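/- **Notation.** For $\nu\notin\mathbb Z$ let $K_\nu(z)=\frac{\pi}{2}\,\frac{I_{-\nu}(z)-I_\nu(z)}{\sin \pi\nu}$ with $I_\nu(z)=\sum_{n\ge 0}\frac{(z/2)^{\nu+2n}}{n!\,\Gamma(\nu+n+1)}$. Let $\zeta(s,\alpha)$ be the (analytically continued) Hurwitz zeta function, and let $\zeta(1,\theta)-\zeta(1,1-\theta)$ denote $\lim_{s\to1}\bigl(\zeta(s,\theta)-\zeta(s,1-\theta)\bigr)$. For $0\le\alpha,\beta\le 1$ put $H_{\alpha,\beta}=\{(n-\alpha)(r-\beta): n,r\in\mathbb N\}$, where $\mathbb N=\{1,2,3,\dots\}$. **Theorem.** Let $\nu\in\mathbb C\setminus\mathbb Z$ with $\operatorname{Re}\nu\ge 0$, and let $N$ be an integer with $N\ge\lfloor(\operatorname{Re}\nu+1)/2\rfloor$. (i) For all real $\theta\in(0,1)$ and $x>0$ with $x\notin H_{\theta,0}\cup H_{1-\theta,0}$, the series over $n$ and the double series over $(d,m)$ below converge absolutely, and $$ \begin{aligned} &8\pi x^{\nu/2}\sum_{n=1}^\infty n^{\nu/2}K_\nu(4\pi\sqrt{nx})\sum_{d\mid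 n}d^{-\nu}\sin(2\pi d\theta) =\frac{\zeta(\nu+1)}{\cos(\pi\nu/2)}\bigl(\zeta(1,\theta)-\zeta(1,1-\theta)\bigr)x^\nu\\ &\quad-\frac{\pi}{2\sin(\pi\nu/2)}\bigl(\zeta(1-\nu,\theta)-\zeta(1-\nu,1-\theta)\bigr) +\frac{1}{2x\cos(\pi\nu/2)}\bigl(\zeta(-\nu,\theta)-\zeta(-\nu,1-\theta)\bigr)\\ &\quad-\frac{1}{\cos(\pi\nu/2)}\sum_{j=1}^N\zeta(2j)\bigl(\zeta(2j-\nu,\theta)-\zeta(2j-\nu,1-\theta)\bigr)x^{2j-1}\\ &\quad-\frac{x^{2N+1}}{\cos(\pi\nu/2)}\sum_{d=1}^\infty d^{-\nu-1}\sum_{m=0}^\infty\left\{\frac{(d(m+\theta))^{\nu+1-2N}-x^{\nu+1-2N}}{(m+\theta)\bigl(d^2(m+\theta)^2-x^2\bigr)}-\frac{(d(m+1-\theta))^{\nu+1-2N}-x^{\nu+1-2N}}{(m+1-\theta)\bigl(d^2(m+1-\theta)^2-x^2\bigr)}\right\}. \end{aligned} $$ (ii) For each such $\nu$ and $N$, statement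 (i) is equivalent to the following: for every $q\ge1$, every odd primitive Dirichlet character $\chi$ modulo $q$ and every real $x>0$ with $qx\notin\{1,2,3,\dots\}$, the two infinite series below converge absolutely, and $$ \begin{aligned} &8\pi x^{\nu/2}\sum_{n=1}^\infty\sigma_{-\nu,\chi}(n)n^{\nu/2}K_\nu(4\pi\sqrt{nx}) =-\frac{\Gamma(\nu)L(\nu,\chi)}{(2\pi)^{\nu-1}}+\frac{2\Gamma(1+\nu)L(1+\nu,\chi)}{(2\pi)^{\nu+1}}x^{-1}\\ &\quad+\frac{i\,q^{1-\nu}}{\tau(\bar\chi)}\left\{\frac{2\zeta(\nu+1)L(1,\bar\chi)(qx)^\nu}{\cos(\pi\nu/2)}-\frac{2}{\cos(\pi\nu/2)}\sum_{j=1}^N\zeta(2j)L(2j-\nu,\bar\chi)(qx)^{2j-1}\right.\\ &\qquad\left.-\frac{2}{\cos(\pi\nu/2)}(qx)^{2N+1}\sum_{n=1}^\infty\bar\sigma_{-\nu,\bar\chi}(n)\frac{n^{\nu+1-2N}-(qx)^{\nu+1-2N}}{n\,(n^2-(qx)^2)}\right\}, \end{aligned} $$ where $\sigma_{-\nu,\chi}(n)=\sum_{d\mid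 n}d^{-\nu}\chi(d)$, $\bar\sigma_{-\nu,\bar\chi}(n)=\sum_{d\mid n}d^{-\nu}\bar\chi(n/d)$ and $\tau(\bar\chi)=\sum_{h=1}^q\bar\chi(h)e^{2\pi i h/q}$. -/

import Mathlib

noncomputable section

namespace CohenSine

/-- The modified Bessel function of the first kind,
`I_ν(z) = ∑_{n ≥ 0} (z/2)^{ν+2n} / (n! Γ(ν+n+1))` (principal branch of the power). -/
def besselI (ν z : ℂ) : ℂ :=
  ∑' n : ℕ, (z / 2) ^ (ν + 2 * n) / ((n.factorial : ℂ) * Complex.Gamma (ν + n + 1))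

/-- The modified Bessel function of the second kind, for `ν ∉ ℤ`:
`K_ν(z) = (π/2) (I_{-ν}(z) - I_ν(z)) / sin(πν)`. -/
def besselK (ν z : ℂ) : ℂ :=
  (Real.pi : ℂ) / 2 * (besselI (-ν) z - besselI ν z) / Complex.sin (Real.pi * ν)

/-- The function `s ↦ ζ(s, θ) - ζ(s, 1 - θ)` for `0 < θ < 1`, with `ζ(s, α)` the (analytically
continued) Hurwitz zeta function. The poles of the two terms at `s = 1` cancel; that the value at
`s = 1` used here is the limit of the difference is `differentiable_hurwitzDiff` below. -/
def hurwitzDiff (θ : ℝ) (s : ℂ) : ℂ :=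
  HurwitzZeta.hurwitzZeta (θ : UnitAddCircle) s
    - HurwitzZeta.hurwitzZeta ((1 - θ : ℝ) : UnitAddCircle) s

/-- `ζ(s, θ) - ζ(s, 1 - θ)` is entire, so its value at `s = 1` is the limiting value. -/
theorem differentiable_hurwitzDiff (θ : ℝ) : Differentiable ℂ (hurwitzDiff θ) :=
  HurwitzZeta.differentiable_hurwitzZeta_sub_hurwitzZeta _ _

/-- For `Re s > 1` the function `hurwitzDiff` is the difference of the two defining series. -/
theorem hurwitzDiff_eq_tsum {θ : ℝ} (h0 : 0 < θ) (h1 : θ < 1) {s : ℂ} (hs : 1 < s.re) :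
    hurwitzDiff θ s =
      (∑' m : ℕ, 1 / ((m : ℂ) + (θ : ℂ)) ^ s)
        - ∑' m : ℕ, 1 / ((m : ℂ) + ((1 - θ : ℝ) : ℂ)) ^ s := by
  rw [hurwitzDiff,
    ← (HurwitzZeta.hasSum_hurwitzZeta_of_one_lt_re ⟨h0.le, h1.le⟩ hs).tsum_eq,
    ← (HurwitzZeta.hasSum_hurwitzZeta_of_one_lt_re
      (a := 1 - θ) ⟨by linarith, by linarith⟩ hs).tsum_eq]

/-- The set `H_{α,β} = {(n - α)(r - β) : n, r ∈ ℕ}` with `n, r ≥ 1`. -/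
def excludedSet (α β : ℝ) : Set ℝ :=
  {y | ∃ n r : ℕ, 0 < n ∧ 0 < r ∧ y = ((n : ℝ) - α) * ((r : ℝ) - β)}

/-- The `n`-th term `n^{ν/2} K_ν(4π√(nx)) ∑_{d ∣ n} d^{-ν} sin(2πdθ)`. -/
def sineSeriesTerm (ν : ℂ) (θ x : ℝ) (n : ℕ+) : ℂ :=
  (n : ℂ) ^ (ν / 2) * besselK ν ((4 * Real.pi * Real.sqrt (n * x) : ℝ) : ℂ)
    * ∑ d ∈ (n : ℕ).divisors, (d : ℂ) ^ (-ν) * ((Real.sin (2 * Real.pi * d * θ) : ℝ) : ℂ)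

/-- The expression `((d y)^{ν+1-2N} - x^{ν+1-2N}) / (y (d² y² - x²))`. -/
def remainderPart (ν : ℂ) (N : ℕ) (x : ℝ) (d : ℕ+) (y : ℝ) : ℂ :=
  (((d * y : ℝ) : ℂ) ^ (ν + 1 - 2 * N) - (x : ℂ) ^ (ν + 1 - 2 * N))
    / ((y * ((d : ℝ) ^ 2 * y ^ 2 - x ^ 2) : ℝ) : ℂ)

/-- The `(d, m)`-th term of the double series. -/
def remainderTerm (ν : ℂ) (N : ℕ) (θ x : ℝ) (d : ℕ+) (m : ℕ) : ℂ :=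
  (d : ℂ) ^ (-ν - 1) * (remainderPart ν N x d (m + θ) - remainderPart ν N x d (m + 1 - θ))

/-- The Cohen-type identity with `sin(2πdθ)`: both infinite series converge absolutely, and the
identity holds. -/
def SineIdentity (ν : ℂ) (N : ℕ) (θ x : ℝ) : Prop :=
  Summable (sineSeriesTerm ν θ x) ∧
  Summable (fun p : ℕ+ × ℕ => remainderTerm ν N θ x p.1 p.2) ∧
  8 * (Real.pi : ℂ) * (x : ℂ) ^ (ν / 2) * ∑' n : ℕ+, sineSeriesTerm ν θ x n =
    1 / Complex.cos (Real.pi * ν / 2) * riemannZeta (ν + 1) * hurwitzDiff θ 1 * (x : ℂ) ^ ν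
    - Real.pi / (2 * Complex.sin (Real.pi * ν / 2)) * hurwitzDiff θ (1 - ν)
    + 1 / (2 * x * Complex.cos (Real.pi * ν / 2)) * hurwitzDiff θ (-ν)
    - 1 / Complex.cos (Real.pi * ν / 2)
        * ∑ j ∈ Finset.Icc 1 N,
            riemannZeta (2 * j) * hurwitzDiff θ (2 * j - ν) * (x : ℂ) ^ (2 * j - 1)
    - 1 / Complex.cos (Real.pi * ν / 2) * (x : ℂ) ^ (2 * N + 1)
        * ∑' d : ℕ+, ∑' m : ℕ, remainderTerm ν N θ x d m

/-- The `n`-th term `σ_{-ν,χ}(n) n^{ν/2} K_ν(4π√(nx))`, where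
`σ_{-ν,χ}(n) = ∑_{d ∣ n} d^{-ν} χ(d)`. -/
def charTerm {q : ℕ} (ν : ℂ) (χ : DirichletCharacter ℂ q) (x : ℝ) (n : ℕ+) : ℂ :=
  (∑ d ∈ (n : ℕ).divisors, (d : ℂ) ^ (-ν) * χ (d : ZMod q))
    * (n : ℂ) ^ (ν / 2) * besselK ν ((4 * Real.pi * Real.sqrt (n * x) : ℝ) : ℂ)

/-- The `n`-th term `σ̄_{-ν,ψ}(n) (n^{ν+1-2N} - X^{ν+1-2N}) / (n (n² - X²))`, where
`σ̄_{-ν,ψ}(n) = ∑_{d ∣ n} d^{-ν} ψ(n/d)`. -/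
def charRemainderTerm {q : ℕ} (ν : ℂ) (N : ℕ) (ψ : DirichletCharacter ℂ q) (X : ℝ) (n : ℕ+) : ℂ :=
  (∑ d ∈ (n : ℕ).divisors, (d : ℂ) ^ (-ν) * ψ (((n : ℕ) / d : ℕ) : ZMod q))
    * (((n : ℂ) ^ (ν + 1 - 2 * N) - (X : ℂ) ^ (ν + 1 - 2 * N)) / (n * ((n : ℂ) ^ 2 - (X : ℂ) ^ 2)))

/-- The Cohen-type identity for a Dirichlet character `χ` modulo `q`. Here `χ⁻¹` is the complex
conjugate character, and `gaussSum χ⁻¹ ZMod.stdAddChar` is `∑_{h mod q} χ⁻¹(h) e^{2πih/q}`. -/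
def CharacterIdentity {q : ℕ} [NeZero q] (ν : ℂ) (N : ℕ) (χ : DirichletCharacter ℂ q) (x : ℝ) :
    Prop :=
  Summable (charTerm ν χ x) ∧
  Summable (charRemainderTerm ν N χ⁻¹ (q * x)) ∧
  8 * (Real.pi : ℂ) * (x : ℂ) ^ (ν / 2) * ∑' n : ℕ+, charTerm ν χ x n =
    -(Complex.Gamma ν * DirichletCharacter.LFunction χ ν / (2 * Real.pi : ℂ) ^ (ν - 1))
    + 2 * Complex.Gamma (1 + ν) * DirichletCharacter.LFunction χ (1 + ν)
        / (2 * Real.pi : ℂ) ^ (ν + 1) * (x : ℂ)⁻¹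
    + Complex.I * (q : ℂ) ^ (1 - ν) / gaussSum χ⁻¹ ZMod.stdAddChar *
      (2 * riemannZeta (ν + 1) * DirichletCharacter.LFunction χ⁻¹ 1 * ((q * x : ℝ) : ℂ) ^ ν
          / Complex.cos (Real.pi * ν / 2)
        - 2 / Complex.cos (Real.pi * ν / 2)
            * ∑ j ∈ Finset.Icc 1 N, riemannZeta (2 * j)
                * DirichletCharacter.LFunction χ⁻¹ (2 * j - ν) * ((q * x : ℝ) : ℂ) ^ (2 * j - 1)
        - 2 / Complex.cos (Real.pi * ν / 2) * ((q * x : ℝ) : ℂ) ^ (2 * N + 1)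
            * ∑' n : ℕ+, charRemainderTerm ν N χ⁻¹ (q * x) n)

end CohenSine

end

noncomputable section

namespace CohenSine

open Set Filter Topology MeasureTheory Asymptotics
open scoped Real

/-! Both sides of the sine identity are two evaluations of one Mellin transform. Put `S(t) = ∑_d
sin(2πdθ) e^{-2πdt}` and `E(u) = ∑_k e^{-2πku}`, and let `M(ν) = ∫₀^∞ t^{ν-1} S(t) E(x/t) dt`. The
integrand decays faster than any power at both ends, so `M` is entire.

Bessel side. Expanding both sums, the `(d, k)` term is a multiple of `∫ t^{ν-1} e^{-t-w/t} dt` with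
`w = 4π²dkx`. That integral equals the power-series definition of `K_ν` (`macdonaldIntegral_eq`),
and grouping by `n = dk` gives `4πM(ν)` as the Bessel series (`tsum_sineSeriesTerm`). The integral
and the series share their derivative rule, recurrence, reflection formula and limit `Γ` at `0⁺`.
Their difference therefore solves a singular first-order system with zero initial data, and it
vanishes by iterated integration.

Zeta side, for `0 < Re ν < 1`. The cotangent expansion gives partial fractions for `S` and for `E(u)
+ 1/2 - 1/(2πu)`. Termwise integration of products of such fractions gives the double series with `N
= 0` together with the `ζ(ν+1)` term. The corrections `1/2` and `1/(2πu)` leave Mellin transforms of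
`S` at `ν` and `ν + 1`, which Hurwitz's formula turns into the two remaining zeta terms
(`mellin_productKernel_eq_sineRHS_zero`). An algebraic identity for one summand moves `N` to `N + 1`
without changing the right side (`sineRHS_succ`). For given `N` that side is holomorphic in `-1 < Re
ν < 2N + 1` away from the integers, so analytic continuation covers every admissible order
(`mellin_productKernel_eq_sineRHS`).

For an odd primitive `χ` modulo `q`, a Gauss sum writes `χ(d)` as a combination of the `sin(2πdj/q)`
with weights `χ⁻¹(j)`. The same combination of the sine identities at `θ = j/q`, with the functional
equation of `L(s, χ)`, is the character identity (`characterIdentity_of_sineIdentity`). The converse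
implication in (ii) needs no argument from characters, since (i) is proved outright. -/

/-! ### The series `∑ zⁿ / (n! Γ(c + n))` -/

/-- The regularized confluent hypergeometric limit function `₀F₁(c; z) / Γ(c)`. -/
def hypSeries (c z : ℂ) : ℂ :=
  ∑' n : ℕ, z ^ n / ((n.factorial : ℂ) * Complex.Gamma (c + n))

/-- These are the coefficients of the regularized `₀F₁`, whose radius of convergence is infinite. At
a pole of `Γ` the convention `Γ = 0`, `1 / 0 = 0` gives the right value of the entire function `1 /
Γ`, so `c` is unrestricted. -/
theorem summable_hypCoeff (c : ℂ) (r : NNReal) :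
    Summable fun n : ℕ => ‖1 / ((n.factorial : ℂ) * Complex.Gamma (c + n))‖ * (r : ℝ) ^ n := by
  have h := (Complex.regularizedHGFunSeries 0 {c}).summable_norm_mul_pow (r := r) (by
    rw [Complex.radius_regularizedHGFunSeries_eq_top (by simp)]
    exact ENNReal.coe_lt_top)
  refine h.congr fun n => ?_
  rw [Complex.regularizedHGFunSeries, FormalMultilinearSeries.ofScalars_norm,
    Complex.regularizedHGFunCoeff]
  simp

theorem summable_hypSeries (c z : ℂ) :
    Summable fun n : ℕ => z ^ n / ((n.factorial : ℂ) * Complex.Gamma (c + n)) := by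
  refine Summable.of_norm ((summable_hypCoeff c ‖z‖₊).congr fun n => ?_)
  rw [norm_div, norm_div, norm_pow, coe_nnnorm, norm_one]
  ring

theorem hasDerivAt_hypSeries (c z : ℂ) :
    HasDerivAt (hypSeries c) (hypSeries (c + 1) z) z := by
  set r : ℝ := ‖z‖ + 1 with hr
  have hr0 : 0 ≤ r := by positivity
  have key : HasDerivAt
      (fun z => ∑' n : ℕ, z ^ n / ((n.factorial : ℂ) * Complex.Gamma (c + n)))
      (∑' n : ℕ, (n * z ^ (n - 1)) / ((n.factorial : ℂ) * Complex.Gamma (c + n))) z := by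
    have hsum : Summable fun n : ℕ =>
        ‖(n : ℂ) / ((n.factorial : ℂ) * Complex.Gamma (c + n))‖ * r ^ (n - 1) := by
      rw [← summable_nat_add_iff 1]
      refine (summable_hypCoeff (c + 1) ⟨r, hr0⟩).congr fun n => ?_
      congr 2
      have h1 : ((n : ℂ) + 1) ≠ 0 := by exact_mod_cast Nat.succ_ne_zero n
      rw [Nat.factorial_succ]
      push_cast
      rw [show c + 1 + (n : ℂ) = c + (n + 1) by ring, mul_assoc, div_mul_eq_div_div _ _ (_ * _),
        div_self h1]
    refine hasDerivAt_tsum_of_isPreconnected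
      (g := fun (n : ℕ) z => z ^ n / ((n.factorial : ℂ) * Complex.Gamma (c + n)))
      (g' := fun (n : ℕ) z => (n * z ^ (n - 1)) / ((n.factorial : ℂ) * Complex.Gamma (c + n)))
      hsum (t := Metric.ball (0 : ℂ) r)
      Metric.isOpen_ball (convex_ball (0 : ℂ) r).isPreconnected ?_ ?_ (y₀ := 0) ?_ ?_ ?_
    · intro n y _
      exact (hasDerivAt_pow n y).div_const _
    · intro n y hy
      rw [mem_ball_zero_iff] at hy
      rw [norm_div, norm_mul, norm_pow, norm_div, mul_div_right_comm]
      gcongr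
    · simpa using (by positivity : 0 < r)
    · exact summable_hypSeries c 0
    · simp [hr]
  refine HasDerivAt.congr_deriv (f := hypSeries c) key ?_
  have hs : Summable fun n : ℕ =>
      ((n : ℂ) * z ^ (n - 1)) / ((n.factorial : ℂ) * Complex.Gamma (c + n)) := by
    rw [← summable_nat_add_iff 1]
    refine (summable_hypSeries (c + 1) z).congr fun n => ?_
    have h1 : ((n : ℂ) + 1) ≠ 0 := by exact_mod_cast Nat.succ_ne_zero n
    rw [Nat.factorial_succ, Nat.add_sub_cancel]
    push_cast
    rw [show c + 1 + (n : ℂ) = c + (n + 1) by ring, mul_assoc, mul_div_mul_left _ _ h1]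
  rw [hs.tsum_eq_zero_add, hypSeries]
  simp only [Nat.cast_zero, zero_mul, zero_div, zero_add]
  refine tsum_congr fun n => ?_
  have h1 : ((n : ℂ) + 1) ≠ 0 := by exact_mod_cast Nat.succ_ne_zero n
  rw [Nat.factorial_succ, Nat.add_sub_cancel]
  push_cast
  rw [show c + 1 + (n : ℂ) = c + (n + 1) by ring, mul_assoc, mul_div_mul_left _ _ h1]

/-- Contiguous relation: write `1/Γ(c+n) = (c+n)/Γ(c+n+1)` and split `c + n`; the part with `n`
cancels against `n!` and shifts the index. -/
theorem hypSeries_eq_add (c z : ℂ) :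
    hypSeries c z = c * hypSeries (c + 1) z + z * hypSeries (c + 2) z := by
  have hs : Summable fun n : ℕ => (n : ℂ) * z ^ n /
      ((n.factorial : ℂ) * Complex.Gamma (c + 1 + n)) := by
    rw [← summable_nat_add_iff 1]
    refine ((summable_hypSeries (c + 2) z).mul_left z).congr fun n => ?_
    have h1 : ((n : ℂ) + 1) ≠ 0 := by exact_mod_cast Nat.succ_ne_zero n
    rw [Nat.factorial_succ, pow_succ]
    push_cast
    rw [show c + 1 + ((n : ℂ) + 1) = c + 2 + n by ring, mul_assoc ((n : ℂ) + 1),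
      mul_div_mul_left _ _ h1]
    ring
  have h2 : z * hypSeries (c + 2) z = ∑' n : ℕ, (n : ℂ) * z ^ n /
      ((n.factorial : ℂ) * Complex.Gamma (c + 1 + n)) := by
    rw [hs.tsum_eq_zero_add, hypSeries, ← tsum_mul_left]
    simp only [Nat.cast_zero, zero_mul, zero_div, zero_add]
    refine tsum_congr fun n => ?_
    have h1 : ((n : ℂ) + 1) ≠ 0 := by exact_mod_cast Nat.succ_ne_zero n
    rw [Nat.factorial_succ, pow_succ]
    push_cast
    rw [show c + 1 + ((n : ℂ) + 1) = c + 2 + n by ring, mul_assoc ((n : ℂ) + 1),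
      mul_div_mul_left _ _ h1]
    ring
  rw [h2, hypSeries, hypSeries, ← tsum_mul_left,
    ← ((summable_hypSeries (c + 1) z).mul_left c).tsum_add hs]
  refine tsum_congr fun n => ?_
  rw [div_eq_mul_inv, mul_inv, Complex.one_div_Gamma_eq_self_mul_one_div_Gamma_add_one,
    show c + n + 1 = c + 1 + n by ring]
  simp only [div_eq_mul_inv, mul_inv]
  ring

/-- `π / sin (πν) · (₀F₁(1 - ν; w) / Γ(1 - ν) - w^ν ₀F₁(1 + ν; w) / Γ(1 + ν))`, which is
`2 (z / 2) ^ ν K_ν(z)` for `w = z² / 4`. -/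
def macdonaldSeries (ν : ℂ) (w : ℝ) : ℂ :=
  π / Complex.sin (π * ν) *
    (hypSeries (1 - ν) w - (w : ℂ) ^ ν * hypSeries (1 + ν) w)

theorem sin_pi_mul_add_one (ν : ℂ) : Complex.sin (π * (ν + 1)) = -Complex.sin (π * ν) := by
  rw [mul_add, mul_one, Complex.sin_add_pi]

theorem sin_pi_mul_sub_one (ν : ℂ) : Complex.sin (π * (ν - 1)) = -Complex.sin (π * ν) := by
  rw [mul_sub, mul_one, Complex.sin_sub_pi]

/-- The three-term recurrence of `K_ν`, from the contiguous relation at `-ν` and at `ν`. At integer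
`ν` every term is `0` because of the division by `sin(πν)`. -/
theorem macdonaldSeries_add_one (ν : ℂ) {w : ℝ} (hw : 0 < w) :
    macdonaldSeries (ν + 1) w = ν * macdonaldSeries ν w + w * macdonaldSeries (ν - 1) w := by
  have hw' : (w : ℂ) ≠ 0 := by exact_mod_cast hw.ne'
  have h1 := hypSeries_eq_add (-ν) w
  have h2 := hypSeries_eq_add ν w
  simp only [macdonaldSeries, sin_pi_mul_add_one, sin_pi_mul_sub_one]
  rw [show 1 - (ν + 1) = -ν by ring, show 1 + (ν + 1) = ν + 2 by ring,
    show 1 - (ν - 1) = -ν + 2 by ring, show 1 + (ν - 1) = ν by ring, h1, h2,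
    Complex.cpow_add _ _ hw', Complex.cpow_sub _ _ hw', Complex.cpow_one,
    show -ν + 1 = 1 - ν by ring, show 1 + ν = ν + 1 by ring]
  field_simp
  ring

theorem hasDerivAt_macdonaldSeries {ν : ℂ} (hν : ν ≠ 0) {w : ℝ} (hw : 0 < w) :
    HasDerivAt (macdonaldSeries ν) (-macdonaldSeries (ν - 1) w) w := by
  have hw' : (w : ℂ) ≠ 0 := by exact_mod_cast hw.ne'
  have h1 := (hasDerivAt_hypSeries (1 - ν) w).comp_ofReal
  have h2 := (hasDerivAt_hypSeries (1 + ν) w).comp_ofReal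
  have h3 := hasDerivAt_ofReal_cpow_const hw.ne' hν
  have := (h1.sub (h3.mul h2)).const_mul (π / Complex.sin (π * ν))
  refine this.congr_deriv ?_
  have h4 := hypSeries_eq_add ν w
  simp only [macdonaldSeries, sin_pi_mul_sub_one]
  rw [show 1 - (ν - 1) = 1 - ν + 1 by ring, show 1 + (ν - 1) = ν by ring, h4,
    show 1 + ν + 1 = ν + 2 by ring, show 1 + ν = ν + 1 by ring,
    Complex.cpow_sub _ _ hw', Complex.cpow_one]
  field_simp

theorem besselI_eq (ν : ℂ) {z : ℝ} (hz : 0 < z) :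
    besselI ν z = ((z / 2 : ℝ) : ℂ) ^ ν * hypSeries (1 + ν) ((z ^ 2 / 4 : ℝ) : ℂ) := by
  have hz' : ((z / 2 : ℝ) : ℂ) ≠ 0 := by exact_mod_cast (by positivity : z / 2 ≠ 0)
  rw [besselI, hypSeries, ← tsum_mul_left]
  refine tsum_congr fun n => ?_
  rw [show ((z : ℂ) / 2) = ((z / 2 : ℝ) : ℂ) by push_cast; ring, Complex.cpow_add _ _ hz',
    show (2 * (n : ℂ)) = ((2 * n : ℕ) : ℂ) by push_cast; ring, Complex.cpow_natCast, pow_mul,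
    show ν + n + 1 = 1 + ν + n by ring, mul_div_assoc]
  congr 3
  push_cast
  ring

theorem besselK_eq (ν : ℂ) {z : ℝ} (hz : 0 < z) :
    besselK ν z = 1 / 2 * ((z / 2 : ℝ) : ℂ) ^ (-ν) * macdonaldSeries ν (z ^ 2 / 4) := by
  have hz' : ((z / 2 : ℝ) : ℂ) ≠ 0 := by exact_mod_cast (by positivity : z / 2 ≠ 0)
  have h : (((z ^ 2 / 4 : ℝ) : ℂ)) ^ ν = ((z / 2 : ℝ) : ℂ) ^ ν * ((z / 2 : ℝ) : ℂ) ^ ν := by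
    rw [show z ^ 2 / 4 = (z / 2) * (z / 2) by ring, Complex.ofReal_mul,
      Complex.mul_cpow_ofReal_nonneg (by positivity) (by positivity)]
  have h2 : ((z / 2 : ℝ) : ℂ) ^ ν ≠ 0 := by
    rw [Ne, Complex.cpow_eq_zero_iff]; tauto
  rw [besselK, besselI_eq _ hz, besselI_eq _ hz, macdonaldSeries, h, ← sub_eq_add_neg,
    Complex.cpow_neg]
  field_simp

theorem macdonaldSeries_neg (ν : ℂ) {w : ℝ} (hw : 0 < w) :
    macdonaldSeries (-ν) w = (w : ℂ) ^ (-ν) * macdonaldSeries ν w := by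
  have hw' : (w : ℂ) ≠ 0 := by exact_mod_cast hw.ne'
  have h2 : (w : ℂ) ^ ν ≠ 0 := by rw [Ne, Complex.cpow_eq_zero_iff]; tauto
  rw [macdonaldSeries, macdonaldSeries, mul_neg, Complex.sin_neg, Complex.cpow_neg, sub_neg_eq_add,
    ← sub_eq_add_neg, div_neg]
  field_simp
  ring

theorem tendsto_ofReal_cpow_nhdsGT_zero {s : ℂ} (hs : 0 < s.re) :
    Tendsto (fun w : ℝ => (w : ℂ) ^ s) (𝓝[>] 0) (𝓝 0) := by
  have h := (Complex.continuousAt_ofReal_cpow_const 0 s (Or.inl hs)).tendsto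
  rw [Complex.ofReal_zero, Complex.zero_cpow (by rintro rfl; simp at hs)] at h
  exact h.mono_left nhdsWithin_le_nhds

/-- The term with `w^s` disappears and leaves `π / (sin(πs) Γ(1-s))`, which is `Γ(s)` by reflection.
-/
theorem tendsto_macdonaldSeries {s : ℂ} (hs : 0 < s.re) (hsin : Complex.sin (π * s) ≠ 0) :
    Tendsto (macdonaldSeries s) (𝓝[>] 0) (𝓝 (Complex.Gamma s)) := by
  have hc (c : ℂ) : Tendsto (fun w : ℝ => hypSeries c w) (𝓝[>] 0) (𝓝 (Complex.Gamma c)⁻¹) := by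
    have h := (hasDerivAt_hypSeries c ((0 : ℝ) : ℂ)).comp_ofReal.continuousAt.tendsto
    have h0 : hypSeries c ((0 : ℝ) : ℂ) = (Complex.Gamma c)⁻¹ := by
      rw [hypSeries, tsum_eq_single 0 (by intro n hn; simp [hn])]
      simp
    rw [h0] at h
    exact h.mono_left nhdsWithin_le_nhds
  have h := ((hc (1 - s)).sub ((tendsto_ofReal_cpow_nhdsGT_zero hs).mul (hc (1 + s)))).const_mul
    (π / Complex.sin (π * s))
  refine h.trans (le_of_eq ?_)
  have h1 := Complex.Gamma_mul_Gamma_one_sub s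
  have h2 : Complex.Gamma (1 - s) ≠ 0 := by
    intro h
    rw [h, mul_zero, eq_comm, div_eq_zero_iff] at h1
    exact h1.elim (by simp [Real.pi_ne_zero]) hsin
  rw [← h1]
  congr 1
  field_simp
  ring

/-! ### The integral `∫ t^(ν-1) exp (-t - w/t) dt` -/

/-- The integral `∫₀^∞ t^(ν-1) exp (-t - w/t) dt`. -/
def macdonaldIntegral (ν : ℂ) (w : ℝ) : ℂ :=
  mellin (fun t => ((Real.exp (-t - w / t) : ℝ) : ℂ)) ν

theorem isBigO_exp_neg_atTop (b : ℝ) {c : ℝ} (hc : 0 < c) {w : ℝ} (hw : 0 ≤ w) :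
    (fun t : ℝ => Real.exp (-c * t - w / t)) =O[atTop] fun t => t ^ b := by
  refine IsBigO.trans (IsBigO.of_bound 1 ?_) (isLittleO_exp_neg_mul_rpow_atTop hc b).isBigO
  filter_upwards [eventually_gt_atTop 0] with t ht
  rw [Real.norm_eq_abs, Real.norm_eq_abs, Real.abs_exp, Real.abs_exp, one_mul, Real.exp_le_exp]
  have : 0 ≤ w / t := by positivity
  linarith

/-- Here `e^{-w/t}` does the work: it is exponential decay at infinity after `t ↦ 1/t`. With the
decay at infinity, the Mellin transform exists at every `s`. -/
theorem isBigO_exp_neg_div_nhdsGT_zero (b : ℝ) {c : ℝ} (hc : 0 ≤ c) {w : ℝ} (hw : 0 < w) :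
    (fun t : ℝ => Real.exp (-c * t - w / t)) =O[𝓝[>] 0] fun t => t ^ b := by
  have h := (isLittleO_exp_neg_mul_rpow_atTop hw (-b)).isBigO.comp_tendsto tendsto_inv_nhdsGT_zero
  refine (IsBigO.trans (IsBigO.of_bound 1 ?_) h).trans (IsBigO.of_bound 1 ?_)
  · filter_upwards [self_mem_nhdsWithin] with t ht
    have ht : 0 < t := ht
    rw [Real.norm_eq_abs, Real.norm_eq_abs, Real.abs_exp, one_mul, Function.comp_apply,
      Real.abs_exp, Real.exp_le_exp, div_eq_mul_inv]
    have : 0 ≤ c * t := by positivity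
    linarith
  · filter_upwards [self_mem_nhdsWithin] with t ht
    have ht : 0 < t := ht
    rw [Function.comp_apply, Real.inv_rpow ht.le, ← Real.rpow_neg ht.le, neg_neg, one_mul]

theorem continuousOn_exp_neg_sub_div (c w : ℝ) :
    ContinuousOn (fun t : ℝ => Real.exp (-c * t - w / t)) (Ioi 0) := by
  refine Real.continuous_exp.comp_continuousOn (ContinuousOn.sub (by fun_prop) ?_)
  exact continuousOn_const.div continuousOn_id fun t ht => (ne_of_gt ht)

theorem mellinConvergent_exp_neg_sub_div (s : ℂ) {c w : ℝ} (hc : 0 < c) (hw : 0 < w) :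
    MellinConvergent (fun t => ((Real.exp (-c * t - w / t) : ℝ) : ℂ)) s := by
  refine mellinConvergent_of_isBigO_rpow (a := s.re + 1) (b := s.re - 1) ?_ ?_ (by linarith) ?_
    (by linarith)
  · exact (Complex.continuous_ofReal.comp_continuousOn
      (continuousOn_exp_neg_sub_div c w)).locallyIntegrableOn measurableSet_Ioi
  · exact Complex.isBigO_ofReal_left.mpr (isBigO_exp_neg_atTop _ hc hw.le)
  · exact Complex.isBigO_ofReal_left.mpr (isBigO_exp_neg_div_nhdsGT_zero _ hc.le hw)

theorem mellinConvergent_macdonald (s : ℂ) {w : ℝ} (hw : 0 < w) :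
    MellinConvergent (fun t => ((Real.exp (-t - w / t) : ℝ) : ℂ)) s := by
  simpa using mellinConvergent_exp_neg_sub_div s one_pos hw

theorem hasDerivAt_macdonaldIntegral (ν : ℂ) {w : ℝ} (hw : 0 < w) :
    HasDerivAt (macdonaldIntegral ν) (-macdonaldIntegral (ν - 1) w) w := by
  have hmeas (ν : ℂ) {w : ℝ} (hw : 0 < w) := (mellinConvergent_macdonald ν hw).1
  have h := hasDerivAt_integral_of_dominated_loc_of_deriv_le (𝕜 := ℝ) (μ := volume.restrict (Ioi (0 : ℝ)))
    (F := fun (w : ℝ) (t : ℝ) => (t : ℂ) ^ (ν - 1) • ((Real.exp (-t - w / t) : ℝ) : ℂ))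
    (F' := fun (w : ℝ) (t : ℝ) => -((t : ℂ) ^ (ν - 1 - 1) • ((Real.exp (-t - w / t) : ℝ) : ℂ)))
    -- On the neighbourhood `v > w/2` the factor `e^{-v/t}` is at most `e^{-(w/2)/t}`, so the
    -- integrand at `w/2` dominates.
    (bound := fun t => ‖(t : ℂ) ^ (ν - 1 - 1) • ((Real.exp (-t - w / 2 / t) : ℝ) : ℂ)‖)
    (s := Ioi (w / 2)) (x₀ := w) (Ioi_mem_nhds (by linarith)) ?_
    (mellinConvergent_macdonald ν hw) (hmeas (ν - 1) hw).neg ?_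
    (mellinConvergent_macdonald (ν - 1) (half_pos hw)).norm ?_
  · have := h.2
    rw [integral_neg] at this
    exact this
  · filter_upwards [lt_mem_nhds hw] with v hv using hmeas ν hv
  · filter_upwards [self_mem_ae_restrict measurableSet_Ioi] with t ht v hv
    have ht : 0 < t := ht
    have hv : w / 2 < v := hv
    rw [norm_neg, norm_smul, norm_smul]
    refine mul_le_mul_of_nonneg_left ?_ (norm_nonneg _)
    rw [Complex.norm_real, Complex.norm_real, Real.norm_eq_abs, Real.norm_eq_abs, Real.abs_exp,
      Real.abs_exp, Real.exp_le_exp]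
    gcongr
  · filter_upwards [self_mem_ae_restrict measurableSet_Ioi] with t ht v hv
    have ht : 0 < t := ht
    have ht' : (t : ℂ) ≠ 0 := by exact_mod_cast ht.ne'
    have h1 : HasDerivAt (fun v : ℝ => Real.exp (-t - v / t)) (Real.exp (-t - v / t) * -(1 / t)) v :=
      (((hasDerivAt_id v).div_const t).const_sub (-t)).exp
    refine (h1.ofReal_comp.const_mul ((t : ℂ) ^ (ν - 1))).congr_deriv ?_
    rw [Complex.cpow_sub (ν - 1) 1 ht', Complex.cpow_one, smul_eq_mul]
    push_cast
    field_simp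

/-- The exponent `-t - w/t` is invariant under `t ↦ w/t`. -/
theorem macdonaldIntegral_neg (ν : ℂ) {w : ℝ} (hw : 0 < w) :
    macdonaldIntegral (-ν) w = (w : ℂ) ^ (-ν) * macdonaldIntegral ν w := by
  have h1 := mellin_comp_inv (fun t => ((Real.exp (-t - w / t) : ℝ) : ℂ)) ν
  have h2 := mellin_comp_mul_left (fun t => ((Real.exp (-t - w / t) : ℝ) : ℂ)) ν hw
  rw [macdonaldIntegral, ← h1, macdonaldIntegral, ← smul_eq_mul, ← h2]
  refine setIntegral_congr_fun measurableSet_Ioi fun t ht => ?_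
  have ht : 0 < t := ht
  have h : -t⁻¹ - w / t⁻¹ = -(w * t) - w / (w * t) := by
    field_simp
    ring
  simp only [h]

/-- Integrate the derivative of `t^ν e^{-t-w/t}` over the half-line; both boundary values vanish. -/
theorem macdonaldIntegral_add_one {ν : ℂ} (hν : ν ≠ 0) {w : ℝ} (hw : 0 < w) :
    macdonaldIntegral (ν + 1) w = ν * macdonaldIntegral ν w + w * macdonaldIntegral (ν - 1) w := by
  have c0 := mellinConvergent_macdonald (ν + 1) hw
  have c1 := mellinConvergent_macdonald ν hw
  have c2 := mellinConvergent_macdonald (ν - 1) hw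
  have hv (t : ℝ) (ht : 0 < t) : HasDerivAt (fun t : ℝ => ((Real.exp (-t - w / t) : ℝ) : ℂ))
      (((Real.exp (-t - w / t) * (-1 + w / t ^ 2) : ℝ)) : ℂ) t := by
    refine HasDerivAt.ofReal_comp ?_
    have := (((hasDerivAt_id t).neg).sub ((hasDerivAt_const t w).div (hasDerivAt_id t) ht.ne')).exp
    refine this.congr_deriv ?_
    simp
    ring
  have e (t : ℝ) (ht : t ∈ Ioi (0 : ℝ)) :
      ν * (t : ℂ) ^ (ν - 1) * ((Real.exp (-t - w / t) : ℝ) : ℂ)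
        + (t : ℂ) ^ ν * (((Real.exp (-t - w / t) * (-1 + w / t ^ 2) : ℝ)) : ℂ)
      = (ν * ((t : ℂ) ^ (ν - 1) • ((Real.exp (-t - w / t) : ℝ) : ℂ))
        - (t : ℂ) ^ (ν + 1 - 1) • ((Real.exp (-t - w / t) : ℝ) : ℂ))
        + w * ((t : ℂ) ^ (ν - 1 - 1) • ((Real.exp (-t - w / t) : ℝ) : ℂ)) := by
    have ht' : (t : ℂ) ≠ 0 := by exact_mod_cast (ne_of_gt ht)
    rw [add_sub_cancel_right, Complex.cpow_sub (ν - 1) 1 ht', Complex.cpow_sub ν 1 ht',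
      Complex.cpow_one]
    simp only [smul_eq_mul]
    push_cast
    field_simp
    ring
  have hint : IntegrableOn (fun t : ℝ =>
      (ν * ((t : ℂ) ^ (ν - 1) • ((Real.exp (-t - w / t) : ℝ) : ℂ))
        - (t : ℂ) ^ (ν + 1 - 1) • ((Real.exp (-t - w / t) : ℝ) : ℂ))
        + w * ((t : ℂ) ^ (ν - 1 - 1) • ((Real.exp (-t - w / t) : ℝ) : ℂ))) (Ioi 0) :=
    ((c1.const_mul ν).sub c0).add (c2.const_mul (w : ℂ))
  -- Both boundary limits at once: later `p` is chosen so that `Re ν + p` is `1` at the origin and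
  -- `-1` at infinity.
  have hz (l : Filter ℝ) (hl : ∀ᶠ t in l, 0 < t) (p : ℝ)
      (hO : (fun t : ℝ => Real.exp (-1 * t - w / t)) =O[l] fun t => t ^ p)
      (h0 : Tendsto (fun t : ℝ => t ^ (ν.re + p)) l (𝓝 0)) :
      Tendsto ((fun t : ℝ => (t : ℂ) ^ ν) * fun t : ℝ => ((Real.exp (-t - w / t) : ℝ) : ℂ))
        l (𝓝 0) := by
    have h1 : (fun t : ℝ => (t : ℂ) ^ ν) =O[l] fun t => t ^ ν.re := by
      refine IsBigO.of_bound 1 ?_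
      filter_upwards [hl] with t ht
      rw [Complex.norm_cpow_eq_rpow_re_of_pos ht, one_mul]
      exact le_abs_self _
    have h2 : (fun t : ℝ => ((Real.exp (-t - w / t) : ℝ) : ℂ)) =O[l] fun t => t ^ p := by
      simpa using Complex.isBigO_ofReal_left.mpr hO
    refine ((h1.mul h2).congr' EventuallyEq.rfl ?_).trans_tendsto h0
    filter_upwards [hl] with t ht
    rw [Real.rpow_add ht]
  have key := integral_Ioi_deriv_mul_eq_sub (a := (0 : ℝ)) (a' := (0 : ℂ)) (b' := 0)
    (u := fun t : ℝ => (t : ℂ) ^ ν) (u' := fun t : ℝ => ν * (t : ℂ) ^ (ν - 1))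
    (v := fun t : ℝ => ((Real.exp (-t - w / t) : ℝ) : ℂ))
    (v' := fun t : ℝ => (((Real.exp (-t - w / t) * (-1 + w / t ^ 2) : ℝ)) : ℂ))
    (fun t ht => hasDerivAt_ofReal_cpow_const (ne_of_gt ht) hν) (fun t ht => hv t ht)
    (hint.congr_fun (fun t ht => (e t ht).symm) measurableSet_Ioi)
    (hz _ self_mem_nhdsWithin (-ν.re + 1) (isBigO_exp_neg_div_nhdsGT_zero _ zero_le_one hw) (by
      simp only [← add_assoc, add_neg_cancel, zero_add, Real.rpow_one]
      exact tendsto_id.mono_left nhdsWithin_le_nhds))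
    (hz _ (eventually_gt_atTop 0) (-ν.re - 1) (isBigO_exp_neg_atTop _ one_pos hw.le) (by
      simp only [add_sub, add_neg_cancel, zero_sub]
      exact tendsto_rpow_neg_atTop one_pos))
  have k1 := integral_add (μ := volume.restrict (Ioi 0)) ((c1.const_mul ν).sub c0)
    (c2.const_mul (w : ℂ))
  have k2 := integral_sub (μ := volume.restrict (Ioi 0)) (c1.const_mul ν) c0
  rw [integral_const_mul] at k1 k2
  rw [setIntegral_congr_fun measurableSet_Ioi e, sub_zero] at key
  have k3 := k1.symm.trans key
  simp only [Pi.sub_apply] at k3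
  simp only [macdonaldIntegral, mellin]
  linear_combination k2 - k3

theorem tendsto_macdonaldIntegral {s : ℂ} (hs : 0 < s.re) :
    Tendsto (macdonaldIntegral s) (𝓝[>] 0) (𝓝 (Complex.Gamma s)) := by
  rw [Complex.Gamma_eq_integral hs, Complex.GammaIntegral]
  refine tendsto_integral_filter_of_dominated_convergence
    (fun x => ‖((Real.exp (-x) : ℝ) : ℂ) * (x : ℂ) ^ (s - 1)‖) ?_ ?_
    (Complex.GammaIntegral_convergent hs).norm ?_
  · filter_upwards [self_mem_nhdsWithin] with w hw using (mellinConvergent_macdonald s hw).1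
  · filter_upwards [self_mem_nhdsWithin] with w hw
    filter_upwards [self_mem_ae_restrict measurableSet_Ioi] with t ht
    have ht : 0 < t := ht
    have hw : 0 < w := hw
    rw [norm_smul, norm_mul, mul_comm]
    refine mul_le_mul_of_nonneg_right ?_ (norm_nonneg _)
    rw [Complex.norm_real, Complex.norm_real, Real.norm_eq_abs, Real.norm_eq_abs, Real.abs_exp,
      Real.abs_exp, Real.exp_le_exp]
    have : 0 ≤ w / t := by positivity
    linarith
  · filter_upwards with t
    have h : Continuous fun w : ℝ => (t : ℂ) ^ (s - 1) • ((Real.exp (-t - w / t) : ℝ) : ℂ) := by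
      fun_prop
    have := (h.tendsto 0).mono_left (nhdsWithin_le_nhds (s := Ioi 0))
    simpa [mul_comm] using this

/-! ### Identification of the integral with the series -/

/-- Integrate the bound from `ε` to `r` and let `ε → 0⁺`. The derivative may be singular at `0`;
only `p > 0` is needed. -/
theorem norm_le_of_norm_deriv_le_rpow {f f' : ℝ → ℂ} {C p W : ℝ} (hC : 0 ≤ C) (hp : 0 < p)
    (hd : ∀ r ∈ Ioc 0 W, HasDerivAt f (f' r) r) (hlim : Tendsto f (𝓝[>] 0) (𝓝 0))
    (hb : ∀ r ∈ Ioc 0 W, ‖f' r‖ ≤ C * r ^ (p - 1)) :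
    ∀ r ∈ Ioc 0 W, ‖f r‖ ≤ C / p * r ^ p := by
  intro r hr
  have hle : ∀ᶠ ε in 𝓝[>] (0 : ℝ), ‖f r‖ ≤ ‖f ε‖ + C / p * r ^ p := by
    filter_upwards [Ioo_mem_nhdsGT hr.1] with ε hε
    have hsub : ∀ x ∈ Icc ε r, x ∈ Ioc 0 W := fun x hx =>
      ⟨hε.1.trans_le hx.1, hx.2.trans hr.2⟩
    have hB : ∀ x ∈ Icc ε r, HasDerivAt (fun x : ℝ => ‖f ε‖ + C / p * (x ^ p - ε ^ p))
        (C * x ^ (p - 1)) x := by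
      intro x hx
      have h := (((Real.hasDerivAt_rpow_const (x := x) (p := p)
        (Or.inl (hsub x hx).1.ne')).sub_const (ε ^ p)).const_mul (C / p)).const_add ‖f ε‖
      refine h.congr_deriv ?_
      field_simp
    have h := image_norm_le_of_norm_deriv_right_le_deriv_boundary' (f := f) (f' := f')
      (a := ε) (b := r) (B := fun x => ‖f ε‖ + C / p * (x ^ p - ε ^ p))
      (B' := fun x => C * x ^ (p - 1))
      (fun x hx => (hd x (hsub x hx)).continuousAt.continuousWithinAt)
      (fun x hx => (hd x (hsub x (Ico_subset_Icc_self hx))).hasDerivWithinAt)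
      (by simp)
      (fun x hx => (hB x hx).continuousAt.continuousWithinAt)
      (fun x hx => (hB x (Ico_subset_Icc_self hx)).hasDerivWithinAt)
      (fun x hx => hb x (hsub x (Ico_subset_Icc_self hx)))
      (x := r) ⟨hε.2.le, le_rfl⟩
    refine h.trans ?_
    have h1 : 0 ≤ ε ^ p := Real.rpow_nonneg hε.1.le p
    have h2 : 0 ≤ C / p := by positivity
    nlinarith
  have := ge_of_tendsto (hlim.norm.add_const (C / p * r ^ p)) hle
  simpa using this

/-- Picard iteration at a singular point. With `δ = 1 - Re μ > 0`, a bound `A r^n` on `D` gives `A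
r^{n+δ}/(n+δ)` on `E`, and then `A r^{n+1}/((n+δ)(n+1))` on `D`. Since `n + δ ≥ δ`, iteration gives
`C r^n / (n! δ^n)`, which tends to `0`. -/
theorem eq_zero_of_bessel_system {D E : ℝ → ℂ} {μ : ℂ} (h1 : μ.re < 1)
    (hD : ∀ w : ℝ, 0 < w → HasDerivAt D ((w : ℂ) ^ (μ - 1) * E w) w)
    (hE : ∀ w : ℝ, 0 < w → HasDerivAt E ((w : ℂ) ^ (-μ) * D w) w)
    (hD0 : Tendsto D (𝓝[>] 0) (𝓝 0)) (hE0 : Tendsto E (𝓝[>] 0) (𝓝 0))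
    {W : ℝ} (hW : 0 < W) : D W = 0 := by
  -- The iteration starts from boundedness: near `0` it comes from the limit, on `[η, W]` from
  -- compactness.
  obtain ⟨C, hC0, hC⟩ : ∃ C : ℝ, 0 ≤ C ∧ ∀ r ∈ Ioc 0 W, ‖D r‖ ≤ C := by
    have h2 : ∀ᶠ w in 𝓝[>] (0 : ℝ), ‖D w‖ ≤ 1 := by
      have := hD0.norm
      rw [norm_zero] at this
      filter_upwards [this.eventually (gt_mem_nhds one_pos)] with w hw using hw.le
    obtain ⟨η, hη, hη2⟩ := mem_nhdsGT_iff_exists_Ioo_subset.mp h2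
    have hη : 0 < η := hη
    obtain ⟨K, hK⟩ := (isCompact_Icc (a := η) (b := W)).exists_bound_of_continuousOn (f := D)
      fun x hx => (hD x (hη.trans_le hx.1)).continuousAt.continuousWithinAt
    refine ⟨max 1 K, by positivity, fun r hr => ?_⟩
    rcases lt_or_ge r η with h | h
    · exact (hη2 ⟨hr.1, h⟩ : ‖D r‖ ≤ 1).trans (le_max_left _ _)
    · exact (hK r ⟨h, hr.2⟩).trans (le_max_right _ _)
  set δ : ℝ := 1 - μ.re with hδ
  have hδ0 : 0 < δ := by rw [hδ]; linarith
  have hn : ∀ n : ℕ, ∀ r ∈ Ioc 0 W, ‖D r‖ ≤ C / (n.factorial * δ ^ n) * r ^ (n : ℝ) := by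
    intro n
    induction n with
    | zero => simpa using hC
    | succ n ih =>
      have hA : 0 ≤ C / (n.factorial * δ ^ n) := by positivity
      have hp : 0 < (n : ℝ) + δ := by positivity
      have hE1 := norm_le_of_norm_deriv_le_rpow (f := E) hA hp (W := W) (fun r hr => hE r hr.1)
        hE0 (fun r hr => by
          rw [norm_mul, Complex.norm_cpow_eq_rpow_re_of_pos hr.1, Complex.neg_re,
            show (n : ℝ) + δ - 1 = -μ.re + n by rw [hδ]; ring, Real.rpow_add hr.1]
          calc _ ≤ r ^ (-μ.re) * (C / (n.factorial * δ ^ n) * r ^ (n : ℝ)) :=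
                mul_le_mul_of_nonneg_left (ih r hr) (Real.rpow_nonneg hr.1.le _)
            _ = _ := by ring)
      have hD1 := norm_le_of_norm_deriv_le_rpow (f := D) (p := n + 1)
        (div_nonneg hA hp.le) (by positivity) (W := W)
        (fun r hr => hD r hr.1) hD0 (fun r hr => by
          rw [norm_mul, Complex.norm_cpow_eq_rpow_re_of_pos hr.1, Complex.sub_re, Complex.one_re,
            show (n : ℝ) + 1 - 1 = (μ.re - 1) + (n + δ) by rw [hδ]; ring, Real.rpow_add hr.1]
          calc _ ≤ r ^ (μ.re - 1) * (C / (n.factorial * δ ^ n) / (n + δ) * r ^ (n + δ)) :=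
                mul_le_mul_of_nonneg_left (hE1 r hr) (Real.rpow_nonneg hr.1.le _)
            _ = _ := by ring)
      intro r hr
      refine (hD1 r hr).trans ?_
      rw [Nat.factorial_succ, pow_succ]
      push_cast
      refine mul_le_mul_of_nonneg_right ?_ (Real.rpow_nonneg hr.1.le _)
      rw [div_div, div_div]
      refine div_le_div_of_nonneg_left hC0 (by positivity) ?_
      have h3 : δ ≤ n + δ := by linarith [n.cast_nonneg (α := ℝ)]
      calc ((n : ℝ) + 1) * n.factorial * (δ ^ n * δ)
          = (n.factorial * δ ^ n) * δ * (n + 1) := by ring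
        _ ≤ n.factorial * δ ^ n * (n + δ) * (n + 1) := by gcongr
        _ = _ := by ring
  have hlim := (FloorSemiring.tendsto_pow_div_factorial_atTop (W / δ)).const_mul C
  rw [mul_zero] at hlim
  have : ‖D W‖ ≤ 0 := by
    refine ge_of_tendsto' hlim fun n => (hn n W ⟨hW, le_rfl⟩).trans (le_of_eq ?_)
    rw [Real.rpow_natCast, div_pow]
    field_simp
  simpa using this

theorem sin_pi_mul_ne_zero {ν : ℂ} (hν : ∀ k : ℤ, ν ≠ k) : Complex.sin (π * ν) ≠ 0 := by
  rw [Complex.sin_ne_zero_iff]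
  intro k h
  refine hν k ?_
  rw [mul_comm] at h
  exact mul_right_cancel₀ (by exact_mod_cast Real.pi_ne_zero) h

theorem tendsto_macdonaldIntegral_sub {s : ℂ} (hs : 0 < s.re) (hs' : ∀ k : ℤ, s ≠ k) :
    Tendsto (fun w => macdonaldIntegral s w - macdonaldSeries s w) (𝓝[>] 0) (𝓝 0) := by
  have := (tendsto_macdonaldIntegral hs).sub (tendsto_macdonaldSeries hs (sin_pi_mul_ne_zero hs'))
  rwa [sub_self] at this

/-- Take `D` to be the difference at order `μ` and `E` minus the difference at `1 - μ`. The
derivative rule lowers the order to `μ - 1` or `-μ`, and reflection brings it back to `1 - μ` or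
`μ`, which closes the system. -/
theorem macdonaldIntegral_eq_of_re_lt_one {μ : ℂ} (h0 : 0 ≤ μ.re) (h1 : μ.re < 1)
    (hμ : ∀ k : ℤ, μ ≠ k) {w : ℝ} (hw : 0 < w) : macdonaldIntegral μ w = macdonaldSeries μ w := by
  have hμ0 : μ ≠ 0 := by simpa using hμ 0
  have hμ1 : 1 - μ ≠ 0 := by
    intro h
    exact hμ 1 (by rw [Int.cast_one]; linear_combination -h)
  have hint1 : ∀ k : ℤ, μ + 1 ≠ k := fun k h => hμ (k - 1) (by push_cast; rw [← h]; ring)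
  have hint2 : ∀ k : ℤ, 1 - μ ≠ k := fun k h => hμ (1 - k) (by push_cast; rw [← h]; ring)
  have hE0 := tendsto_macdonaldIntegral_sub (s := 1 - μ) (by simp; linarith) hint2
  -- When `Re μ = 0` the limit `Γ(μ)` is not available. The recurrence gives `μ D_μ = D_{μ+1} - w^μ
  -- D_{1-μ}` instead, where both orders have positive real part and `|w^μ| ≤ 1` near `0`.
  have hD0 : Tendsto (fun w => macdonaldIntegral μ w - macdonaldSeries μ w) (𝓝[>] 0) (𝓝 0) := by
    have hA := tendsto_macdonaldIntegral_sub (s := μ + 1) (by simp; linarith) hint1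
    have hbd : Tendsto (fun w : ℝ => (w : ℂ) ^ μ *
        (macdonaldIntegral (1 - μ) w - macdonaldSeries (1 - μ) w)) (𝓝[>] 0) (𝓝 0) := by
      refine hE0.zero_mul_isBoundedUnder_le ?_ |>.congr fun w => mul_comm _ _
      refine ⟨1, ?_⟩
      rw [eventually_map]
      filter_upwards [Ioo_mem_nhdsGT one_pos] with w hw
      rw [Function.comp_apply, Complex.norm_cpow_eq_rpow_re_of_pos hw.1]
      exact Real.rpow_le_one hw.1.le hw.2.le h0
    have := (hA.sub hbd).div_const μ
    rw [sub_zero, zero_div] at this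
    refine this.congr' ?_
    filter_upwards [self_mem_nhdsWithin] with w hw
    have hw : 0 < w := hw
    have hw' : (w : ℂ) ≠ 0 := by exact_mod_cast hw.ne'
    have h2 : (w : ℂ) ^ μ ≠ 0 := by rw [Ne, Complex.cpow_eq_zero_iff]; tauto
    rw [macdonaldIntegral_add_one hμ0 hw, macdonaldSeries_add_one μ hw,
      show μ - 1 = -(1 - μ) by ring, macdonaldIntegral_neg _ hw, macdonaldSeries_neg _ hw,
      show -(1 - μ) = μ - 1 by ring, Complex.cpow_sub _ _ hw', Complex.cpow_one]
    field_simp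
    ring
  have hE0' : Tendsto (fun w => -(macdonaldIntegral (1 - μ) w - macdonaldSeries (1 - μ) w))
      (𝓝[>] 0) (𝓝 0) := by simpa using hE0.neg
  refine sub_eq_zero.mp (eq_zero_of_bessel_system h1
    (D := fun w => macdonaldIntegral μ w - macdonaldSeries μ w) ?_ ?_ hD0 hE0' hw)
  · intro w hw
    refine ((hasDerivAt_macdonaldIntegral μ hw).sub
      (hasDerivAt_macdonaldSeries hμ0 hw)).congr_deriv ?_
    rw [show μ - 1 = -(1 - μ) by ring, macdonaldIntegral_neg _ hw, macdonaldSeries_neg _ hw]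
    ring
  · intro w hw
    refine ((hasDerivAt_macdonaldIntegral (1 - μ) hw).sub
      (hasDerivAt_macdonaldSeries hμ1 hw)).neg.congr_deriv ?_
    rw [show 1 - μ - 1 = -μ by ring, macdonaldIntegral_neg _ hw, macdonaldSeries_neg _ hw]
    ring

/-- The three-term recurrence climbs from the strip `0 ≤ Re μ < 1`, so the induction carries two
consecutive orders. At the start, equality at `μ - 1` comes from differentiating equality at `μ`. -/
theorem macdonaldIntegral_eq {ν : ℂ} (h0 : 0 ≤ ν.re) (hν : ∀ k : ℤ, ν ≠ k) {w : ℝ} (hw : 0 < w) :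
    macdonaldIntegral ν w = macdonaldSeries ν w := by
  have step (n : ℕ) : ∀ μ : ℂ, 0 ≤ μ.re → μ.re < 1 → (∀ k : ℤ, μ ≠ k) →
      macdonaldIntegral (μ + n) w = macdonaldSeries (μ + n) w ∧
      macdonaldIntegral (μ + n - 1) w = macdonaldSeries (μ + n - 1) w := by
    intro μ h0 h1 hμ
    have hne (m : ℕ) : μ + m ≠ 0 := fun h =>
      hμ (-m) (by push_cast; linear_combination h)
    induction n with
    | zero =>
      rw [Nat.cast_zero, add_zero]
      refine ⟨macdonaldIntegral_eq_of_re_lt_one h0 h1 hμ hw, ?_⟩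
      have e : macdonaldIntegral μ =ᶠ[𝓝 w] macdonaldSeries μ := by
        filter_upwards [lt_mem_nhds hw] with v hv
        exact macdonaldIntegral_eq_of_re_lt_one h0 h1 hμ hv
      have := (hasDerivAt_macdonaldIntegral μ hw).unique
        ((hasDerivAt_macdonaldSeries (by simpa using hne 0) hw).congr_of_eventuallyEq e)
      exact neg_injective this
    | succ n ih =>
      push_cast
      rw [← add_assoc, add_sub_cancel_right, macdonaldIntegral_add_one (hne n) hw,
        macdonaldSeries_add_one _ hw, ih.1, ih.2]
      exact ⟨rfl, rfl⟩
  have h := (step ⌊ν.re⌋₊ (ν - ⌊ν.re⌋₊) (by simpa using Nat.floor_le h0)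
    (by simpa [sub_lt_iff_lt_add'] using Nat.lt_floor_add_one ν.re)
    (fun k hk => hν (k + ⌊ν.re⌋₊) (by push_cast; linear_combination hk))).1
  rwa [sub_add_cancel] at h

/-! ### Partial fractions of the exponential kernels -/

theorem norm_exp_two_pi_I_mul_lt_one {z : ℂ} (hz : 0 < z.im) :
    ‖Complex.exp (2 * π * Complex.I * z)‖ < 1 :=
  UpperHalfPlane.norm_exp_two_pi_I_lt_one ⟨z, hz⟩

/-- Compare the partial fraction series of `π cot(πz)` with its expansion in powers of `e^{2πiz}`.
-/
theorem hasSum_cot_partial_fraction {z : ℂ} (hz : 0 < z.im) :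
    HasSum (fun n : ℕ => 1 / (z - (n + 1)) + 1 / (z + (n + 1)))
      (-π * Complex.I - 2 * π * Complex.I *
        ∑' n : ℕ, Complex.exp (2 * π * Complex.I * z) ^ (n + 1) - 1 / z) := by
  have hmem := UpperHalfPlane.coe_mem_integerComplement ⟨z, hz⟩
  have h1 := cot_series_rep' hmem
  have h2 := pi_mul_cot_pi_q_exp ⟨z, hz⟩
  have hg := summable_geometric_of_norm_lt_one (norm_exp_two_pi_I_mul_lt_one hz)
  have hs : Summable (fun n : ℕ => 1 / (z - (n + 1)) + 1 / (z + (n + 1))) :=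
    (summable_cotTerm hmem).congr fun n => rfl
  simp only at h1 h2
  rw [hg.tsum_eq_zero_add, pow_zero] at h2
  have := hs.hasSum
  rw [← h1, h2] at this
  convert this using 1
  ring

/-- The kernel `∑_{d ≥ 1} sin (2πdθ) exp (-2πdt)`. -/
def sineKernel (θ t : ℝ) : ℝ :=
  ∑' d : ℕ+, Real.sin (2 * π * d * θ) * Real.exp (-(2 * π * d) * t)

/-- The kernel `∑_{k ≥ 1} exp (-2πku) = 1 / (exp (2πu) - 1)`. -/
def expKernel (u : ℝ) : ℝ := ∑' k : ℕ+, Real.exp (-(2 * π * k) * u)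

theorem summable_expKernel {u : ℝ} (hu : 0 < u) :
    Summable fun k : ℕ+ => Real.exp (-(2 * π * k) * u) := by
  have h : Summable fun n : ℕ => Real.exp (-(2 * π * u)) ^ n :=
    summable_geometric_of_lt_one (Real.exp_nonneg _) (by
      rw [Real.exp_lt_one_iff]
      have := Real.pi_pos
      nlinarith [mul_pos Real.pi_pos hu])
  refine (h.comp_injective PNat.coe_injective).congr fun k => ?_
  rw [Function.comp_apply, ← Real.exp_nat_mul]
  ring_nf

theorem summable_sineKernel (θ : ℝ) {t : ℝ} (ht : 0 < t) :
    Summable fun d : ℕ+ => Real.sin (2 * π * d * θ) * Real.exp (-(2 * π * d) * t) := by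
  refine Summable.of_norm_bounded (summable_expKernel ht) fun d => ?_
  rw [norm_mul, Real.norm_eq_abs, Real.norm_eq_abs, Real.abs_exp]
  exact mul_le_of_le_one_left (Real.exp_nonneg _) (Real.abs_sin_le_one _)

theorem hasSum_pow_exp {z : ℂ} (hz : 0 < z.im) :
    HasSum (fun d : ℕ+ => Complex.exp (2 * π * Complex.I * d * z))
      (∑' n : ℕ, Complex.exp (2 * π * Complex.I * z) ^ (n + 1)) := by
  have hg := summable_geometric_of_norm_lt_one (norm_exp_two_pi_I_mul_lt_one hz)
  have h := ((summable_nat_add_iff 1).mpr hg).hasSum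
  rw [← Equiv.pnatEquivNat.symm.hasSum_iff]
  refine h.congr_fun fun n => ?_
  rw [Function.comp_apply, ← Complex.exp_nat_mul]
  simp
  ring_nf

/-- The paired partial fraction `y / (t² + y²) - y' / (t² + y'²)` with `y = m + θ` and
`y' = m + 1 - θ`. -/
def poleTerm (θ t : ℝ) (m : ℕ) : ℝ :=
  (m + θ) / (t ^ 2 + (m + θ) ^ 2) - (m + 1 - θ) / (t ^ 2 + (m + 1 - θ) ^ 2)

/-- A single fraction decays only like `1/m`. The difference contains the factor `z - y`, which
gains a power and makes the paired series converge uniformly in `t`. -/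
theorem abs_div_sub_div_le {y z c t : ℝ} (hc : 0 < c) (hy : c ≤ y) (hz : c ≤ z)
    (hyz : |z - y| ≤ 1) : |y / (t ^ 2 + y ^ 2) - z / (t ^ 2 + z ^ 2)| ≤ 1 / c ^ 2 := by
  have hy0 := hc.trans_le hy
  have hz0 := hc.trans_le hz
  have e : y / (t ^ 2 + y ^ 2) - z / (t ^ 2 + z ^ 2)
      = (z - y) * ((y * z - t ^ 2) / ((t ^ 2 + y ^ 2) * (t ^ 2 + z ^ 2))) := by
    field_simp
    ring
  rw [e, abs_mul]
  refine (mul_le_of_le_one_left (abs_nonneg _) hyz).trans ?_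
  rw [abs_div, abs_of_pos (by positivity : 0 < (t ^ 2 + y ^ 2) * (t ^ 2 + z ^ 2)),
    div_le_div_iff₀ (by positivity) (by positivity), one_mul]
  have h1 : |y * z - t ^ 2| ≤ y * z + t ^ 2 := by
    rw [abs_le]; constructor <;> nlinarith [mul_pos hy0 hz0, sq_nonneg t]
  have h2 : c ^ 2 ≤ y ^ 2 := by gcongr
  have h3 : c ^ 2 ≤ z ^ 2 := by gcongr
  have h4 : c ^ 2 ≤ y * z := by nlinarith
  calc |y * z - t ^ 2| * c ^ 2 ≤ (y * z + t ^ 2) * c ^ 2 := by gcongr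
    _ ≤ _ := by nlinarith [sq_nonneg t, mul_pos hy0 hz0, sq_nonneg (t ^ 2)]

/-- A summable majorant for `poleTerm`, uniform in `t`. -/
def poleBound (θ : ℝ) (m : ℕ) : ℝ := 1 / (m + min θ (1 - θ)) ^ 2

theorem abs_poleTerm_le {θ : ℝ} (h0 : 0 < θ) (h1 : θ < 1) (t : ℝ) (m : ℕ) :
    |poleTerm θ t m| ≤ poleBound θ m := by
  have hmin : 0 < min θ (1 - θ) := lt_min h0 (by linarith)
  refine abs_div_sub_div_le (by positivity) ?_ ?_ ?_
  · linarith [min_le_left θ (1 - θ)]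
  · linarith [min_le_right θ (1 - θ)]
  · rw [abs_le]; constructor <;> linarith

theorem summable_poleBound {θ : ℝ} (h0 : 0 < θ) (h1 : θ < 1) : Summable (poleBound θ) := by
  have hmin : 0 < min θ (1 - θ) := lt_min h0 (by linarith)
  have := (Real.summable_one_div_nat_add_rpow (min θ (1 - θ)) 2).mpr one_lt_two
  refine this.congr fun m => ?_
  rw [poleBound, abs_of_pos (by positivity), Real.rpow_two]

/-- Real part of the cotangent expansion at `z = θ + it`. -/
theorem hasSum_poleTerm {θ : ℝ} (h0 : 0 < θ) (h1 : θ < 1) {t : ℝ} (ht : 0 < t) :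
    HasSum (poleTerm θ t) (2 * π * sineKernel θ t) := by
  set z : ℂ := θ + t * Complex.I with hz
  have hzre : z.re = θ := by simp [hz]
  have hzim : z.im = t := by simp [hz]
  have him : 0 < z.im := by rwa [hzim]
  have hre (a : ℝ) : (1 / (z + a)).re = (θ + a) / (t ^ 2 + (θ + a) ^ 2) := by
    rw [one_div, Complex.inv_re, Complex.normSq_apply]
    simp only [Complex.add_re, Complex.add_im, Complex.ofReal_re, Complex.ofReal_im, hzre, hzim]
    ring_nf
  have hS : (2 * π * Complex.I *
      ∑' n : ℕ, Complex.exp (2 * π * Complex.I * z) ^ (n + 1)).re = -(2 * π * sineKernel θ t) := by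
    have h2 := (Complex.hasSum_im (hasSum_pow_exp him)).tsum_eq
    have h3 : (∑' n : ℕ, Complex.exp (2 * π * Complex.I * z) ^ (n + 1)).im = sineKernel θ t := by
      rw [← h2, sineKernel]
      refine tsum_congr fun d => ?_
      rw [show 2 * π * Complex.I * d * z
        = ((-(2 * π * d) * t : ℝ) : ℂ) + ((2 * π * d * θ : ℝ) : ℂ) * Complex.I by
          rw [hz]; push_cast; linear_combination (2 * π * d * t : ℂ) * Complex.I_sq,
        Complex.exp_add, Complex.exp_mul_I, ← Complex.ofReal_exp, ← Complex.ofReal_cos,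
        ← Complex.ofReal_sin, Complex.im_ofReal_mul, Complex.add_im, Complex.ofReal_im,
        Complex.im_ofReal_mul, Complex.I_im, mul_one, zero_add, mul_comm]
    rw [← h3]
    simp
  have hsum := Complex.hasSum_re (hasSum_cot_partial_fraction him)
  have hval : (-π * Complex.I - 2 * π * Complex.I *
        ∑' n : ℕ, Complex.exp (2 * π * Complex.I * z) ^ (n + 1) - 1 / z).re
      = 2 * π * sineKernel θ t - θ / (t ^ 2 + θ ^ 2) := by
    have h4 := hre 0
    rw [Complex.ofReal_zero, add_zero, add_zero] at h4
    rw [Complex.sub_re, Complex.sub_re, hS, h4]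
    simp
  rw [hval] at hsum
  -- The cotangent series pairs `n + 1 - θ` with `n + 1 + θ`, whereas `poleTerm` pairs it with `n +
  -- θ`. The discrepancy telescopes and supplies the missing term `θ / (t² + θ²)`.
  have hterm (n : ℕ) : (1 / (z - (n + 1)) + 1 / (z + (n + 1))).re
      = poleTerm θ t n + ((((n + 1 : ℕ) : ℝ) + θ) / (t ^ 2 + (((n + 1 : ℕ) : ℝ) + θ) ^ 2)
        - (n + θ) / (t ^ 2 + (n + θ) ^ 2)) := by
    have e1 := hre (-(n + 1))
    have e2 := hre (n + 1)
    push_cast at e1 e2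
    rw [Complex.add_re, sub_eq_add_neg, e1, e2, poleTerm]
    push_cast
    have e3 : θ + -((n : ℝ) + 1) = -(n + 1 - θ) := by ring
    rw [e3, neg_sq, neg_div, show θ + ((n : ℝ) + 1) = n + 1 + θ by ring]
    ring
  have hsumm : Summable (poleTerm θ t) :=
    Summable.of_norm_bounded (summable_poleBound h0 h1) (abs_poleTerm_le h0 h1 t)
  have hlim := hsum.tendsto_sum_nat
  simp only [hterm, Finset.sum_add_distrib] at hlim
  have htel (M : ℕ) := Finset.sum_range_sub
    (fun n : ℕ => ((n : ℝ) + θ) / (t ^ 2 + ((n : ℝ) + θ) ^ 2)) M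
  simp only [htel] at hlim
  have hz0 : Tendsto (fun n : ℕ => ((n : ℝ) + θ) / (t ^ 2 + ((n : ℝ) + θ) ^ 2)) atTop (𝓝 0) := by
    have hinf : Tendsto (fun n : ℕ => (n : ℝ) + θ) atTop atTop :=
      tendsto_atTop_add_const_right _ _ tendsto_natCast_atTop_atTop
    refine squeeze_zero (fun n => by positivity) (fun n => ?_) hinf.inv_tendsto_atTop
    have : 0 < (n : ℝ) + θ := by positivity
    rw [Pi.inv_apply, ← one_div, div_le_div_iff₀ (by positivity) this]
    nlinarith [sq_nonneg t]
  have hfin := (hlim.sub hz0).add_const (θ / (t ^ 2 + θ ^ 2))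
  have : Tendsto (fun M : ℕ => ∑ n ∈ Finset.range M, poleTerm θ t n) atTop
      (𝓝 (2 * π * sineKernel θ t)) := by
    convert hfin using 2
    · rw [Nat.cast_zero, zero_add]
      ring
    · ring
  exact (hsumm.hasSum_iff_tendsto_nat).mpr this

/-- Imaginary part of the cotangent expansion at `z = iu`, scaled by `-1/2`. -/
theorem hasSum_expKernel {u : ℝ} (hu : 0 < u) :
    HasSum (fun d : ℕ+ => u / (u ^ 2 + (d : ℝ) ^ 2))
      (π * (expKernel u + 1 / 2 - 1 / (2 * π * u))) := by
  set z : ℂ := u * Complex.I with hz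
  have him : 0 < z.im := by simpa [hz] using hu
  have hQ : (∑' n : ℕ, Complex.exp (2 * π * Complex.I * z) ^ (n + 1)) = expKernel u := by
    rw [← (hasSum_pow_exp him).tsum_eq, expKernel, Complex.ofReal_tsum]
    refine tsum_congr fun d => ?_
    rw [Complex.ofReal_exp]
    congr 1
    rw [hz]
    push_cast
    linear_combination (2 * π * d * u : ℂ) * Complex.I_sq
  have h := (Complex.hasSum_im (hasSum_cot_partial_fraction him)).mul_left (-1 / 2)
  rw [hQ] at h
  rw [← Equiv.pnatEquivNat.symm.hasSum_iff]
  convert! h using 1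
  · funext n
    have e : (1 / (z - (n + 1)) + 1 / (z + (n + 1)))
        = ((-2 * u / (u ^ 2 + ((n : ℝ) + 1) ^ 2) : ℝ) : ℂ) * Complex.I := by
      have hpos : (u : ℂ) ^ 2 + ((n : ℂ) + 1) ^ 2 ≠ 0 := by
        exact_mod_cast (by positivity : u ^ 2 + ((n : ℝ) + 1) ^ 2 ≠ 0)
      have hfac : (z - (n + 1)) * (z + (n + 1)) = -((u : ℂ) ^ 2 + ((n : ℂ) + 1) ^ 2) := by
        rw [hz]; linear_combination (u ^ 2 : ℂ) * Complex.I_sq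
      have hne : (z - (n + 1)) * (z + (n + 1)) ≠ 0 := by rw [hfac]; exact neg_ne_zero.mpr hpos
      rw [div_add_div _ _ (left_ne_zero_of_mul hne) (right_ne_zero_of_mul hne), hfac]
      push_cast
      rw [div_eq_iff (neg_ne_zero.mpr hpos), hz]
      field_simp
      ring
    rw [e, Complex.im_ofReal_mul, Complex.I_im, Function.comp_apply]
    simp
    ring
  · have e : (1 / z).im = -1 / u := by
      rw [hz, one_div, mul_inv, Complex.inv_I, ← Complex.ofReal_inv]
      simp [neg_div]
    rw [Complex.sub_im, Complex.sub_im, e]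
    simp
    field_simp
    ring

/-! ### Elementary Mellin transforms -/

theorem mellinConvergent_one_div_one_add {s : ℂ} (h0 : 0 < s.re) (h1 : s.re < 1) :
    MellinConvergent (fun t : ℝ => ((1 / (1 + t) : ℝ) : ℂ)) s := by
  refine mellinConvergent_of_isBigO_rpow (a := 1) (b := 0) ?_ ?_ h1 ?_ h0
  · refine ContinuousOn.locallyIntegrableOn (Complex.continuous_ofReal.comp_continuousOn
      (continuousOn_const.div (by fun_prop) fun t ht => ?_)) measurableSet_Ioi
    have ht : 0 < t := ht
    positivity
  · refine Complex.isBigO_ofReal_left.mpr (IsBigO.of_bound 1 ?_)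
    filter_upwards [eventually_gt_atTop 0] with t ht
    rw [Real.rpow_neg_one, one_mul, Real.norm_of_nonneg (by positivity),
      Real.norm_of_nonneg (by positivity), ← one_div]
    gcongr
    linarith
  · refine Complex.isBigO_ofReal_left.mpr (IsBigO.of_bound 1 ?_)
    filter_upwards [self_mem_nhdsWithin] with t ht
    have ht : 0 < t := ht
    rw [neg_zero, Real.rpow_zero, norm_one, one_mul, Real.norm_of_nonneg (by positivity),
      div_le_one (by positivity)]
    linarith

/-- Write `1/(1+t) = ∫ e^{-(1+t)r} dr` and exchange the integrals: the result is `Γ(s) Γ(1-s)`. -/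
theorem mellin_one_div_one_add {s : ℂ} (h0 : 0 < s.re) (h1 : s.re < 1) :
    mellin (fun t : ℝ => ((1 / (1 + t) : ℝ) : ℂ)) s = π / Complex.sin (π * s) := by
  have hconv := mellinConvergent_one_div_one_add h0 h1
  set f : ℝ → ℝ → ℂ := fun t r => (t : ℂ) ^ (s - 1) * ((Real.exp (-(1 + t) * r) : ℝ) : ℂ) with hf
  have hinner (t : ℝ) (ht : 0 < t) :
      ∫ r in Ioi (0 : ℝ), f t r = (t : ℂ) ^ (s - 1) * ((1 / (1 + t) : ℝ) : ℂ) := by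
    have h : ∫ r in Ioi (0 : ℝ), ((Real.exp (-(1 + t) * r) : ℝ) : ℂ)
        = ((∫ r in Ioi (0 : ℝ), Real.exp (-(1 + t) * r) : ℝ) : ℂ) := integral_ofReal
    simp only [hf]
    rw [integral_const_mul, h, integral_exp_mul_Ioi (by linarith), mul_zero, Real.exp_zero,
      neg_div_neg_eq]
  have houter (r : ℝ) (hr : 0 < r) :
      ∫ t in Ioi (0 : ℝ), f t r = Complex.Gamma s * (((Real.exp (-r) : ℝ) : ℂ) *
        (r : ℂ) ^ ((1 - s) - 1)) := by
    have h := Complex.integral_cpow_mul_exp_neg_mul_Ioi h0 hr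
    have e (t : ℝ) : f t r = ((Real.exp (-r) : ℝ) : ℂ) *
        ((t : ℂ) ^ (s - 1) * Complex.exp (-(r * t))) := by
      simp only [hf]
      rw [show -(1 + t) * r = -r + -(r * t) by ring, Real.exp_add]
      push_cast
      ring
    simp only [e]
    rw [integral_const_mul]
    rw [h, one_div, Complex.inv_cpow _ _ (by
      rw [Complex.arg_ofReal_of_nonneg hr.le]; exact Real.pi_ne_zero.symm),
      show 1 - s - 1 = -s by ring, Complex.cpow_neg]
    ring
  have hint : Integrable (Function.uncurry f)
      ((volume.restrict (Ioi 0)).prod (volume.restrict (Ioi 0))) := by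
    have hmeas : AEStronglyMeasurable (Function.uncurry f)
        ((volume.restrict (Ioi (0 : ℝ))).prod (volume.restrict (Ioi (0 : ℝ)))) := by
      rw [Measure.prod_restrict]
      refine ContinuousOn.aestronglyMeasurable ?_ (measurableSet_Ioi.prod measurableSet_Ioi)
      intro p hp
      have hp : 0 < p.1 := hp.1
      have hc : ContinuousAt (fun t : ℝ => (t : ℂ) ^ (s - 1)) p.1 :=
        Complex.continuousAt_ofReal_cpow_const _ _ (Or.inr hp.ne')
      refine ContinuousAt.continuousWithinAt (ContinuousAt.mul (hc.comp continuousAt_fst) ?_)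
      fun_prop
    refine (integrable_prod_iff hmeas).mpr ⟨?_, ?_⟩
    · filter_upwards [self_mem_ae_restrict measurableSet_Ioi] with t ht
      have ht : 0 < t := ht
      exact Integrable.const_mul (c := (t : ℂ) ^ (s - 1))
        (f := fun r => ((Real.exp (-(1 + t) * r) : ℝ) : ℂ))
        (integrableOn_exp_mul_Ioi (by linarith : -(1 + t) < 0) 0).ofReal
    · refine hconv.norm.congr ?_
      filter_upwards [self_mem_ae_restrict measurableSet_Ioi] with t ht
      have ht : 0 < t := ht
      have e (r : ℝ) : ‖Function.uncurry f (t, r)‖ = ‖(t : ℂ) ^ (s - 1)‖ *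
          Real.exp (-(1 + t) * r) := by
        rw [Function.uncurry_apply_pair, norm_mul, Complex.norm_real, Real.norm_eq_abs,
          Real.abs_exp]
      simp only [e]
      rw [integral_const_mul, integral_exp_mul_Ioi (by linarith), norm_smul, Complex.norm_real,
        Real.norm_of_nonneg (by positivity), mul_zero, Real.exp_zero, neg_div_neg_eq]
  have hswap := integral_integral_swap hint
  rw [setIntegral_congr_fun measurableSet_Ioi hinner,
    setIntegral_congr_fun measurableSet_Ioi houter, integral_const_mul] at hswap
  have hΓ := Complex.Gamma_eq_integral (s := 1 - s) (by simpa using h1)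
  rw [Complex.GammaIntegral] at hΓ
  rw [← hΓ, Complex.Gamma_mul_Gamma_one_sub] at hswap
  exact hswap

/-- The kernel `1 / (t² + c²)` has Mellin transform `π c^(ν-1) / (2 cos (πν/2))` at `ν + 1`. -/
theorem hasMellin_one_div_sq_add_sq {ν : ℂ} (h0 : -1 < ν.re) (h1 : ν.re < 1) {c : ℝ} (hc : 0 < c) :
    HasMellin (fun t : ℝ => ((1 / (t ^ 2 + c ^ 2) : ℝ) : ℂ)) (ν + 1)
      (π / (2 * Complex.cos (π * ν / 2)) * (c : ℂ) ^ (ν - 1)) := by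
  have hre : ((ν + 1) / ((2 : ℝ) : ℂ)).re = (ν.re + 1) / 2 := by
    rw [Complex.div_ofReal_re]; simp
  have hr0 : 0 < ((ν + 1) / ((2 : ℝ) : ℂ)).re := by rw [hre]; linarith
  have hr1 : ((ν + 1) / ((2 : ℝ) : ℂ)).re < 1 := by rw [hre]; linarith
  set f : ℝ → ℂ := fun t : ℝ => ((1 / (1 + t) : ℝ) : ℂ) with hf
  have hcinv : 0 < c⁻¹ := inv_pos.mpr hc
  have hc' : (c : ℂ) ≠ 0 := by exact_mod_cast hc.ne'
  have hconv : MellinConvergent (fun t => f ((c⁻¹ * t) ^ (2 : ℝ))) (ν + 1) :=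
    (MellinConvergent.comp_mul_left (f := fun t => f (t ^ (2 : ℝ))) hcinv).mpr
      ((MellinConvergent.comp_rpow two_ne_zero).mpr (mellinConvergent_one_div_one_add hr0 hr1))
  have hval := mellin_comp_mul_left (fun t => f (t ^ (2 : ℝ))) (ν + 1) hcinv
  rw [mellin_comp_rpow, mellin_one_div_one_add hr0 hr1] at hval
  have e (t : ℝ) : ((1 / (t ^ 2 + c ^ 2) : ℝ) : ℂ)
      = ((c : ℂ) ^ 2)⁻¹ • f ((c⁻¹ * t) ^ (2 : ℝ)) := by
    rw [hf, smul_eq_mul]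
    simp only [Real.rpow_two]
    have h : 1 / (t ^ 2 + c ^ 2) = (c ^ 2)⁻¹ * (1 / (1 + (c⁻¹ * t) ^ 2)) := by
      have h1 : t ^ 2 + c ^ 2 ≠ 0 := by positivity
      have h2 : 1 + (c⁻¹ * t) ^ 2 ≠ 0 := by positivity
      rw [← one_div, div_mul_div_comm, one_mul, mul_add, mul_pow, inv_pow, mul_one,
        mul_inv_cancel_left₀ (by positivity), add_comm]
    rw [h]
    push_cast
    rfl
  rw [funext e]
  refine ⟨hconv.const_smul _, ?_⟩
  rw [mellin_const_smul, hval, abs_of_pos two_pos, show (π : ℂ) * ((ν + 1) / ((2 : ℝ) : ℂ))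
    = π * ν / 2 + π / 2 by push_cast; ring, Complex.sin_add_pi_div_two, Complex.ofReal_inv,
    Complex.inv_cpow _ _ (by
      rw [Complex.arg_ofReal_of_nonneg hc.le]; exact Real.pi_ne_zero.symm),
    Complex.cpow_neg, inv_inv, Complex.cpow_add _ _ hc', Complex.cpow_sub _ _ hc',
    Complex.cpow_one]
  simp only [smul_eq_mul, Complex.real_smul]
  push_cast
  field_simp

/-! ### Size of the kernels -/

theorem continuousOn_expSeries {a : ℕ+ → ℝ} (ha : ∀ d, |a d| ≤ 1) :
    ContinuousOn (fun t : ℝ => ∑' d : ℕ+, a d * Real.exp (-(2 * π * d) * t)) (Ioi 0) := by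
  intro t ht
  have ht : 0 < t := ht
  have h : ContinuousOn (fun t : ℝ => ∑' d : ℕ+, a d * Real.exp (-(2 * π * d) * t))
      (Ioi (t / 2)) := by
    refine continuousOn_tsum (fun d => by fun_prop) (summable_expKernel (half_pos ht)) ?_
    intro d r hr
    have hr : t / 2 < r := hr
    rw [norm_mul, Real.norm_eq_abs, Real.norm_eq_abs, Real.abs_exp]
    refine (mul_le_of_le_one_left (Real.exp_nonneg _) (ha d)).trans (Real.exp_le_exp.mpr ?_)
    have := Real.pi_pos
    rw [neg_mul, neg_mul, neg_le_neg_iff]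
    gcongr
  exact (h.continuousAt (Ioi_mem_nhds (by linarith))).continuousWithinAt

theorem continuousOn_sineKernel (θ : ℝ) : ContinuousOn (sineKernel θ) (Ioi 0) :=
  continuousOn_expSeries fun _ => Real.abs_sin_le_one _

theorem continuousOn_expKernel : ContinuousOn expKernel (Ioi 0) := by
  have h := continuousOn_expSeries (a := fun _ => 1) fun _ => by simp
  simp only [one_mul] at h
  exact h

theorem expKernel_nonneg (u : ℝ) : 0 ≤ expKernel u := tsum_nonneg fun _ => Real.exp_nonneg _

theorem abs_sineKernel_le_expKernel (θ : ℝ) {t : ℝ} (ht : 0 < t) :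
    |sineKernel θ t| ≤ expKernel t := by
  refine tsum_of_norm_bounded
    (f := fun d : ℕ+ => Real.sin (2 * π * d * θ) * Real.exp (-(2 * π * d) * t))
    (summable_expKernel ht).hasSum fun d => ?_
  rw [norm_mul, Real.norm_eq_abs, Real.norm_eq_abs, Real.abs_exp]
  exact mul_le_of_le_one_left (Real.exp_nonneg _) (Real.abs_sin_le_one _)

theorem isBigO_expKernel_atTop (b : ℝ) : expKernel =O[atTop] fun t => t ^ b := by
  refine IsBigO.trans ?_ (isLittleO_exp_neg_mul_rpow_atTop Real.pi_pos b).isBigO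
  have hs := summable_expKernel (u := 1 / 2) (by norm_num)
  refine IsBigO.of_bound (∑' k : ℕ+, Real.exp (-(2 * π * k) * (1 / 2))) ?_
  filter_upwards [eventually_ge_atTop 1] with t ht
  rw [Real.norm_of_nonneg (expKernel_nonneg t), Real.norm_eq_abs, Real.abs_exp, ← tsum_mul_right]
  refine (summable_expKernel (by linarith)).tsum_le_tsum (fun k => ?_) (hs.mul_right _)
  rw [← Real.exp_add, Real.exp_le_exp]
  have hk : (1 : ℝ) ≤ k := by exact_mod_cast (one_le : 1 ≤ k)
  -- For `k, t ≥ 1` this splits the bound as `e^{-2πkt} ≤ e^{-πk} e^{-πt}`; the first factor is the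
  -- summand of the kernel at `1/2`.
  have h1 : (k : ℝ) + t ≤ 2 * k * t := by nlinarith
  nlinarith [Real.pi_pos]

theorem isBigO_sineKernel_atTop (θ b : ℝ) : sineKernel θ =O[atTop] fun t => t ^ b := by
  refine IsBigO.trans (IsBigO.of_bound 1 ?_) (isBigO_expKernel_atTop b)
  filter_upwards [eventually_gt_atTop 0] with t ht
  rw [one_mul, Real.norm_of_nonneg (expKernel_nonneg t)]
  exact abs_sineKernel_le_expKernel θ ht

/-- Termwise bounds on the exponential series blow up as `t → 0⁺`; the partial fractions show that
the oscillating sum stays bounded. -/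
theorem abs_sineKernel_le {θ : ℝ} (h0 : 0 < θ) (h1 : θ < 1) {t : ℝ} (ht : 0 < t) :
    |sineKernel θ t| ≤ (∑' m, poleBound θ m) := by
  have h := tsum_of_norm_bounded (f := poleTerm θ t) (summable_poleBound h0 h1).hasSum (abs_poleTerm_le h0 h1 t)
  rw [(hasSum_poleTerm h0 h1 ht).tsum_eq, norm_mul, Real.norm_eq_abs, Real.norm_eq_abs] at h
  refine le_trans (le_mul_of_one_le_left (abs_nonneg _) ?_) h
  rw [abs_of_pos (by positivity)]
  linarith [Real.pi_gt_three]

theorem isBigO_sineKernel_nhdsGT_zero {θ : ℝ} (h0 : 0 < θ) (h1 : θ < 1) :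
    sineKernel θ =O[𝓝[>] 0] fun t => t ^ (-(0 : ℝ)) := by
  refine IsBigO.of_bound (∑' m, poleBound θ m) ?_
  filter_upwards [self_mem_nhdsWithin] with t ht
  rw [neg_zero, Real.rpow_zero, norm_one, mul_one]
  exact abs_sineKernel_le h0 h1 ht

/-! ### The Mellin transform of the sine kernel -/

theorem locallyIntegrableOn_sineKernel (θ : ℝ) :
    LocallyIntegrableOn (fun t => (sineKernel θ t : ℂ)) (Ioi 0) :=
  (Complex.continuous_ofReal.comp_continuousOn
    (continuousOn_sineKernel θ)).locallyIntegrableOn measurableSet_Ioi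

theorem mellinConvergent_sineKernel {θ : ℝ} (h0 : 0 < θ) (h1 : θ < 1) {s : ℂ} (hs : 0 < s.re) :
    MellinConvergent (fun t => (sineKernel θ t : ℂ)) s :=
  mellinConvergent_of_isBigO_rpow (a := s.re + 1) (locallyIntegrableOn_sineKernel θ)
    (Complex.isBigO_ofReal_left.mpr (isBigO_sineKernel_atTop θ _)) (by linarith)
    (Complex.isBigO_ofReal_left.mpr (isBigO_sineKernel_nhdsGT_zero h0 h1)) hs

theorem differentiableAt_mellin_sineKernel {θ : ℝ} (h0 : 0 < θ) (h1 : θ < 1) {s : ℂ}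
    (hs : 0 < s.re) : DifferentiableAt ℂ (mellin fun t => (sineKernel θ t : ℂ)) s :=
  mellin_differentiableAt_of_isBigO_rpow (a := s.re + 1) (locallyIntegrableOn_sineKernel θ)
    (Complex.isBigO_ofReal_left.mpr (isBigO_sineKernel_atTop θ _)) (by linarith)
    (Complex.isBigO_ofReal_left.mpr (isBigO_sineKernel_nhdsGT_zero h0 h1)) hs

theorem mellin_sineKernel_of_one_lt_re (θ : ℝ) {s : ℂ} (hs : 1 < s.re) :
    mellin (fun t => (sineKernel θ t : ℂ)) s
      = (2 * π : ℂ) ^ (-s) * Complex.Gamma s * HurwitzZeta.sinZeta θ s := by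
  have h1 : HasSum (fun d : ℕ+ => Complex.Gamma s * ((Real.sin (2 * π * d * θ) : ℝ) : ℂ)
      / ((2 * π * d : ℝ) : ℂ) ^ s) (mellin (fun t => (sineKernel θ t : ℂ)) s) := by
    refine hasSum_mellin (p := fun d : ℕ+ => 2 * π * d) (fun d => Or.inr (by positivity))
      (by linarith) (fun t ht => ?_) ?_
    · have := Complex.hasSum_ofReal.mpr (summable_sineKernel θ ht).hasSum
      push_cast [sineKernel] at this ⊢
      exact this
    · have hz : Summable fun n : ℕ => 1 / (n : ℝ) ^ s.re := Real.summable_one_div_nat_rpow.mpr hs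
      refine Summable.of_norm_bounded (hz.comp_injective PNat.coe_injective) fun d => ?_
      have hd : (0 : ℝ) < d := by positivity
      rw [Complex.norm_real, Real.norm_of_nonneg (by positivity), Function.comp_apply]
      refine div_le_div₀ zero_le_one (Real.abs_sin_le_one _) (by positivity) ?_
      refine Real.rpow_le_rpow hd.le ?_ (by linarith)
      nlinarith [Real.pi_gt_three]
  have h2 := (HurwitzZeta.hasSum_nat_sinZeta θ hs).mul_left ((2 * π : ℂ) ^ (-s) * Complex.Gamma s)
  have h3 : HasSum (fun d : ℕ+ => (2 * π : ℂ) ^ (-s) * Complex.Gamma s *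
      (((Real.sin (2 * π * θ * (d : ℕ)) : ℝ) : ℂ) / ((d : ℕ) : ℂ) ^ s))
      ((2 * π : ℂ) ^ (-s) * Complex.Gamma s * HurwitzZeta.sinZeta θ s) := by
    refine (Function.Injective.hasSum_iff PNat.coe_injective ?_).mpr h2
    intro n hn
    have : n = 0 := by
      by_contra h
      exact hn ⟨⟨n, Nat.pos_of_ne_zero h⟩, rfl⟩
    simp [this]
  refine h1.unique (h3.congr_fun fun d => ?_)
  have e : ((2 * π * d : ℝ) : ℂ) ^ s = (2 * π : ℂ) ^ s * ((d : ℕ) : ℂ) ^ s := by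
    rw [Complex.ofReal_mul, Complex.mul_cpow_ofReal_nonneg (by positivity) (by positivity)]
    push_cast
    rfl
  rw [e, Complex.cpow_neg, show 2 * π * θ * (d : ℕ) = 2 * π * d * θ by ring]
  field_simp

/-- Termwise integration needs `Re s > 1`. Boundedness of the kernel near `0` makes the left side
holomorphic for `Re s > 0`, and the identity theorem extends the formula. -/
theorem mellin_sineKernel {θ : ℝ} (h0 : 0 < θ) (h1 : θ < 1) {s : ℂ} (hs : 0 < s.re) :
    mellin (fun t => (sineKernel θ t : ℂ)) s
      = (2 * π : ℂ) ^ (-s) * Complex.Gamma s * HurwitzZeta.sinZeta θ s := by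
  have hU : IsOpen {s : ℂ | 0 < s.re} := isOpen_lt continuous_const Complex.continuous_re
  have hUc : IsPreconnected {s : ℂ | 0 < s.re} := (convex_halfSpace_re_gt 0).isPreconnected
  have hf : AnalyticOnNhd ℂ (mellin fun t => (sineKernel θ t : ℂ)) {s : ℂ | 0 < s.re} :=
    DifferentiableOn.analyticOnNhd (fun s hs =>
      (differentiableAt_mellin_sineKernel h0 h1 hs).differentiableWithinAt) hU
  have hg : AnalyticOnNhd ℂ (fun s : ℂ => (2 * π : ℂ) ^ (-s) * Complex.Gamma s *
      HurwitzZeta.sinZeta θ s) {s : ℂ | 0 < s.re} := by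
    refine DifferentiableOn.analyticOnNhd (fun s hs => ?_) hU
    have hs : 0 < s.re := hs
    have hΓ : DifferentiableAt ℂ Complex.Gamma s := Complex.differentiableAt_Gamma _ fun m h => by
      rw [h] at hs
      simp at hs
      linarith [m.cast_nonneg (α := ℝ)]
    have h2π : (2 * π : ℂ) ≠ 0 := by exact_mod_cast (by positivity : 2 * π ≠ 0)
    exact (((differentiableAt_id.neg.const_cpow (Or.inl h2π)).mul hΓ).mul
      (HurwitzZeta.differentiableAt_sinZeta θ s)).differentiableWithinAt
  refine hf.eqOn_of_preconnected_of_eventuallyEq hg hUc (z₀ := 2) (by simp) ?_ hs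
  have : {s : ℂ | 1 < s.re} ∈ 𝓝 (2 : ℂ) :=
    (isOpen_lt continuous_const Complex.continuous_re).mem_nhds (by simp)
  filter_upwards [this] with s hs using mellin_sineKernel_of_one_lt_re θ hs

/-! ### Hurwitz's formula for the odd zeta function -/

theorem hurwitzDiff_eq_two_mul (θ : ℝ) (s : ℂ) :
    hurwitzDiff θ s = 2 * HurwitzZeta.hurwitzZetaOdd θ s := by
  have h : (((1 - θ : ℝ)) : UnitAddCircle) = -(θ : UnitAddCircle) := by
    rw [AddCircle.coe_sub, AddCircle.coe_period, zero_sub]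
  rw [hurwitzDiff, h, HurwitzZeta.hurwitzZeta, HurwitzZeta.hurwitzZeta,
    HurwitzZeta.hurwitzZetaEven_neg, HurwitzZeta.hurwitzZetaOdd_neg]
  ring

theorem hurwitzDiff_one_sub {θ : ℝ} (h0 : 0 < θ) (h1 : θ < 1) {s : ℂ} (hs : 0 < s.re) :
    hurwitzDiff θ (1 - s)
      = 4 * Complex.sin (π * s / 2) * mellin (fun t => (sineKernel θ t : ℂ)) s := by
  rw [hurwitzDiff_eq_two_mul, mellin_sineKernel h0 h1 hs, HurwitzZeta.hurwitzZetaOdd_one_sub _ (by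
    rintro n rfl
    simp at hs
    linarith [n.cast_nonneg (α := ℝ)])]
  ring

/-! ### The remainder series -/

/-- Only finitely many products `d(m+θ)` are below `2x`, and each of them differs from `x`. Beyond
`2x` the constant `1/2` works. -/
theorem exists_pos_le_abs_sq_sub_sq {θ x : ℝ} (h0 : 0 < θ) (hx : 0 < x)
    (hne : ∀ (d : ℕ+) (m : ℕ), (d : ℝ) * (m + θ) ≠ x) :
    ∃ δ : ℝ, 0 < δ ∧ ∀ (d : ℕ+) (m : ℕ),
      δ * ((d : ℝ) * (m + θ)) ^ 2 ≤ |((d : ℝ) * (m + θ)) ^ 2 - x ^ 2| := by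
  set X : ℕ+ × ℕ → ℝ := fun p => (p.1 : ℝ) * (p.2 + θ) with hX
  have hXpos (p : ℕ+ × ℕ) : 0 < X p := by simp only [hX]; positivity
  set T : Set (ℕ+ × ℕ) := {p | X p < 2 * x} with hT
  have hfin : T.Finite := by
    obtain ⟨K, hK⟩ := exists_nat_gt (2 * x / θ)
    obtain ⟨M, hM⟩ := exists_nat_gt (2 * x)
    have hK' : 2 * x < K * θ := by rwa [div_lt_iff₀ h0] at hK
    refine Set.Finite.subset ((Set.finite_Iic (⟨K + 1, K.succ_pos⟩ : ℕ+)).prod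
      (Set.finite_Iic M)) fun p hp => ?_
    have hp : (p.1 : ℝ) * (p.2 + θ) < 2 * x := hp
    have hd : (1 : ℝ) ≤ p.1 := Nat.one_le_cast.mpr p.1.2
    have hm : (0 : ℝ) ≤ p.2 := p.2.cast_nonneg
    constructor
    · have : (p.1 : ℝ) < K := by
        by_contra h
        push Not at h
        nlinarith
      have : (p.1 : ℕ) < K := by exact_mod_cast this
      exact (show (p.1 : ℕ) ≤ K + 1 by omega)
    · have : (p.2 : ℝ) < M := by nlinarith
      have : p.2 < M := by exact_mod_cast this
      exact this.le
  set g : ℕ+ × ℕ → ℝ := fun p => |X p ^ 2 - x ^ 2| / X p ^ 2 with hg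
  have hgpos (p : ℕ+ × ℕ) : 0 < g p := by
    have : X p ^ 2 - x ^ 2 ≠ 0 := by
      rw [sub_ne_zero]
      intro h
      exact hne p.1 p.2 ((pow_left_inj₀ (hXpos p).le hx.le two_ne_zero).mp h)
    have := hXpos p
    simp only [hg]
    positivity
  obtain ⟨δ, hδ, hle⟩ : ∃ δ : ℝ, 0 < δ ∧ ∀ p ∈ T, δ ≤ g p := by
    rcases T.eq_empty_or_nonempty with h | h
    · exact ⟨1, one_pos, by simp [h]⟩
    · obtain ⟨p, -, hp⟩ := Set.exists_min_image T g hfin h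
      exact ⟨g p, hgpos p, hp⟩
  refine ⟨min δ (1 / 2), by positivity, fun d m => ?_⟩
  have hXp := hXpos (d, m)
  by_cases hp : (d, m) ∈ T
  · have h1 := (min_le_left δ (1 / 2)).trans (hle _ hp)
    rw [hg, le_div_iff₀ (by positivity)] at h1
    exact h1
  · have h2 : 2 * x ≤ X (d, m) := not_lt.mp hp
    change min δ (1 / 2) * X (d, m) ^ 2 ≤ |X (d, m) ^ 2 - x ^ 2|
    refine le_trans ?_ (le_abs_self _)
    have h3 : min δ (1 / 2) * X (d, m) ^ 2 ≤ 1 / 2 * X (d, m) ^ 2 := by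
      gcongr
      exact min_le_right _ _
    nlinarith

theorem rpow_le_rpow_add_rpow {y s α b : ℝ} (hy : 0 < y) (h1 : α ≤ s) (h2 : s ≤ b) :
    y ^ s ≤ y ^ b + y ^ α := by
  have hb := Real.rpow_nonneg hy.le b
  have ha := Real.rpow_nonneg hy.le α
  rcases le_total 1 y with h | h
  · linarith [Real.rpow_le_rpow_of_exponent_le h h2]
  · linarith [Real.rpow_le_rpow_of_exponent_ge hy h h1]

theorem summable_nat_add_rpow {θ : ℝ} (h0 : 0 < θ) {s : ℝ} (hs : s < -1) :
    Summable fun m : ℕ => ((m : ℝ) + θ) ^ s := by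
  refine ((Real.summable_one_div_nat_add_rpow θ (-s)).mpr (by linarith)).congr fun m => ?_
  have : 0 < (m : ℝ) + θ := by positivity
  rw [abs_of_pos this, Real.rpow_neg this.le, one_div, inv_inv]

theorem summable_pnat_rpow {s : ℝ} (hs : s < -1) : Summable fun d : ℕ+ => (d : ℝ) ^ s :=
  (Real.summable_nat_rpow.mpr hs).comp_injective PNat.coe_injective

/-- Once the denominator is bounded below by `δ y (dy)²`, the powers of `d` are `-2N - 2` and `-Re ν
- 3`. Both are at most `-2`, so the bound separates the variables. -/
theorem norm_cpow_mul_remainderPart_le {δ x y : ℝ} (hδ : 0 < δ) (hx : 0 < x) (hy : 0 < y) (d : ℕ+)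
    (hX : δ * ((d : ℝ) * y) ^ 2 ≤ |((d : ℝ) * y) ^ 2 - x ^ 2|) (N : ℕ) (ν : ℂ) (hν : -1 ≤ ν.re) :
    ‖(d : ℂ) ^ (-ν - 1) * remainderPart ν N x d y‖
      ≤ δ⁻¹ * ((d : ℝ) ^ (-2 : ℝ) * (y ^ (ν.re - 2 * N - 2) + x ^ (ν.re + 1 - 2 * N) *
        y ^ (-3 : ℝ))) := by
  have hd : (0 : ℝ) < d := by positivity
  have hd1 : (1 : ℝ) ≤ d := Nat.one_le_cast.mpr d.2
  set s := ν.re with hs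
  have hre : (ν + 1 - 2 * N).re = s + 1 - 2 * N := by simp [hs]
  have hnum : ‖(((d * y : ℝ) : ℂ) ^ (ν + 1 - 2 * N) - (x : ℂ) ^ (ν + 1 - 2 * N))‖
      ≤ (d * y) ^ (s + 1 - 2 * N) + x ^ (s + 1 - 2 * N) := by
    refine (norm_sub_le _ _).trans (le_of_eq ?_)
    rw [Complex.norm_cpow_eq_rpow_re_of_pos (by positivity),
      Complex.norm_cpow_eq_rpow_re_of_pos hx, hre]
  have hden : y * (δ * ((d : ℝ) * y) ^ 2) ≤ ‖((y * ((d : ℝ) ^ 2 * y ^ 2 - x ^ 2) : ℝ) : ℂ)‖ := by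
    rw [Complex.norm_real, Real.norm_eq_abs, abs_mul, abs_of_pos hy, ← mul_pow]
    gcongr
  have hpow : ‖(d : ℂ) ^ (-ν - 1)‖ = (d : ℝ) ^ (-s - 1) := by
    have := Complex.norm_cpow_eq_rpow_re_of_pos hd (-ν - 1)
    simpa [hs] using this
  rw [norm_mul, hpow, remainderPart, norm_div]
  calc (d : ℝ) ^ (-s - 1) * (‖(((d * y : ℝ) : ℂ) ^ (ν + 1 - 2 * N) - (x : ℂ) ^ (ν + 1 - 2 * N))‖
        / ‖((y * ((d : ℝ) ^ 2 * y ^ 2 - x ^ 2) : ℝ) : ℂ)‖)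
      ≤ (d : ℝ) ^ (-s - 1) * (((d * y) ^ (s + 1 - 2 * N) + x ^ (s + 1 - 2 * N))
        / (y * (δ * ((d : ℝ) * y) ^ 2))) := by gcongr
    _ = δ⁻¹ * ((d : ℝ) ^ (-2 * N - 2 : ℝ) * y ^ (s - 2 * N - 2)
        + (d : ℝ) ^ (-s - 3) * (x ^ (s + 1 - 2 * N) * y ^ (-3 : ℝ))) := by
      have e1 : (d : ℝ) ^ (-2 * N - 2 : ℝ)
          = (d : ℝ) ^ (-s - 1) * (d : ℝ) ^ (s + 1 - 2 * N) / (d : ℝ) ^ 2 := by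
        rw [← Real.rpow_add hd, ← Real.rpow_natCast (d : ℝ) 2, ← Real.rpow_sub hd]
        congr 1
        push_cast
        ring
      have e2 : (d : ℝ) ^ (-s - 3) = (d : ℝ) ^ (-s - 1) / (d : ℝ) ^ 2 := by
        rw [← Real.rpow_natCast (d : ℝ) 2, ← Real.rpow_sub hd]
        congr 1
        push_cast
        ring
      have e3 : y ^ (s - 2 * N - 2) = y ^ (s + 1 - 2 * N) / y ^ 3 := by
        rw [← Real.rpow_natCast y 3, ← Real.rpow_sub hy]
        congr 1
        push_cast
        ring
      have e4 : y ^ (-3 : ℝ) = (y ^ 3)⁻¹ := by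
        rw [Real.rpow_neg hy.le, ← Real.rpow_natCast y 3]
        norm_num
      rw [e1, e2, e3, e4, Real.mul_rpow hd.le hy.le]
      field_simp
    _ ≤ δ⁻¹ * ((d : ℝ) ^ (-2 : ℝ) * y ^ (s - 2 * N - 2)
        + (d : ℝ) ^ (-2 : ℝ) * (x ^ (s + 1 - 2 * N) * y ^ (-3 : ℝ))) := by
      have f1 : (d : ℝ) ^ (-2 * N - 2 : ℝ) ≤ (d : ℝ) ^ (-2 : ℝ) :=
        Real.rpow_le_rpow_of_exponent_le hd1 (by linarith [N.cast_nonneg (α := ℝ)])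
      have f2 : (d : ℝ) ^ (-s - 3) ≤ (d : ℝ) ^ (-2 : ℝ) :=
        Real.rpow_le_rpow_of_exponent_le hd1 (by linarith)
      gcongr
    _ = _ := by rw [mul_add ((d : ℝ) ^ (-2 : ℝ))]

/-- One majorant for a whole vertical strip, as holomorphy in `ν` requires. The condition `b < 2N +
1` says exactly that the exponent `b - 2N - 2` of `m + θ` is below `-1`. -/
theorem exists_remainder_bound {θ x : ℝ} (h0 : 0 < θ) (hx : 0 < x)
    (hne : ∀ (d : ℕ+) (m : ℕ), (d : ℝ) * (m + θ) ≠ x) (N : ℕ) {α b : ℝ} (hα : -1 ≤ α)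
    (hαb : α ≤ b) (hb : b < 2 * N + 1) :
    ∃ u : ℕ+ × ℕ → ℝ, Summable u ∧ ∀ ν : ℂ, α ≤ ν.re → ν.re ≤ b → ∀ p : ℕ+ × ℕ,
      ‖(p.1 : ℂ) ^ (-ν - 1) * remainderPart ν N x p.1 (p.2 + θ)‖ ≤ u p := by
  obtain ⟨δ, hδ, hle⟩ := exists_pos_le_abs_sq_sub_sq h0 hx hne
  set C : ℝ := x ^ (b + 1 - 2 * N) + x ^ (α + 1 - 2 * N) with hC
  have hC0 : 0 ≤ C := by positivity
  refine ⟨fun p => δ⁻¹ * ((p.1 : ℝ) ^ (-2 : ℝ) * (((p.2 + θ) ^ (b - 2 * N - 2)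
    + (p.2 + θ) ^ (α - 2 * N - 2)) + C * (p.2 + θ) ^ (-3 : ℝ))), ?_, fun ν h1 h2 p => ?_⟩
  · refine Summable.mul_left _ (Summable.mul_of_nonneg (summable_pnat_rpow (by norm_num))
      (((summable_nat_add_rpow h0 (by linarith)).add
        (summable_nat_add_rpow h0 (by linarith))).add
        ((summable_nat_add_rpow h0 (by norm_num)).mul_left C)) ?_ ?_)
    · intro d
      simp only [Pi.zero_apply]
      positivity
    · intro m
      simp only [Pi.zero_apply]
      positivity
  · have hy : 0 < (p.2 : ℝ) + θ := by positivity
    refine (norm_cpow_mul_remainderPart_le hδ hx hy p.1 (hle p.1 p.2) N ν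
      (hα.trans h1)).trans ?_
    have f1 := rpow_le_rpow_add_rpow hy (show α - 2 * N - 2 ≤ ν.re - 2 * N - 2 by linarith)
      (show ν.re - 2 * N - 2 ≤ b - 2 * N - 2 by linarith)
    have f2 := rpow_le_rpow_add_rpow hx (show α + 1 - 2 * N ≤ ν.re + 1 - 2 * N by linarith)
      (show ν.re + 1 - 2 * N ≤ b + 1 - 2 * N by linarith)
    beta_reduce
    gcongr

theorem summable_remainderPart {θ x : ℝ} (h0 : 0 < θ) (hx : 0 < x)
    (hne : ∀ (d : ℕ+) (m : ℕ), (d : ℝ) * (m + θ) ≠ x) (N : ℕ) {ν : ℂ} (hν : -1 ≤ ν.re)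
    (hN : ν.re < 2 * N + 1) :
    Summable fun p : ℕ+ × ℕ => (p.1 : ℂ) ^ (-ν - 1) * remainderPart ν N x p.1 (p.2 + θ) := by
  obtain ⟨u, hu, hle⟩ := exists_remainder_bound h0 hx hne N hν le_rfl hN
  exact Summable.of_norm_bounded hu (hle ν le_rfl le_rfl)

/-! ### Independence of the right-hand side from `N` -/

theorem remainderTerm_eq (ν : ℂ) (N : ℕ) (θ x : ℝ) (d : ℕ+) (m : ℕ) :
    remainderTerm ν N θ x d m = (d : ℂ) ^ (-ν - 1) * remainderPart ν N x d (m + θ)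
      - (d : ℂ) ^ (-ν - 1) * remainderPart ν N x d (m + (1 - θ)) := by
  rw [remainderTerm, mul_sub, add_sub_assoc]

theorem summable_remainderTerm {θ x : ℝ} (h0 : 0 < θ) (h1 : θ < 1) (hx : 0 < x)
    (hne : ∀ (d : ℕ+) (m : ℕ), (d : ℝ) * (m + θ) ≠ x)
    (hne' : ∀ (d : ℕ+) (m : ℕ), (d : ℝ) * (m + (1 - θ)) ≠ x) (N : ℕ) {ν : ℂ} (hν : -1 ≤ ν.re)
    (hN : ν.re < 2 * N + 1) :
    Summable fun p : ℕ+ × ℕ => remainderTerm ν N θ x p.1 p.2 := by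
  simp only [remainderTerm_eq]
  exact (summable_remainderPart h0 hx hne N hν hN).sub
    (summable_remainderPart (sub_pos.mpr h1) hx hne' N hν hN)

/-- With `X = dy` and `a = ν + 1 - 2N`, `(X^a - x^a) - x²(X^{a-2} - x^{a-2}) = X^{a-2}(X² - x²)`.
The denominator cancels and a product of a power of `d` and a power of `y` remains. -/
theorem remainderPart_succ {x y : ℝ} (hx : 0 < x) (hy : 0 < y) (d : ℕ+) (h : (d : ℝ) * y ≠ x)
    (ν : ℂ) (N : ℕ) :
    (d : ℂ) ^ (-ν - 1) * remainderPart ν N x d y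
      = (x : ℂ) ^ 2 * ((d : ℂ) ^ (-ν - 1) * remainderPart ν (N + 1) x d y)
        + 1 / (d : ℂ) ^ (2 * N + 2) * (1 / (y : ℂ) ^ (2 * N + 2 - ν)) := by
  have hd : (0 : ℝ) < d := by positivity
  have hd' : (d : ℂ) ≠ 0 := by exact_mod_cast hd.ne'
  have hy' : (y : ℂ) ≠ 0 := by exact_mod_cast hy.ne'
  have hx' : (x : ℂ) ≠ 0 := by exact_mod_cast hx.ne'
  have hden : (d : ℂ) ^ 2 * (y : ℂ) ^ 2 - (x : ℂ) ^ 2 ≠ 0 := by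
    rw [← mul_pow, sub_ne_zero]
    intro hh
    have : ((d : ℝ) * y) ^ 2 = x ^ 2 := by exact_mod_cast hh
    exact h ((pow_left_inj₀ (by positivity) hx.le two_ne_zero).mp this)
  have e1 : ν + 1 - 2 * ((N + 1 : ℕ) : ℂ) = ν + 1 - 2 * N - (2 : ℕ) := by push_cast; ring
  have e2 : (y : ℂ) ^ (2 * (N : ℂ) + 2 - ν) = (y : ℂ) ^ 3 / (y : ℂ) ^ (ν + 1 - 2 * N) := by
    rw [show 2 * (N : ℂ) + 2 - ν = (3 : ℕ) - (ν + 1 - 2 * N) by push_cast; ring,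
      Complex.cpow_sub _ _ hy', Complex.cpow_natCast]
  have e3 : (d : ℂ) ^ (ν + 1 - 2 * N) * (d : ℂ) ^ (-ν - 1) = 1 / (d : ℂ) ^ (2 * N) := by
    rw [← Complex.cpow_add _ _ hd', show ν + 1 - 2 * (N : ℂ) + (-ν - 1) = -((2 * N : ℕ) : ℂ) by
      push_cast; ring, Complex.cpow_neg, Complex.cpow_natCast, one_div]
  have e4 : (d : ℂ) ^ (-ν - 1) = 1 / (d : ℂ) ^ (2 * N) / (d : ℂ) ^ (ν + 1 - 2 * N) := by
    rw [← e3, mul_div_cancel_left₀]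
    rw [Ne, Complex.cpow_eq_zero_iff]
    tauto
  have hdp : (d : ℂ) ^ (ν + 1 - 2 * N) ≠ 0 := by rw [Ne, Complex.cpow_eq_zero_iff]; tauto
  have hyp : (y : ℂ) ^ (ν + 1 - 2 * N) ≠ 0 := by rw [Ne, Complex.cpow_eq_zero_iff]; tauto
  have hX : (((d : ℝ) * y : ℝ) : ℂ) ≠ 0 := by exact_mod_cast (by positivity : (d : ℝ) * y ≠ 0)
  have e5 : (((d : ℝ) * y : ℝ) : ℂ) ^ (ν + 1 - 2 * N)
      = (d : ℂ) ^ (ν + 1 - 2 * N) * (y : ℂ) ^ (ν + 1 - 2 * N) := by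
    rw [Complex.ofReal_mul, Complex.mul_cpow_ofReal_nonneg hd.le hy.le]
    rfl
  rw [remainderPart, remainderPart, e1, Complex.cpow_sub _ ((2 : ℕ) : ℂ) hX,
    Complex.cpow_sub _ ((2 : ℕ) : ℂ) hx',
    Complex.cpow_natCast, Complex.cpow_natCast, e2, e4, e5]
  generalize (d : ℂ) ^ (ν + 1 - 2 * N) = D at *
  generalize (y : ℂ) ^ (ν + 1 - 2 * N) = Y at *
  generalize (x : ℂ) ^ (ν + 1 - 2 * N) = Z at *
  push_cast
  rw [pow_add]
  have hd'' : ((d : ℝ) : ℂ) = (d : ℂ) := by push_cast; rfl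
  have hP : (d : ℂ) ^ (2 * N) ≠ 0 := pow_ne_zero _ hd'
  generalize (d : ℂ) ^ (2 * N) = P at *
  obtain ⟨W, hW⟩ : ∃ W : ℂ, W = (d : ℂ) ^ 2 * (y : ℂ) ^ 2 - (x : ℂ) ^ 2 := ⟨_, rfl⟩
  rw [← hW] at hden ⊢
  field_simp
  rw [hW]
  ring

/-- The right-hand side of the identity with `sin (2πdθ)`. -/
def sineRHS (ν : ℂ) (N : ℕ) (θ x : ℝ) : ℂ :=
  1 / Complex.cos (Real.pi * ν / 2) * riemannZeta (ν + 1) * hurwitzDiff θ 1 * (x : ℂ) ^ ν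
    - Real.pi / (2 * Complex.sin (Real.pi * ν / 2)) * hurwitzDiff θ (1 - ν)
    + 1 / (2 * x * Complex.cos (Real.pi * ν / 2)) * hurwitzDiff θ (-ν)
    - 1 / Complex.cos (Real.pi * ν / 2)
        * ∑ j ∈ Finset.Icc 1 N,
            riemannZeta (2 * j) * hurwitzDiff θ (2 * j - ν) * (x : ℂ) ^ (2 * j - 1)
    - 1 / Complex.cos (Real.pi * ν / 2) * (x : ℂ) ^ (2 * N + 1)
        * ∑' d : ℕ+, ∑' m : ℕ, remainderTerm ν N θ x d m

theorem hasSum_pnat_zeta {s : ℂ} (hs : 1 < s.re) :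
    HasSum (fun d : ℕ+ => 1 / (d : ℂ) ^ s) (riemannZeta s) := by
  rw [zeta_eq_tsum_one_div_nat_cpow hs]
  have h := (Complex.summable_one_div_nat_cpow.mpr hs).hasSum
  refine (Function.Injective.hasSum_iff PNat.coe_injective ?_).mpr h
  intro n hn
  have : n = 0 := by
    by_contra h
    exact hn ⟨⟨n, Nat.pos_of_ne_zero h⟩, rfl⟩
  have hs0 : s ≠ 0 := by rintro rfl; norm_num at hs
  simp [this, Complex.zero_cpow hs0]

theorem summable_one_div_nat_add_cpow {θ : ℝ} (h0 : 0 < θ) {s : ℂ} (hs : 1 < s.re) :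
    Summable fun m : ℕ => 1 / ((m + θ : ℝ) : ℂ) ^ s := by
  refine Summable.of_norm ((summable_nat_add_rpow h0 (neg_lt_neg hs)).congr fun m => ?_)
  have : 0 < (m : ℝ) + θ := by positivity
  rw [norm_div, norm_one, Complex.norm_cpow_eq_rpow_re_of_pos this, Real.rpow_neg this.le, one_div]

theorem hasSum_hurwitzDiff {θ : ℝ} (h0 : 0 < θ) (h1 : θ < 1) {s : ℂ} (hs : 1 < s.re) :
    HasSum (fun m : ℕ => 1 / ((m + θ : ℝ) : ℂ) ^ s - 1 / ((m + (1 - θ) : ℝ) : ℂ) ^ s)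
      (hurwitzDiff θ s) := by
  rw [hurwitzDiff_eq_tsum h0 h1 hs]
  have hA := (summable_one_div_nat_add_cpow h0 hs).hasSum
  have hB := (summable_one_div_nat_add_cpow (sub_pos.mpr h1) hs).hasSum
  have := hA.sub hB
  push_cast at this ⊢
  exact this

theorem hasSum_mul_of_hasSum {ι κ : Type*} {f : ι → ℂ} {g : κ → ℂ} {a b : ℂ} (hf : HasSum f a)
    (hg : HasSum g b) : HasSum (fun p : ι × κ => f p.1 * g p.2) (a * b) :=
  hf.mul hg (summable_mul_of_summable_norm hf.summable.norm hg.summable.norm)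

/-- The separated terms sum to a product of two Dirichlet series, absolutely convergent because
`Re(2N + 2 - ν) > 1`. This product is the `j = N + 1` term of the finite sum. -/
theorem tsum_remainderTerm_succ {θ x : ℝ} (h0 : 0 < θ) (h1 : θ < 1) (hx : 0 < x)
    (hne : ∀ (d : ℕ+) (m : ℕ), (d : ℝ) * (m + θ) ≠ x)
    (hne' : ∀ (d : ℕ+) (m : ℕ), (d : ℝ) * (m + (1 - θ)) ≠ x) (N : ℕ) {ν : ℂ} (hν : -1 ≤ ν.re)
    (hN : ν.re < 2 * N + 1) :
    ∑' d : ℕ+, ∑' m : ℕ, remainderTerm ν N θ x d m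
      = (x : ℂ) ^ 2 * ∑' d : ℕ+, ∑' m : ℕ, remainderTerm ν (N + 1) θ x d m
        + riemannZeta (2 * N + 2) * hurwitzDiff θ (2 * N + 2 - ν) := by
  have hs0 := summable_remainderTerm h0 h1 hx hne hne' N hν hN
  have hs1 := summable_remainderTerm h0 h1 hx hne hne' (N + 1) hν (by push_cast; linarith)
  have hζ : HasSum (fun d : ℕ+ => 1 / (d : ℂ) ^ (2 * N + 2)) (riemannZeta (2 * N + 2)) := by
    have h2 : (1 : ℝ) < (2 * (N : ℂ) + 2).re := by
      simp
      linarith [N.cast_nonneg (α := ℝ)]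
    refine (hasSum_pnat_zeta h2).congr_fun fun d => ?_
    rw [← Complex.cpow_natCast]
    push_cast
    rfl
  have hH := hasSum_hurwitzDiff h0 h1 (s := 2 * N + 2 - ν) (by simp; linarith)
  have hprod := hasSum_mul_of_hasSum hζ hH
  rw [← hs0.tsum_prod, ← hs1.tsum_prod, ← tsum_mul_left, ← hprod.tsum_eq,
    ← (hs1.mul_left _).tsum_add hprod.summable]
  refine tsum_congr fun p => ?_
  rw [remainderTerm_eq, remainderTerm_eq,
    remainderPart_succ hx (by positivity) p.1 (hne p.1 p.2),
    remainderPart_succ hx (add_pos_of_nonneg_of_pos p.2.cast_nonneg (sub_pos.mpr h1)) p.1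
      (hne' p.1 p.2)]
  ring

theorem sineRHS_succ {θ x : ℝ} (h0 : 0 < θ) (h1 : θ < 1) (hx : 0 < x)
    (hne : ∀ (d : ℕ+) (m : ℕ), (d : ℝ) * (m + θ) ≠ x)
    (hne' : ∀ (d : ℕ+) (m : ℕ), (d : ℝ) * (m + (1 - θ)) ≠ x) (N : ℕ) {ν : ℂ} (hν : -1 ≤ ν.re)
    (hN : ν.re < 2 * N + 1) : sineRHS ν (N + 1) θ x = sineRHS ν N θ x := by
  rw [sineRHS, sineRHS, tsum_remainderTerm_succ h0 h1 hx hne hne' N hν hN,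
    Finset.sum_Icc_succ_top (by omega), show 2 * (N + 1) - 1 = 2 * N + 1 by omega]
  push_cast
  rw [show 2 * ((N : ℂ) + 1) = 2 * N + 2 by ring]
  ring

theorem sineRHS_eq_zero_index {θ x : ℝ} (h0 : 0 < θ) (h1 : θ < 1) (hx : 0 < x)
    (hne : ∀ (d : ℕ+) (m : ℕ), (d : ℝ) * (m + θ) ≠ x)
    (hne' : ∀ (d : ℕ+) (m : ℕ), (d : ℝ) * (m + (1 - θ)) ≠ x) (N : ℕ) {ν : ℂ} (hν : -1 ≤ ν.re)
    (hν' : ν.re < 1) : sineRHS ν N θ x = sineRHS ν 0 θ x := by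
  induction N with
  | zero => rfl
  | succ N ih =>
    rw [sineRHS_succ h0 h1 hx hne hne' N hν (by linarith [N.cast_nonneg (α := ℝ)]), ih]

/-! ### The value of `ζ(s, θ) - ζ(s, 1 - θ)` at `s = 1` -/

/-- Factor out `y^{-s} ≤ 1/c + 1/c²`; the other factor `1 - (y/z)^s` is at most `1 - (y/z)² ≤ 2/c`.
The quadratic decay in `c` is uniform in `s`. -/
theorem abs_rpow_neg_sub_rpow_neg_le_of_le {y z c s : ℝ} (hc : 0 < c) (hy : c ≤ y) (hyz : y ≤ z)
    (hyz' : z - y ≤ 1) (hs1 : 1 ≤ s) (hs2 : s ≤ 2) :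
    |y ^ (-s) - z ^ (-s)| ≤ 2 * (1 + 1 / c) * (1 / c ^ 2) := by
  have hy0 := hc.trans_le hy
  have hz0 := hy0.trans_le hyz
  have hle : z ^ (-s) ≤ y ^ (-s) := Real.rpow_le_rpow_of_nonpos hy0 hyz (by linarith)
  have h1 : y ^ (-s) - z ^ (-s) = y ^ (-s) * (1 - (y / z) ^ s) := by
    rw [Real.div_rpow hy0.le hz0.le, Real.rpow_neg hy0.le, Real.rpow_neg hz0.le]
    have : y ^ s ≠ 0 := (Real.rpow_pos_of_pos hy0 s).ne'
    field_simp
  have h2 : (y / z) ^ (2 : ℝ) ≤ (y / z) ^ s :=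
    Real.rpow_le_rpow_of_exponent_ge (by positivity) ((div_le_one hz0).mpr hyz) hs2
  have h3 : 1 - (y / z) ^ s ≤ 2 / c := by
    have h4 : 1 - (y / z) ^ 2 ≤ 2 / z := by
      have : 1 - (y / z) ^ 2 = (z - y) * (z + y) / z ^ 2 := by
        field_simp
        ring
      rw [this, div_le_div_iff₀ (by positivity) hz0]
      have h6 : (z - y) * (z + y) ≤ 1 * (2 * z) :=
        mul_le_mul hyz' (by linarith) (by linarith) zero_le_one
      nlinarith
    have h5 : 2 / z ≤ 2 / c := by gcongr; linarith
    rw [Real.rpow_two] at h2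
    linarith
  have h6 : y ^ (-s) ≤ 1 / c + 1 / c ^ 2 := by
    have h7 : y ^ (-s) ≤ c ^ (-s) := Real.rpow_le_rpow_of_nonpos hc hy (by linarith)
    have h8 := rpow_le_rpow_add_rpow hc (neg_le_neg hs2) (neg_le_neg hs1)
    rw [Real.rpow_neg_one, Real.rpow_neg hc.le 2, Real.rpow_two] at h8
    rw [one_div, one_div]
    linarith
  rw [abs_of_nonneg (by linarith), h1]
  calc y ^ (-s) * (1 - (y / z) ^ s) ≤ y ^ (-s) * (2 / c) := by
        have := Real.rpow_nonneg hy0.le (-s)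
        gcongr
    _ ≤ (1 / c + 1 / c ^ 2) * (2 / c) := by gcongr
    _ = _ := by field_simp

theorem abs_rpow_neg_sub_rpow_neg_le {y z c s : ℝ} (hc : 0 < c) (hy : c ≤ y) (hz : c ≤ z)
    (hyz : |z - y| ≤ 1) (hs1 : 1 ≤ s) (hs2 : s ≤ 2) :
    |y ^ (-s) - z ^ (-s)| ≤ 2 * (1 + 1 / c) * (1 / c ^ 2) := by
  rw [abs_le] at hyz
  rcases le_total y z with h | h
  · exact abs_rpow_neg_sub_rpow_neg_le_of_le hc hy h hyz.2 hs1 hs2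
  · rw [abs_sub_comm]
    exact abs_rpow_neg_sub_rpow_neg_le_of_le hc hz h (by linarith) hs1 hs2

/-- Each Hurwitz series diverges at `s = 1`; the paired series has a majorant uniform on `(1, 2)`,
so dominated convergence as `s → 1⁺` applies. -/
theorem hasSum_hurwitzDiff_one {θ : ℝ} (h0 : 0 < θ) (h1 : θ < 1) :
    HasSum (fun m : ℕ => 1 / ((m + θ : ℝ) : ℂ) - 1 / ((m + (1 - θ) : ℝ) : ℂ))
      (hurwitzDiff θ 1) := by
  set μ := min θ (1 - θ) with hμ
  have hμ0 : 0 < μ := lt_min h0 (by linarith)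
  have hy (m : ℕ) : 0 < (m : ℝ) + θ := by positivity
  have hz (m : ℕ) : 0 < (m : ℝ) + (1 - θ) :=
    add_pos_of_nonneg_of_pos m.cast_nonneg (sub_pos.mpr h1)
  have hterm (m : ℕ) (s : ℝ) : 1 / ((m + θ : ℝ) : ℂ) ^ (s : ℂ) - 1 / ((m + (1 - θ) : ℝ) : ℂ) ^ (s : ℂ)
      = ((((m : ℝ) + θ) ^ (-s) - ((m : ℝ) + (1 - θ)) ^ (-s) : ℝ) : ℂ) := by
    rw [Real.rpow_neg (hy m).le, Real.rpow_neg (hz m).le, Complex.ofReal_sub, Complex.ofReal_inv,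
      Complex.ofReal_inv, Complex.ofReal_cpow (hy m).le, Complex.ofReal_cpow (hz m).le, one_div,
      one_div]
  have hbound (m : ℕ) (s : ℝ) (hs1 : 1 ≤ s) (hs2 : s ≤ 2) :
      ‖1 / ((m + θ : ℝ) : ℂ) ^ (s : ℂ) - 1 / ((m + (1 - θ) : ℝ) : ℂ) ^ (s : ℂ)‖
        ≤ 2 * (1 + 1 / μ) * poleBound θ m := by
    rw [hterm, Complex.norm_real, Real.norm_eq_abs]
    refine (abs_rpow_neg_sub_rpow_neg_le (c := m + μ) (by positivity) ?_ ?_ ?_ hs1 hs2).trans ?_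
    · linarith [min_le_left θ (1 - θ)]
    · linarith [min_le_right θ (1 - θ)]
    · rw [abs_le]; constructor <;> linarith
    · rw [poleBound]
      gcongr
      linarith [m.cast_nonneg (α := ℝ)]
  have hsumm := (summable_poleBound h0 h1).mul_left (2 * (1 + 1 / μ))
  have hlim := tendsto_tsum_of_dominated_convergence (𝓕 := 𝓝[>] (1 : ℝ))
    (f := fun (s : ℝ) (m : ℕ) =>
      1 / ((m + θ : ℝ) : ℂ) ^ (s : ℂ) - 1 / ((m + (1 - θ) : ℝ) : ℂ) ^ (s : ℂ))
    (g := fun m : ℕ => 1 / ((m + θ : ℝ) : ℂ) - 1 / ((m + (1 - θ) : ℝ) : ℂ)) hsumm (by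
      intro m
      have hc (y : ℝ) (hy : 0 < y) : Tendsto (fun s : ℝ => 1 / (y : ℂ) ^ (s : ℂ)) (𝓝[>] (1 : ℝ))
          (𝓝 (1 / (y : ℂ))) := by
        have hy' : (y : ℂ) ≠ 0 := by exact_mod_cast hy.ne'
        have h : ContinuousAt (fun s : ℝ => 1 / (y : ℂ) ^ (s : ℂ)) 1 := by
          refine ContinuousAt.div continuousAt_const ?_ ?_
          · exact (continuousAt_const_cpow hy').comp Complex.continuous_ofReal.continuousAt
          · rw [Ne, Complex.cpow_eq_zero_iff]
            tauto
        have := h.tendsto.mono_left (nhdsWithin_le_nhds (s := Ioi 1))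
        simpa using this
      exact (hc _ (hy m)).sub (hc _ (hz m))) (by
      filter_upwards [Ioo_mem_nhdsGT one_lt_two] with s hs m
      exact hbound m s hs.1.le hs.2.le)
  have hlim2 : Tendsto (fun s : ℝ => hurwitzDiff θ s) (𝓝[>] 1) (𝓝 (hurwitzDiff θ 1)) := by
    have h : ContinuousAt (fun s : ℝ => hurwitzDiff θ s) 1 :=
      ((differentiable_hurwitzDiff θ).continuous.comp Complex.continuous_ofReal).continuousAt
    have := h.tendsto.mono_left (nhdsWithin_le_nhds (s := Ioi 1))
    simpa using this
  have heq : hurwitzDiff θ 1 = ∑' m : ℕ, (1 / ((m + θ : ℝ) : ℂ) - 1 / ((m + (1 - θ) : ℝ) : ℂ)) := by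
    refine tendsto_nhds_unique hlim2 (hlim.congr' ?_)
    filter_upwards [self_mem_nhdsWithin] with s hs
    exact (hasSum_hurwitzDiff h0 h1 (s := s) (by simpa using hs)).tsum_eq
  rw [heq]
  refine (Summable.of_norm_bounded hsumm fun m => ?_).hasSum
  have := hbound m 1 le_rfl one_le_two
  simpa using this

/-! ### The integral identity for `0 < Re ν < 1` -/

/-- The product of fractions is `y/(y²-c²)` times `1/(t²+c²) - 1/(t²+y²)`, and each part has a known
Mellin transform. In the application `c = x/d`, so `y ≠ c` is where the excluded values of `x`
enter. -/
theorem integral_partial_fraction {ν : ℂ} (h0 : -1 < ν.re) (h1 : ν.re < 1) {y c : ℝ} (hy : 0 < y)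
    (hc : 0 < c) (hne : y ≠ c) :
    IntegrableOn (fun t : ℝ => (t : ℂ) ^ ν * ((1 / (t ^ 2 + c ^ 2) * (y / (t ^ 2 + y ^ 2)) : ℝ) : ℂ))
      (Ioi 0) ∧
    ∫ t in Ioi (0 : ℝ), (t : ℂ) ^ ν * ((1 / (t ^ 2 + c ^ 2) * (y / (t ^ 2 + y ^ 2)) : ℝ) : ℂ)
      = π / (2 * Complex.cos (π * ν / 2)) *
        (y * ((c : ℂ) ^ (ν - 1) - (y : ℂ) ^ (ν - 1)) / ((y : ℂ) ^ 2 - (c : ℂ) ^ 2)) := by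
  have hC := hasMellin_one_div_sq_add_sq h0 h1 hc
  have hY := hasMellin_one_div_sq_add_sq h0 h1 hy
  have hsub := hasMellin_sub hC.1 hY.1
  rw [hC.2, hY.2] at hsub
  have hsq : y ^ 2 - c ^ 2 ≠ 0 := by
    rw [sub_ne_zero]
    exact fun h => hne ((pow_left_inj₀ hy.le hc.le two_ne_zero).mp h)
  have e (t : ℝ) : (t : ℂ) ^ ν * ((1 / (t ^ 2 + c ^ 2) * (y / (t ^ 2 + y ^ 2)) : ℝ) : ℂ)
      = ((y / (y ^ 2 - c ^ 2) : ℝ) : ℂ) * ((t : ℂ) ^ (ν + 1 - 1) •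
        (((1 / (t ^ 2 + c ^ 2) : ℝ) : ℂ) - ((1 / (t ^ 2 + y ^ 2) : ℝ) : ℂ))) := by
    have : 1 / (t ^ 2 + c ^ 2) * (y / (t ^ 2 + y ^ 2))
        = y / (y ^ 2 - c ^ 2) * (1 / (t ^ 2 + c ^ 2) - 1 / (t ^ 2 + y ^ 2)) := by
      field_simp
      ring
    rw [this, add_sub_cancel_right, smul_eq_mul]
    push_cast
    ring
  simp only [e]
  refine ⟨hsub.1.const_mul _, ?_⟩
  rw [integral_const_mul]
  have h2 := hsub.2
  rw [mellin] at h2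
  rw [h2]
  push_cast
  ring

theorem integral_norm_one_div_sq_add_sq {ν : ℂ} (h0 : -1 < ν.re) (h1 : ν.re < 1) {c : ℝ}
    (hc : 0 < c) :
    ∫ t in Ioi (0 : ℝ), ‖(t : ℂ) ^ ν * ((1 / (t ^ 2 + c ^ 2) : ℝ) : ℂ)‖
      = π / (2 * Real.cos (π * ν.re / 2)) * c ^ (ν.re - 1) := by
  have h := (hasMellin_one_div_sq_add_sq (ν := ν.re) (by simpa using h0) (by simpa using h1) hc).2
  rw [mellin, add_sub_cancel_right] at h
  rw [← Complex.ofReal_inj, ← integral_complex_ofReal]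
  push_cast
  rw [Complex.ofReal_cpow hc.le]
  push_cast
  rw [← h]
  refine setIntegral_congr_fun measurableSet_Ioi fun t ht => ?_
  have ht : 0 < t := ht
  simp only [norm_mul, smul_eq_mul]
  rw [Complex.norm_cpow_eq_rpow_re_of_pos ht]
  have : 0 ≤ 1 / (t ^ 2 + c ^ 2) := by positivity
  have e : ‖(1 : ℂ) / (t ^ 2 + c ^ 2)‖ = 1 / (t ^ 2 + c ^ 2) := by
    have := Complex.norm_real (1 / (t ^ 2 + c ^ 2))
    push_cast at this
    rw [this, Real.norm_of_nonneg (by positivity)]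
  push_cast
  rw [e, Complex.ofReal_cpow ht.le]
  push_cast
  rfl

theorem norm_integrand_mul_le {ν : ℂ} {c t A K : ℝ} (h : |A| ≤ K) :
    ‖(t : ℂ) ^ ν * ((1 / (t ^ 2 + c ^ 2) * A : ℝ) : ℂ)‖
      ≤ K * ‖(t : ℂ) ^ ν * ((1 / (t ^ 2 + c ^ 2) : ℝ) : ℂ)‖ := by
  rw [norm_mul, norm_mul, Complex.norm_real, Complex.norm_real, norm_mul, Real.norm_eq_abs A]
  calc _ = |A| * (‖(t : ℂ) ^ ν‖ * ‖1 / (t ^ 2 + c ^ 2)‖) := by ring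
    _ ≤ _ := by gcongr

theorem integrableOn_cpow_mul_one_div {ν : ℂ} (h0 : -1 < ν.re) (h1 : ν.re < 1) {c : ℝ}
    (hc : 0 < c) :
    IntegrableOn (fun t : ℝ => (t : ℂ) ^ ν * ((1 / (t ^ 2 + c ^ 2) : ℝ) : ℂ)) (Ioi 0) := by
  have h := (hasMellin_one_div_sq_add_sq h0 h1 hc).1
  rw [MellinConvergent, add_sub_cancel_right] at h
  exact h

theorem hasSum_integral_sineKernel_div {θ : ℝ} (hθ0 : 0 < θ) (hθ1 : θ < 1) {ν : ℂ}
    (h0 : -1 < ν.re) (h1 : ν.re < 1) {c : ℝ} (hc : 0 < c) (hne : ∀ m : ℕ, (m : ℝ) + θ ≠ c)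
    (hne' : ∀ m : ℕ, (m : ℝ) + (1 - θ) ≠ c) :
    HasSum (fun m : ℕ => π / (2 * Complex.cos (π * ν / 2)) *
        ((m + θ : ℝ) * ((c : ℂ) ^ (ν - 1) - ((m + θ : ℝ) : ℂ) ^ (ν - 1))
          / (((m + θ : ℝ) : ℂ) ^ 2 - (c : ℂ) ^ 2)
        - (m + (1 - θ) : ℝ) * ((c : ℂ) ^ (ν - 1) - ((m + (1 - θ) : ℝ) : ℂ) ^ (ν - 1))
          / (((m + (1 - θ) : ℝ) : ℂ) ^ 2 - (c : ℂ) ^ 2)))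
      (2 * π * ∫ t in Ioi (0 : ℝ), (t : ℂ) ^ ν *
        ((1 / (t ^ 2 + c ^ 2) * sineKernel θ t : ℝ) : ℂ)) := by
  have hy (m : ℕ) : 0 < (m : ℝ) + θ := by positivity
  have hz (m : ℕ) : 0 < (m : ℝ) + (1 - θ) :=
    add_pos_of_nonneg_of_pos m.cast_nonneg (sub_pos.mpr hθ1)
  set F : ℕ → ℝ → ℂ := fun m t => (t : ℂ) ^ ν * ((1 / (t ^ 2 + c ^ 2) * poleTerm θ t m : ℝ) : ℂ)
    with hF
  have hFe (m : ℕ) : F m = fun t : ℝ =>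
      (t : ℂ) ^ ν * ((1 / (t ^ 2 + c ^ 2) * ((m + θ) / (t ^ 2 + (m + θ) ^ 2)) : ℝ) : ℂ)
      - (t : ℂ) ^ ν * ((1 / (t ^ 2 + c ^ 2) *
        ((m + (1 - θ)) / (t ^ 2 + (m + (1 - θ)) ^ 2)) : ℝ) : ℂ) := by
    funext t
    simp only [hF]
    rw [poleTerm, add_sub_assoc, mul_sub (1 / (t ^ 2 + c ^ 2)), Complex.ofReal_sub, mul_sub]
  have hA (m : ℕ) := integral_partial_fraction h0 h1 (hy m) hc (hne m)
  have hB (m : ℕ) := integral_partial_fraction h0 h1 (hz m) hc (hne' m)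
  have hint (m : ℕ) : IntegrableOn (F m) (Ioi 0) := by
    rw [hFe]
    exact (hA m).1.sub (hB m).1
  have hbase := integrableOn_cpow_mul_one_div h0 h1 hc
  have hnorm (m : ℕ) : ∫ t in Ioi (0 : ℝ), ‖F m t‖ ≤ poleBound θ m *
      ∫ t in Ioi (0 : ℝ), ‖(t : ℂ) ^ ν * ((1 / (t ^ 2 + c ^ 2) : ℝ) : ℂ)‖ := by
    rw [← integral_const_mul]
    refine integral_mono (hint m).norm (hbase.norm.const_mul _) fun t => ?_
    exact norm_integrand_mul_le (abs_poleTerm_le hθ0 hθ1 t m)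
  have key := hasSum_integral_of_summable_integral_norm hint
    (Summable.of_nonneg_of_le (fun m => integral_nonneg fun t => norm_nonneg _) hnorm
      ((summable_poleBound hθ0 hθ1).mul_right _))
  have hval : ∫ t in Ioi (0 : ℝ), ∑' m, F m t = 2 * π * ∫ t in Ioi (0 : ℝ), (t : ℂ) ^ ν *
        ((1 / (t ^ 2 + c ^ 2) * sineKernel θ t : ℝ) : ℂ) := by
    rw [← integral_const_mul]
    refine setIntegral_congr_fun measurableSet_Ioi fun t ht => ?_
    have h := ((Complex.hasSum_ofReal.mpr (hasSum_poleTerm hθ0 hθ1 ht)).mul_left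
      ((t : ℂ) ^ ν * ((1 / (t ^ 2 + c ^ 2) : ℝ) : ℂ))).tsum_eq
    simp only [hF]
    push_cast at h ⊢
    simp only [← mul_assoc] at h ⊢
    rw [h]
    ring
  rw [hval] at key
  refine key.congr_fun fun m => ?_
  rw [hFe, integral_sub (hA m).1 (hB m).1, (hA m).2, (hB m).2, mul_sub]

/-- The kernel `t ↦ sineKernel θ t * expKernel (x / t)`. -/
def productKernel (θ x t : ℝ) : ℂ := ((sineKernel θ t * expKernel (x / t) : ℝ) : ℂ)

/-- Insert the partial fractions of `E(x/t)`. Since the sine kernel is bounded, the `d`-th integral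
is `O(d^{-1-Re ν})`, which is summable because `Re ν > 0`. -/
theorem hasSum_integral_productKernel {θ x : ℝ} (hθ0 : 0 < θ) (hθ1 : θ < 1) (hx : 0 < x) {ν : ℂ}
    (h0 : 0 < ν.re) (h1 : ν.re < 1) :
    HasSum (fun d : ℕ+ => (x : ℂ) / (d : ℂ) ^ 2 * ∫ t in Ioi (0 : ℝ), (t : ℂ) ^ ν *
        ((1 / (t ^ 2 + (x / d) ^ 2) * sineKernel θ t : ℝ) : ℂ))
      (∫ t in Ioi (0 : ℝ), (t : ℂ) ^ (ν - 1) * ((π * (expKernel (x / t) + 1 / 2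
        - 1 / (2 * π * (x / t))) * sineKernel θ t : ℝ) : ℂ)) := by
  set K := ∑' m, poleBound θ m with hK
  have hc (d : ℕ+) : 0 < x / (d : ℝ) := by positivity
  set F : ℕ+ → ℝ → ℂ := fun d t => (x : ℂ) / (d : ℂ) ^ 2 * ((t : ℂ) ^ ν *
        ((1 / (t ^ 2 + (x / d) ^ 2) * sineKernel θ t : ℝ) : ℂ)) with hF
  have hbase (d : ℕ+) := integrableOn_cpow_mul_one_div (by linarith) h1 (hc d)
  have hle (d : ℕ+) (t : ℝ) (ht : 0 < t) : ‖(t : ℂ) ^ ν *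
        ((1 / (t ^ 2 + (x / d) ^ 2) * sineKernel θ t : ℝ) : ℂ)‖
      ≤ K * ‖(t : ℂ) ^ ν * ((1 / (t ^ 2 + (x / d) ^ 2) : ℝ) : ℂ)‖ :=
    norm_integrand_mul_le (abs_sineKernel_le hθ0 hθ1 ht)
  have hint (d : ℕ+) : IntegrableOn (fun t : ℝ => (t : ℂ) ^ ν *
        ((1 / (t ^ 2 + (x / d) ^ 2) * sineKernel θ t : ℝ) : ℂ)) (Ioi 0) := by
    refine Integrable.mono' ((hbase d).norm.const_mul K) ?_ ?_
    · have h2 := ((Complex.continuous_ofReal.comp_continuousOn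
        (continuousOn_sineKernel θ)).aestronglyMeasurable (μ := volume) measurableSet_Ioi)
      refine ((hbase d).1.mul h2).congr (Eventually.of_forall fun t => ?_)
      simp only [Pi.mul_apply, Function.comp_apply, Complex.ofReal_mul]
      ring
    · filter_upwards [self_mem_ae_restrict measurableSet_Ioi] with t ht using hle d t ht
  have hnorm (d : ℕ+) : ∫ t in Ioi (0 : ℝ), ‖F d t‖ ≤
      (K * (π / (2 * Real.cos (π * ν.re / 2))) * (x * x ^ (ν.re - 1))) *
        (d : ℝ) ^ (-1 - ν.re) := by
    have hd : (0 : ℝ) < d := by positivity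
    have h2 : ∫ t in Ioi (0 : ℝ), ‖F d t‖ ≤ ∫ t in Ioi (0 : ℝ), x / (d : ℝ) ^ 2 *
        (K * ‖(t : ℂ) ^ ν * ((1 / (t ^ 2 + (x / d) ^ 2) : ℝ) : ℂ)‖) := by
      refine setIntegral_mono_on ((hint d).const_mul _).norm
        (((hbase d).norm.const_mul _).const_mul _) measurableSet_Ioi fun t ht => ?_
      have h3 : ‖(x : ℂ) / (d : ℂ) ^ 2‖ = x / (d : ℝ) ^ 2 := by
        rw [norm_div, norm_pow, Complex.norm_real, Complex.norm_natCast, Real.norm_of_nonneg hx.le]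
      rw [norm_mul, h3]
      exact mul_le_mul_of_nonneg_left (hle d t ht) (by positivity)
    refine h2.trans (le_of_eq ?_)
    rw [integral_const_mul, integral_const_mul,
      integral_norm_one_div_sq_add_sq (by linarith) h1 (hc d), Real.div_rpow hx.le hd.le]
    have e : (d : ℝ) ^ (-1 - ν.re) = 1 / ((d : ℝ) ^ 2 * (d : ℝ) ^ (ν.re - 1)) := by
      rw [← Real.rpow_natCast (d : ℝ) 2, ← Real.rpow_add hd, one_div, ← Real.rpow_neg hd.le]
      congr 1
      push_cast
      ring
    rw [e]
    field_simp
  have key := hasSum_integral_of_summable_integral_norm (F := F)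
    (fun d => (hint d).const_mul _)
    (Summable.of_nonneg_of_le (fun d => integral_nonneg fun t => norm_nonneg _) hnorm
      ((summable_pnat_rpow (by linarith)).mul_left _))
  have hval : ∫ t in Ioi (0 : ℝ), ∑' d, F d t = ∫ t in Ioi (0 : ℝ), (t : ℂ) ^ (ν - 1) *
      ((π * (expKernel (x / t) + 1 / 2 - 1 / (2 * π * (x / t))) * sineKernel θ t : ℝ) : ℂ) := by
    refine setIntegral_congr_fun measurableSet_Ioi fun t ht => ?_
    have ht : 0 < t := ht
    have ht' : (t : ℂ) ≠ 0 := by exact_mod_cast ht.ne'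
    have h := ((Complex.hasSum_ofReal.mpr ((hasSum_expKernel (div_pos hx ht)).mul_right
      (sineKernel θ t))).mul_left ((t : ℂ) ^ (ν - 1))).tsum_eq
    rw [← h]
    refine tsum_congr fun d => ?_
    have hd : (0 : ℝ) < d := by positivity
    have e : x / t / ((x / t) ^ 2 + (d : ℝ) ^ 2) * sineKernel θ t
        = (x / (d : ℝ) ^ 2) * t * (1 / (t ^ 2 + (x / d) ^ 2) * sineKernel θ t) := by
      have : x ^ 2 + t ^ 2 * (d : ℝ) ^ 2 ≠ 0 := by positivity
      field_simp
      ring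
    simp only [hF]
    rw [e, Complex.ofReal_mul _ (1 / (t ^ 2 + (x / d) ^ 2) * sineKernel θ t),
      Complex.cpow_sub _ _ ht', Complex.cpow_one]
    push_cast
    field_simp
  rw [hval] at key
  refine key.congr_fun fun d => ?_
  simp only [hF]
  rw [integral_const_mul]

/-! ### Decay of the product kernel and its Mellin transform -/

theorem expKernel_le {u : ℝ} (hu : 0 < u) :
    expKernel u ≤ (∑' k : ℕ+, (k : ℝ) ^ (-2 : ℝ)) * u ^ (-2 : ℝ) := by
  rw [expKernel, ← tsum_mul_right]
  refine (summable_expKernel hu).tsum_le_tsum (fun k => ?_)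
    ((summable_pnat_rpow (by norm_num)).mul_right _)
  have hk : (0 : ℝ) < k := by positivity
  rw [← Real.mul_rpow hk.le hu.le, Real.rpow_neg (by positivity), Real.rpow_two, neg_mul,
    Real.exp_neg]
  refine inv_anti₀ (by positivity) ?_
  have h1 := Real.quadratic_le_exp_of_nonneg (x := 2 * π * k * u) (by positivity)
  have h2 : (0 : ℝ) < k * u := by positivity
  have h3 := Real.pi_gt_three
  have h4 : 2 * ((k : ℝ) * u) ≤ 2 * π * k * u := by nlinarith
  nlinarith [mul_pos h2 h2]

theorem continuousOn_productKernel (θ : ℝ) {x : ℝ} (hx : 0 < x) :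
    ContinuousOn (productKernel θ x) (Ioi 0) := by
  refine Complex.continuous_ofReal.comp_continuousOn ((continuousOn_sineKernel θ).mul ?_)
  refine continuousOn_expKernel.comp (continuousOn_const.div continuousOn_id fun t ht =>
    (ne_of_gt ht)) fun t ht => div_pos hx ht

/-- `E(x/t)` grows at most like `t²`, which the decay of the sine kernel absorbs. Near `0` the roles
are reversed. -/
theorem isBigO_productKernel_atTop (θ : ℝ) {x : ℝ} (hx : 0 < x) (b : ℝ) :
    productKernel θ x =O[atTop] fun t => t ^ b := by
  refine Complex.isBigO_ofReal_left.mpr ?_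
  have h : (fun t => expKernel (x / t)) =O[atTop] fun t => t ^ (2 : ℝ) := by
    refine IsBigO.of_bound ((∑' k : ℕ+, (k : ℝ) ^ (-2 : ℝ)) * x ^ (-2 : ℝ)) ?_
    filter_upwards [eventually_gt_atTop 0] with t ht
    rw [Real.norm_of_nonneg (expKernel_nonneg _), Real.norm_of_nonneg (by positivity)]
    refine (expKernel_le (div_pos hx ht)).trans (le_of_eq ?_)
    rw [Real.div_rpow hx.le ht.le, Real.rpow_neg ht.le 2]
    field_simp
  refine ((isBigO_sineKernel_atTop θ (b - 2)).mul h).congr' EventuallyEq.rfl ?_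
  filter_upwards [eventually_gt_atTop 0] with t ht
  rw [← Real.rpow_add ht, sub_add_cancel]

theorem isBigO_productKernel_nhdsGT_zero {θ : ℝ} (h0 : 0 < θ) (h1 : θ < 1) {x : ℝ} (hx : 0 < x)
    (b : ℝ) : productKernel θ x =O[𝓝[>] 0] fun t => t ^ b := by
  refine Complex.isBigO_ofReal_left.mpr ?_
  have hlim : Tendsto (fun t : ℝ => x / t) (𝓝[>] 0) atTop := by
    simpa only [div_eq_mul_inv] using tendsto_inv_nhdsGT_zero.const_mul_atTop hx
  have h : (fun t => expKernel (x / t)) =O[𝓝[>] 0] fun t => t ^ b := by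
    refine ((isBigO_expKernel_atTop (-b)).comp_tendsto hlim).trans ?_
    refine IsBigO.of_bound (x ^ (-b)) ?_
    filter_upwards [self_mem_nhdsWithin] with t ht
    have ht : 0 < t := ht
    rw [Function.comp_apply, Real.norm_of_nonneg (by positivity),
      Real.norm_of_nonneg (by positivity), Real.div_rpow hx.le ht.le, Real.rpow_neg ht.le]
    field_simp
    rfl
  refine ((isBigO_sineKernel_nhdsGT_zero h0 h1).mul h).congr' EventuallyEq.rfl ?_
  filter_upwards [self_mem_nhdsWithin] with t ht
  rw [neg_zero, Real.rpow_zero, one_mul]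

theorem mellinConvergent_productKernel {θ : ℝ} (h0 : 0 < θ) (h1 : θ < 1) {x : ℝ} (hx : 0 < x)
    (s : ℂ) : MellinConvergent (productKernel θ x) s :=
  mellinConvergent_of_isBigO_rpow (a := s.re + 1) (b := s.re - 1)
    ((continuousOn_productKernel θ hx).locallyIntegrableOn measurableSet_Ioi)
    (isBigO_productKernel_atTop θ hx _) (by linarith)
    (isBigO_productKernel_nhdsGT_zero h0 h1 hx _) (by linarith)

theorem differentiable_mellin_productKernel {θ : ℝ} (h0 : 0 < θ) (h1 : θ < 1) {x : ℝ}
    (hx : 0 < x) : Differentiable ℂ (mellin (productKernel θ x)) := fun s =>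
  mellin_differentiableAt_of_isBigO_rpow (a := s.re + 1) (b := s.re - 1)
    ((continuousOn_productKernel θ hx).locallyIntegrableOn measurableSet_Ioi)
    (isBigO_productKernel_atTop θ hx _) (by linarith)
    (isBigO_productKernel_nhdsGT_zero h0 h1 hx _) (by linarith)

theorem integral_expKernel_eq {θ x : ℝ} (hθ0 : 0 < θ) (hθ1 : θ < 1) (hx : 0 < x) {ν : ℂ}
    (h0 : 0 < ν.re) :
    ∫ t in Ioi (0 : ℝ), (t : ℂ) ^ (ν - 1) * ((π * (expKernel (x / t) + 1 / 2
        - 1 / (2 * π * (x / t))) * sineKernel θ t : ℝ) : ℂ)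
      = π * mellin (productKernel θ x) ν
        + π / 2 * mellin (fun t => (sineKernel θ t : ℂ)) ν
        - 1 / (2 * x) * mellin (fun t => (sineKernel θ t : ℂ)) (ν + 1) := by
  have hx' : (x : ℂ) ≠ 0 := by exact_mod_cast hx.ne'
  have hπ : (π : ℂ) ≠ 0 := by exact_mod_cast Real.pi_ne_zero
  have i1 := (mellinConvergent_productKernel hθ0 hθ1 hx ν).const_mul (π : ℂ)
  have i2 := (mellinConvergent_sineKernel hθ0 hθ1 h0).const_mul (π / 2 : ℂ)
  have i3 := (mellinConvergent_sineKernel hθ0 hθ1 (s := ν + 1) (by simp; linarith)).const_mul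
    (1 / (2 * x) : ℂ)
  have k1 := integral_sub (μ := volume.restrict (Ioi 0)) (i1.add i2) i3
  have k2 := integral_add (μ := volume.restrict (Ioi 0)) i1 i2
  rw [integral_const_mul] at k1 k2
  rw [integral_const_mul] at k2
  have e : ∫ t in Ioi (0 : ℝ), (t : ℂ) ^ (ν - 1) * ((π * (expKernel (x / t) + 1 / 2
        - 1 / (2 * π * (x / t))) * sineKernel θ t : ℝ) : ℂ)
      = ∫ t in Ioi (0 : ℝ), ((π * ((t : ℂ) ^ (ν - 1) • productKernel θ x t)
        + π / 2 * ((t : ℂ) ^ (ν - 1) • (sineKernel θ t : ℂ)))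
        - 1 / (2 * x) * ((t : ℂ) ^ (ν + 1 - 1) • (sineKernel θ t : ℂ))) := by
    refine setIntegral_congr_fun measurableSet_Ioi fun t ht => ?_
    have ht' : (t : ℂ) ≠ 0 := by exact_mod_cast (ne_of_gt ht)
    simp only [productKernel, smul_eq_mul]
    rw [add_sub_cancel_right, Complex.cpow_sub _ _ ht', Complex.cpow_one]
    push_cast
    field_simp
  simp only [Pi.add_apply] at k1
  simp only [mellin]
  rw [e]
  refine k1.trans ?_
  congr 1

/-- Integration yields the numerator `(dy)²((dy)^{ν-1} - x^{ν-1})` rather than `(dy)^{ν+1} -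
x^{ν+1}`. The two differ by a multiple of `(dy)² - x²`, and the resulting separated term sums to the
`ζ(ν+1)` term. -/
theorem div_sq_mul_eq_remainder {x y : ℝ} (hx : 0 < x) (hy : 0 < y) (d : ℕ+)
    (h : (d : ℝ) * y ≠ x) (ν : ℂ) :
    (x : ℂ) / (d : ℂ) ^ 2 * (y * (((x / d : ℝ) : ℂ) ^ (ν - 1) - (y : ℂ) ^ (ν - 1))
        / ((y : ℂ) ^ 2 - ((x / d : ℝ) : ℂ) ^ 2))
      = -(x * ((d : ℂ) ^ (-ν - 1) * remainderPart ν 0 x d y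
        - (x : ℂ) ^ (ν - 1) * (1 / (d : ℂ) ^ (ν + 1)) * (1 / (y : ℂ)))) := by
  have hd : (0 : ℝ) < d := by positivity
  have hd' : (d : ℂ) ≠ 0 := by exact_mod_cast hd.ne'
  have hy' : (y : ℂ) ≠ 0 := by exact_mod_cast hy.ne'
  have hx' : (x : ℂ) ≠ 0 := by exact_mod_cast hx.ne'
  have hX : ((d * y : ℝ) : ℂ) ≠ 0 := by exact_mod_cast (by positivity : (d : ℝ) * y ≠ 0)
  have hden : (d : ℂ) ^ 2 * (y : ℂ) ^ 2 - (x : ℂ) ^ 2 ≠ 0 := by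
    rw [← mul_pow, sub_ne_zero]
    intro hh
    have : ((d : ℝ) * y) ^ 2 = x ^ 2 := by exact_mod_cast hh
    exact h ((pow_left_inj₀ (by positivity) hx.le two_ne_zero).mp this)
  have e1 : ((x / d : ℝ) : ℂ) ^ (ν - 1) = (x : ℂ) ^ (ν - 1) / (d : ℂ) ^ (ν - 1) := by
    rw [Complex.ofReal_div, Complex.div_cpow_ofReal_nonneg hx.le hd.le]
    rfl
  have e2 : (d : ℂ) ^ (-ν - 1) = 1 / ((d : ℂ) ^ (ν - 1) * (d : ℂ) ^ 2) := by
    rw [show -ν - 1 = -(ν - 1 + (2 : ℕ)) by push_cast; ring, Complex.cpow_neg,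
      Complex.cpow_add _ _ hd', Complex.cpow_natCast, one_div]
  have e3 : (d : ℂ) ^ (ν + 1) = (d : ℂ) ^ (ν - 1) * (d : ℂ) ^ 2 := by
    rw [show ν + 1 = ν - 1 + (2 : ℕ) by push_cast; ring, Complex.cpow_add _ _ hd',
      Complex.cpow_natCast]
  have e4 : ((d * y : ℝ) : ℂ) ^ (ν + 1)
      = (d : ℂ) ^ (ν - 1) * (y : ℂ) ^ (ν - 1) * ((d : ℂ) ^ 2 * (y : ℂ) ^ 2) := by
    rw [show ν + 1 = ν - 1 + (2 : ℕ) by push_cast; ring, Complex.cpow_add _ _ hX,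
      Complex.cpow_natCast, Complex.ofReal_mul, Complex.mul_cpow_ofReal_nonneg hd.le hy.le, mul_pow]
    rfl
  have e5 : (x : ℂ) ^ (ν + 1) = (x : ℂ) ^ (ν - 1) * (x : ℂ) ^ 2 := by
    rw [show ν + 1 = ν - 1 + (2 : ℕ) by push_cast; ring, Complex.cpow_add _ _ hx',
      Complex.cpow_natCast]
  have hD : (d : ℂ) ^ (ν - 1) ≠ 0 := by rw [Ne, Complex.cpow_eq_zero_iff]; tauto
  rw [remainderPart, Nat.cast_zero, mul_zero, sub_zero, e1, e2, e3, e4, e5]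
  generalize (d : ℂ) ^ (ν - 1) = D at *
  generalize (y : ℂ) ^ (ν - 1) = Y at *
  generalize (x : ℂ) ^ (ν - 1) = Z at *
  have hden' : (y : ℂ) ^ 2 - (((x / d : ℝ)) : ℂ) ^ 2
      = ((d : ℂ) ^ 2 * (y : ℂ) ^ 2 - (x : ℂ) ^ 2) / (d : ℂ) ^ 2 := by
    push_cast
    field_simp
  rw [hden']
  push_cast
  obtain ⟨W, hW⟩ : ∃ W : ℂ, W = (d : ℂ) ^ 2 * (y : ℂ) ^ 2 - (x : ℂ) ^ 2 := ⟨_, rfl⟩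
  rw [← hW] at hden ⊢
  field_simp
  linear_combination (-Z) * hW

theorem cos_pi_mul_div_two_ne_zero {ν : ℂ} (hν : ∀ k : ℤ, ν ≠ k) :
    Complex.cos (π * ν / 2) ≠ 0 := by
  intro h
  have h2 := sin_pi_mul_ne_zero hν
  rw [show (π : ℂ) * ν = 2 * (π * ν / 2) by ring, Complex.sin_two_mul, h, mul_zero] at h2
  exact h2 rfl

theorem sin_pi_mul_div_two_ne_zero {ν : ℂ} (hν : ∀ k : ℤ, ν ≠ k) :
    Complex.sin (π * ν / 2) ≠ 0 := by
  intro h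
  have h2 := sin_pi_mul_ne_zero hν
  rw [show (π : ℂ) * ν = 2 * (π * ν / 2) by ring, Complex.sin_two_mul, h, mul_zero, zero_mul] at h2
  exact h2 rfl

theorem ne_intCast_of_re_mem_Ioo {ν : ℂ} (h0 : 0 < ν.re) (h1 : ν.re < 1) (k : ℤ) : ν ≠ k := by
  rintro rfl
  rw [Complex.intCast_re] at h0 h1
  have h2 : (0 : ℤ) < k := by exact_mod_cast h0
  have h3 : k < (1 : ℤ) := by exact_mod_cast h1
  omega

/-- Evaluates the integral of `S` against `E + 1/2 - 1/(2πu)`, `u = x/t`, in two ways: by partial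
fractions in `d` and `m`, and as three Mellin transforms. -/
theorem mellin_productKernel_eq_sineRHS_zero {θ x : ℝ} (hθ0 : 0 < θ) (hθ1 : θ < 1) (hx : 0 < x)
    (hne : ∀ (d : ℕ+) (m : ℕ), (d : ℝ) * (m + θ) ≠ x)
    (hne' : ∀ (d : ℕ+) (m : ℕ), (d : ℝ) * (m + (1 - θ)) ≠ x) {ν : ℂ} (h0 : 0 < ν.re)
    (h1 : ν.re < 1) : 4 * π * mellin (productKernel θ x) ν = sineRHS ν 0 θ x := by
  have hy (m : ℕ) : 0 < (m : ℝ) + θ := by positivity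
  have hz (m : ℕ) : 0 < (m : ℝ) + (1 - θ) :=
    add_pos_of_nonneg_of_pos m.cast_nonneg (sub_pos.mpr hθ1)
  have hν := ne_intCast_of_re_mem_Ioo h0 h1
  have hcos := cos_pi_mul_div_two_ne_zero hν
  have hsin := sin_pi_mul_div_two_ne_zero hν
  have hx' : (x : ℂ) ≠ 0 := by exact_mod_cast hx.ne'
  have hπ : (π : ℂ) ≠ 0 := by exact_mod_cast Real.pi_ne_zero
  have hs := summable_remainderTerm hθ0 hθ1 hx hne hne' 0 (ν := ν) (by linarith) (by simpa using h1)
  set κ : ℂ := π / (2 * Complex.cos (π * ν / 2)) with hκ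
  have hd (d : ℕ+) : (x : ℂ) / (d : ℂ) ^ 2 * ∫ t in Ioi (0 : ℝ), (t : ℂ) ^ ν *
        ((1 / (t ^ 2 + (x / d) ^ 2) * sineKernel θ t : ℝ) : ℂ)
      = -(κ * x / (2 * π)) * (∑' m : ℕ, remainderTerm ν 0 θ x d m
        - (x : ℂ) ^ (ν - 1) * (1 / (d : ℂ) ^ (ν + 1)) * hurwitzDiff θ 1) := by
    have hdpos : (0 : ℝ) < d := by positivity
    have a1 := (hasSum_integral_sineKernel_div hθ0 hθ1 (by linarith) h1
      (div_pos hx hdpos) (fun m h => hne d m (by rw [h]; field_simp))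
      (fun m h => hne' d m (by rw [h]; field_simp))).mul_left ((x : ℂ) / (d : ℂ) ^ 2)
    have a2 := (((hs.prod_factor d).hasSum.sub ((hasSum_hurwitzDiff_one hθ0 hθ1).mul_left
      ((x : ℂ) ^ (ν - 1) * (1 / (d : ℂ) ^ (ν + 1))))).mul_left (-(κ * x)))
    have a3 := a1.unique (a2.congr_fun fun m => ?_)
    · linear_combination (1 / (2 * π : ℂ)) * a3 - ((x : ℂ) / (d : ℂ) ^ 2 *
        (∫ t in Ioi (0 : ℝ), (t : ℂ) ^ ν *
        ((1 / (t ^ 2 + (x / d) ^ 2) * sineKernel θ t : ℝ) : ℂ))) * (one_div_mul_cancel hπ)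
    · rw [remainderTerm_eq, mul_left_comm, mul_sub ((x : ℂ) / (d : ℂ) ^ 2),
        div_sq_mul_eq_remainder hx (hy m) d (hne d m),
        div_sq_mul_eq_remainder hx (hz m) d (hne' d m)]
      ring
  have key := hasSum_integral_productKernel hθ0 hθ1 hx h0 h1
  simp only [hd] at key
  have hζ := hasSum_pnat_zeta (s := ν + 1) (by simpa using h0)
  have key2 := ((hs.prod.hasSum.sub ((hζ.mul_left ((x : ℂ) ^ (ν - 1))).mul_right
    (hurwitzDiff θ 1))).mul_left (-(κ * x / (2 * π))))
  have heq := key.unique key2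
  rw [integral_expKernel_eq hθ0 hθ1 hx h0] at heq
  have m1 := hurwitzDiff_one_sub hθ0 hθ1 h0
  have m2 := hurwitzDiff_one_sub hθ0 hθ1 (s := ν + 1) (by simp; linarith)
  rw [show 1 - (ν + 1) = -ν by ring, show (π : ℂ) * (ν + 1) / 2 = π * ν / 2 + π / 2 by ring,
    Complex.sin_add_pi_div_two] at m2
  rw [sineRHS, m1, m2, show (x : ℂ) ^ ν = (x : ℂ) ^ (ν - 1) * x by
    rw [Complex.cpow_sub _ _ hx', Complex.cpow_one, div_mul_cancel₀ _ hx']]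
  rw [hκ] at heq
  simp only [Finset.Icc_eq_empty_of_lt zero_lt_one, Finset.sum_empty, mul_zero, zero_add, pow_one,
    sub_zero]
  field_simp at heq ⊢
  linear_combination 2 * heq

/-! ### The series of Bessel functions as an integral -/

theorem hasSum_divisorsAntidiagonal {f : ℕ → ℕ → ℂ} {s : ℂ}
    (h : HasSum (fun p : ℕ+ × ℕ+ => f p.1 p.2) s) :
    HasSum (fun n : ℕ+ => ∑ p ∈ (n : ℕ).divisorsAntidiagonal, f p.1 p.2) s := by
  rw [← sigmaAntidiagonalEquivProd.hasSum_iff] at h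
  refine h.sigma fun n => ?_
  have h2 := hasSum_fintype fun p : (n : ℕ).divisorsAntidiagonal => f p.1.1 p.1.2
  rw [Finset.sum_coe_sort (n : ℕ).divisorsAntidiagonal fun p => f p.1 p.2] at h2
  exact h2

/-- The summand `t^(ν-1) sin (2πdθ) exp (-2πdt - 2πkx/t)`. -/
def besselIntegrand (ν : ℂ) (θ x : ℝ) (d k : ℕ+) (t : ℝ) : ℂ :=
  (t : ℂ) ^ (ν - 1) * ((Real.sin (2 * π * d * θ) * Real.exp (-(2 * π * d) * t)
    * Real.exp (-(2 * π * k) * (x / t)) : ℝ) : ℂ)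

theorem besselIntegrand_eq (ν : ℂ) (θ x : ℝ) (d k : ℕ+) (t : ℝ) :
    besselIntegrand ν θ x d k t = ((Real.sin (2 * π * d * θ) : ℝ) : ℂ) *
      ((t : ℂ) ^ (ν - 1) • ((Real.exp (-(2 * π * d) * t - (2 * π * k * x) / t) : ℝ) : ℂ)) := by
  rw [besselIntegrand, smul_eq_mul, show -(2 * π * d) * t - (2 * π * k * x) / t
    = -(2 * π * d) * t + -(2 * π * k) * (x / t) by ring, Real.exp_add]
  push_cast
  ring

theorem integrableOn_besselIntegrand (ν : ℂ) (θ : ℝ) {x : ℝ} (hx : 0 < x) (d k : ℕ+) :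
    IntegrableOn (besselIntegrand ν θ x d k) (Ioi 0) := by
  rw [funext (besselIntegrand_eq ν θ x d k)]
  exact (mellinConvergent_exp_neg_sub_div ν (c := 2 * π * d) (w := 2 * π * k * x)
    (by positivity) (by positivity)).const_mul _

/-- The bound `e^{-v} ≤ 2/v²` with `v = 2πkx/t` buys `k^{-2}` at the price of `t²`; the Gamma
integral then gives `d^{-Re ν - 2}`. -/
theorem integral_norm_besselIntegrand_le {ν : ℂ} (hν : 0 ≤ ν.re) (θ : ℝ) {x : ℝ} (hx : 0 < x)
    (d k : ℕ+) :
    ∫ t in Ioi (0 : ℝ), ‖besselIntegrand ν θ x d k t‖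
      ≤ (2 * (2 * π * x) ^ (-2 : ℝ) * ((2 * π) ^ (-(ν.re + 2)) * Real.Gamma (ν.re + 2))) *
        ((d : ℝ) ^ (-(ν.re + 2)) * (k : ℝ) ^ (-2 : ℝ)) := by
  have hd : (0 : ℝ) < d := by positivity
  have hk : (0 : ℝ) < k := by positivity
  have hI := Real.integral_rpow_mul_exp_neg_mul_Ioi (a := ν.re + 2) (r := 2 * π * d)
    (by linarith) (by positivity)
  have hint : IntegrableOn (fun t : ℝ => t ^ (ν.re + 2 - 1) * Real.exp (-(2 * π * d * t)))
      (Ioi 0) := by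
    -- A non-integrable function would have integral `0` by convention, but the Gamma value is
    -- positive.
    by_contra h
    rw [IntegrableOn] at h
    rw [integral_undef h] at hI
    have := Real.Gamma_pos_of_pos (show 0 < ν.re + 2 by linarith)
    have : 0 < (1 / (2 * π * d)) ^ (ν.re + 2) * Real.Gamma (ν.re + 2) := by positivity
    linarith
  have hle : ∀ t ∈ Ioi (0 : ℝ), ‖besselIntegrand ν θ x d k t‖ ≤
      (2 * (2 * π * k * x) ^ (-2 : ℝ)) * (t ^ (ν.re + 2 - 1) * Real.exp (-(2 * π * d * t))) := by
    intro t ht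
    have ht : 0 < t := ht
    have h1 : Real.exp (-(2 * π * k) * (x / t)) ≤ 2 * (2 * π * k * x) ^ (-2 : ℝ) * t ^ (2 : ℝ) := by
      have h2 := Real.quadratic_le_exp_of_nonneg (x := 2 * π * k * (x / t)) (by positivity)
      rw [neg_mul, Real.exp_neg]
      have h3 : 0 < 2 * π * k * (x / t) := by positivity
      have h4 : 2 * (2 * π * k * x) ^ (-2 : ℝ) * t ^ (2 : ℝ)
          = ((2 * π * k * (x / t)) ^ 2 / 2)⁻¹ := by
        rw [Real.rpow_neg (by positivity), Real.rpow_two, Real.rpow_two]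
        field_simp
      rw [h4]
      exact inv_anti₀ (by positivity) (by nlinarith)
    have h5 : |Real.sin (2 * π * d * θ)| ≤ 1 := Real.abs_sin_le_one _
    rw [besselIntegrand, norm_mul, Complex.norm_cpow_eq_rpow_re_of_pos ht, Complex.norm_real,
      norm_mul, norm_mul, Real.norm_eq_abs, Real.norm_eq_abs, Real.norm_eq_abs, Real.abs_exp,
      Real.abs_exp, Complex.sub_re, Complex.one_re]
    calc t ^ (ν.re - 1) * (|Real.sin (2 * π * d * θ)| * Real.exp (-(2 * π * d) * t)
          * Real.exp (-(2 * π * k) * (x / t)))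
        ≤ t ^ (ν.re - 1) * (1 * Real.exp (-(2 * π * d) * t)
          * (2 * (2 * π * k * x) ^ (-2 : ℝ) * t ^ (2 : ℝ))) := by gcongr
      _ = _ := by
        rw [show ν.re + 2 - 1 = (ν.re - 1) + 2 by ring, Real.rpow_add ht, neg_mul]
        ring
  refine (setIntegral_mono_on (integrableOn_besselIntegrand ν θ hx d k).norm
    (hint.const_mul _) measurableSet_Ioi hle).trans (le_of_eq ?_)
  rw [integral_const_mul, hI, one_div, Real.inv_rpow (by positivity),
    ← Real.rpow_neg (by positivity), Real.mul_rpow (by positivity) hd.le,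
    show 2 * π * k * x = (2 * π * x) * k by ring, Real.mul_rpow (by positivity) hk.le]
  ring

theorem hasSum_integral_besselIntegrand {ν : ℂ} (hν : 0 ≤ ν.re) (θ : ℝ) {x : ℝ} (hx : 0 < x) :
    HasSum (fun p : ℕ+ × ℕ+ => ∫ t in Ioi (0 : ℝ), besselIntegrand ν θ x p.1 p.2 t)
      (mellin (productKernel θ x) ν) := by
  have hs : Summable fun p : ℕ+ × ℕ+ => (p.1 : ℝ) ^ (-(ν.re + 2)) * (p.2 : ℝ) ^ (-2 : ℝ) := by
    refine Summable.mul_of_nonneg (f := fun d : ℕ+ => (d : ℝ) ^ (-(ν.re + 2)))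
      (g := fun k : ℕ+ => (k : ℝ) ^ (-2 : ℝ)) (summable_pnat_rpow (by linarith))
      (summable_pnat_rpow (by norm_num)) ?_ ?_
    · intro d
      simp only [Pi.zero_apply]
      positivity
    · intro d
      simp only [Pi.zero_apply]
      positivity
  have key := hasSum_integral_of_summable_integral_norm (μ := volume.restrict (Ioi (0 : ℝ)))
    (F := fun p : ℕ+ × ℕ+ => besselIntegrand ν θ x p.1 p.2)
    (fun p => integrableOn_besselIntegrand ν θ hx p.1 p.2)
    (Summable.of_nonneg_of_le (fun p => integral_nonneg fun t => norm_nonneg _)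
      (fun p => integral_norm_besselIntegrand_le hν θ hx p.1 p.2) (hs.mul_left _))
  refine key.trans (le_of_eq ?_)
  congr 1
  refine setIntegral_congr_fun measurableSet_Ioi fun t ht => ?_
  have ht : 0 < t := ht
  have h1 := Complex.hasSum_ofReal.mpr (summable_sineKernel θ ht).hasSum
  have h2 := Complex.hasSum_ofReal.mpr (summable_expKernel (div_pos hx ht)).hasSum
  have h3 := ((hasSum_mul_of_hasSum h1 h2).mul_left ((t : ℂ) ^ (ν - 1))).tsum_eq
  simp only [besselIntegrand, productKernel, sineKernel, expKernel, smul_eq_mul]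
  push_cast at h3 ⊢
  exact h3

/-- Scaling `t` by `2πd` brings the exponent to `-t - w/t` with `w = 4π²dkx`. This is `z²/4` for `z
= 4π√(dkx)`, and the scaling produces `d^{-ν}`. -/
theorem integral_besselIntegrand {ν : ℂ} (h0 : 0 ≤ ν.re) (hν : ∀ k : ℤ, ν ≠ k) (θ : ℝ) {x : ℝ}
    (hx : 0 < x) (d k : ℕ+) :
    ∫ t in Ioi (0 : ℝ), besselIntegrand ν θ x d k t = 2 * (x : ℂ) ^ (ν / 2) *
      (((d * k : ℕ) : ℂ) ^ (ν / 2) *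
        besselK ν ((4 * π * Real.sqrt ((d * k : ℕ) * x) : ℝ) : ℂ) *
        ((d : ℂ) ^ (-ν) * ((Real.sin (2 * π * d * θ) : ℝ) : ℂ))) := by
  have hd : (0 : ℝ) < d := by positivity
  have hk : (0 : ℝ) < k := by positivity
  have hn : (0 : ℝ) < ((d * k : ℕ) : ℝ) := by push_cast; positivity
  have h2πd : 0 < 2 * π * d := by positivity
  have hnx : 0 < ((d * k : ℕ) : ℝ) * x := by positivity
  simp only [besselIntegrand_eq]
  rw [integral_const_mul]
  have h1 := mellin_comp_mul_left
    (fun t => ((Real.exp (-t - (4 * π ^ 2 * ((d * k : ℕ) * x)) / t) : ℝ) : ℂ)) ν h2πd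
  have h2 : (fun t => ((Real.exp (-(2 * π * d * t) -
      (4 * π ^ 2 * ((d * k : ℕ) * x)) / (2 * π * d * t)) : ℝ) : ℂ))
      = fun t : ℝ => ((Real.exp (-(2 * π * d) * t - (2 * π * k * x) / t) : ℝ) : ℂ) := by
    funext t
    congr 3
    · ring
    · rcases eq_or_ne t 0 with rfl | ht
      · simp
      · push_cast
        field_simp
        ring
  rw [h2] at h1
  have h3 := macdonaldIntegral_eq h0 hν (w := 4 * π ^ 2 * ((d * k : ℕ) * x)) (by positivity)
  rw [macdonaldIntegral] at h3
  rw [h3] at h1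
  rw [mellin] at h1
  rw [h1]
  have hz : 0 < 4 * π * Real.sqrt ((d * k : ℕ) * x) := by positivity
  have h4 := besselK_eq ν hz
  have h5 : (4 * π * Real.sqrt ((d * k : ℕ) * x)) ^ 2 / 4 = 4 * π ^ 2 * ((d * k : ℕ) * x) := by
    rw [mul_pow, Real.sq_sqrt hnx.le]
    ring
  have h6 : 4 * π * Real.sqrt ((d * k : ℕ) * x) / 2 = 2 * π * Real.sqrt ((d * k : ℕ) * x) := by
    ring
  have hr : 0 < Real.sqrt ((d * k : ℕ) * x) := Real.sqrt_pos.mpr hnx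
  have h7 : ((Real.sqrt ((d * k : ℕ) * x) : ℝ) : ℂ) ^ ν
      = ((d * k : ℕ) : ℂ) ^ (ν / 2) * (x : ℂ) ^ (ν / 2) := by
    have h := Complex.mul_cpow_ofReal_nonneg hn.le hx.le (ν / 2)
    rw [Complex.ofReal_natCast] at h
    rw [← h, ← Complex.ofReal_natCast, ← Complex.ofReal_mul]
    conv_rhs => rw [← Real.mul_self_sqrt hnx.le]
    rw [Complex.ofReal_mul, Complex.mul_cpow_ofReal_nonneg hr.le hr.le,
      ← Complex.cpow_add _ _ (by exact_mod_cast hr.ne'), add_halves]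
  rw [h5, h6] at h4
  have hA : ((2 * π : ℝ) : ℂ) ^ ν ≠ 0 := by
    rw [Ne, Complex.cpow_eq_zero_iff]
    rintro ⟨h, -⟩
    have : (2 * π : ℝ) ≠ 0 := by positivity
    exact this (by exact_mod_cast h)
  have hB : ((Real.sqrt ((d * k : ℕ) * x) : ℝ) : ℂ) ^ ν ≠ 0 := by
    rw [Ne, Complex.cpow_eq_zero_iff]
    rintro ⟨h, -⟩
    exact hr.ne' (by exact_mod_cast h)
  rw [h4]
  rw [Complex.ofReal_mul (2 * π) (Real.sqrt _),
    Complex.mul_cpow_ofReal_nonneg (by positivity) hr.le, Complex.ofReal_mul (2 * π) (d : ℝ),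
    Complex.mul_cpow_ofReal_nonneg (by positivity) hd.le, Complex.cpow_neg _ ν,
    Complex.cpow_neg (Complex.ofReal (Real.sqrt _)) ν]
  rw [h7] at hB ⊢
  have hB1 := left_ne_zero_of_mul hB
  have hB2 := right_ne_zero_of_mul hB
  rw [smul_eq_mul, Complex.ofReal_natCast]
  field_simp

theorem hasSum_sineSeriesTerm {ν : ℂ} (h0 : 0 ≤ ν.re) (hν : ∀ k : ℤ, ν ≠ k) (θ : ℝ) {x : ℝ}
    (hx : 0 < x) :
    HasSum (fun n : ℕ+ => 2 * (x : ℂ) ^ (ν / 2) * sineSeriesTerm ν θ x n)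
      (mellin (productKernel θ x) ν) := by
  have h := hasSum_integral_besselIntegrand h0 θ hx
  simp only [integral_besselIntegrand h0 hν θ hx] at h
  have h2 := hasSum_divisorsAntidiagonal (f := fun d k : ℕ => 2 * (x : ℂ) ^ (ν / 2) *
      (((d * k : ℕ) : ℂ) ^ (ν / 2) *
        besselK ν ((4 * π * Real.sqrt ((d * k : ℕ) * x) : ℝ) : ℂ) *
        ((d : ℂ) ^ (-ν) * ((Real.sin (2 * π * d * θ) : ℝ) : ℂ)))) h
  refine h2.congr_fun fun n => ?_
  rw [sineSeriesTerm, Finset.mul_sum, Finset.mul_sum,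
    ← Nat.sum_divisorsAntidiagonal (n := n) fun d _ => 2 * (x : ℂ) ^ (ν / 2) *
      ((n : ℂ) ^ (ν / 2) * besselK ν ((4 * π * Real.sqrt (n * x) : ℝ) : ℂ) *
        ((d : ℂ) ^ (-ν) * ((Real.sin (2 * π * d * θ) : ℝ) : ℂ)))]
  refine Finset.sum_congr rfl fun p hp => ?_
  rw [(Nat.mem_divisorsAntidiagonal.mp hp).1]

theorem summable_sineSeriesTerm {ν : ℂ} (h0 : 0 ≤ ν.re) (hν : ∀ k : ℤ, ν ≠ k) (θ : ℝ) {x : ℝ}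
    (hx : 0 < x) : Summable (sineSeriesTerm ν θ x) := by
  have hB : 2 * (x : ℂ) ^ (ν / 2) ≠ 0 := by
    refine mul_ne_zero two_ne_zero ?_
    rw [Ne, Complex.cpow_eq_zero_iff]
    rintro ⟨h, -⟩
    exact hx.ne' (by exact_mod_cast h)
  exact (summable_mul_left_iff hB).mp (hasSum_sineSeriesTerm h0 hν θ hx).summable

theorem tsum_sineSeriesTerm {ν : ℂ} (h0 : 0 ≤ ν.re) (hν : ∀ k : ℤ, ν ≠ k) (θ : ℝ) {x : ℝ}
    (hx : 0 < x) : 8 * (π : ℂ) * (x : ℂ) ^ (ν / 2) * ∑' n : ℕ+, sineSeriesTerm ν θ x n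
      = 4 * π * mellin (productKernel θ x) ν := by
  rw [← (hasSum_sineSeriesTerm h0 hν θ hx).tsum_eq, tsum_mul_left]
  ring

/-! ### Analytic continuation in the order -/

theorem differentiable_remainderPart (N : ℕ) {x y : ℝ} (hx : 0 < x) (hy : 0 < y) (d : ℕ+) :
    Differentiable ℂ fun ν => (d : ℂ) ^ (-ν - 1) * remainderPart ν N x d y := by
  have hd : (d : ℂ) ≠ 0 := by exact_mod_cast d.ne_zero
  have hdy : ((d * y : ℝ) : ℂ) ≠ 0 := by
    have : (d * y : ℝ) ≠ 0 := by positivity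
    exact_mod_cast this
  have hx' : (x : ℂ) ≠ 0 := by exact_mod_cast hx.ne'
  have h (c : ℂ) (hc : c ≠ 0) (g : ℂ → ℂ) (hg : Differentiable ℂ g) :
      Differentiable ℂ fun ν => c ^ g ν := fun ν => (hg ν).const_cpow (Or.inl hc)
  unfold remainderPart
  exact (h _ hd _ (by fun_prop)).mul
    (((h _ hdy _ (by fun_prop)).sub (h _ hx' _ (by fun_prop))).div_const _)

theorem differentiableOn_tsum_remainderTerm {θ x : ℝ} (h0 : 0 < θ) (h1 : θ < 1) (hx : 0 < x)
    (hne : ∀ (d : ℕ+) (m : ℕ), (d : ℝ) * (m + θ) ≠ x)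
    (hne' : ∀ (d : ℕ+) (m : ℕ), (d : ℝ) * (m + (1 - θ)) ≠ x) (N : ℕ) {α b : ℝ} (hα : -1 ≤ α)
    (hαb : α ≤ b) (hb : b < 2 * N + 1) {U : Set ℂ} (hU : IsOpen U)
    (hUs : ∀ ν ∈ U, α ≤ ν.re ∧ ν.re ≤ b) :
    DifferentiableOn ℂ (fun ν => ∑' d : ℕ+, ∑' m : ℕ, remainderTerm ν N θ x d m) U := by
  have h1' : 0 < 1 - θ := sub_pos.mpr h1
  obtain ⟨u, hu, hule⟩ := exists_remainder_bound h0 hx hne N hα hαb hb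
  obtain ⟨v, hv, hvle⟩ := exists_remainder_bound h1' hx hne' N hα hαb hb
  have key : DifferentiableOn ℂ (fun ν => ∑' p : ℕ+ × ℕ, remainderTerm ν N θ x p.1 p.2) U := by
    refine Complex.differentiableOn_tsum_of_summable_norm (hu.add hv) (fun p => ?_) hU fun p ν hν => ?_
    · simp only [remainderTerm_eq]
      exact ((differentiable_remainderPart N hx (by positivity) p.1).sub
        (differentiable_remainderPart N hx (by positivity) p.1)).differentiableOn
    · rw [remainderTerm_eq]
      exact (norm_sub_le _ _).trans (add_le_add (hule ν (hUs ν hν).1 (hUs ν hν).2 p)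
        (hvle ν (hUs ν hν).1 (hUs ν hν).2 p))
  refine key.congr fun ν hν => ?_
  exact (summable_remainderTerm h0 h1 hx hne hne' N (hα.trans (hUs ν hν).1)
    ((hUs ν hν).2.trans_lt hb)).tsum_prod.symm

/-- The possible singularities come from `ζ(ν+1)` at `0` and from the zeros of `cos(πν/2)` and
`sin(πν/2)`, all at integers. -/
theorem differentiableAt_sineRHS {θ x : ℝ} (h0 : 0 < θ) (h1 : θ < 1) (hx : 0 < x)
    (hne : ∀ (d : ℕ+) (m : ℕ), (d : ℝ) * (m + θ) ≠ x)
    (hne' : ∀ (d : ℕ+) (m : ℕ), (d : ℝ) * (m + (1 - θ)) ≠ x) (N : ℕ) {ν : ℂ} (hν : -1 < ν.re)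
    (hN : ν.re < 2 * N + 1) (hint : ∀ k : ℤ, ν ≠ k) :
    DifferentiableAt ℂ (fun ν => sineRHS ν N θ x) ν := by
  have hx' : (x : ℂ) ≠ 0 := by exact_mod_cast hx.ne'
  have hcos := cos_pi_mul_div_two_ne_zero hint
  have hsin := sin_pi_mul_div_two_ne_zero hint
  obtain ⟨b, hb1, hb2⟩ := exists_between hN
  have hS : DifferentiableAt ℂ
      (fun ν => ∑' d : ℕ+, ∑' m : ℕ, remainderTerm ν N θ x d m) ν := by
    have hU : IsOpen (Complex.re ⁻¹' Ioo (-1) b) := isOpen_Ioo.preimage Complex.continuous_re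
    exact (differentiableOn_tsum_remainderTerm h0 h1 hx hne hne' N le_rfl (hν.trans hb1).le hb2 hU
      fun ν hν => ⟨hν.1.le, hν.2.le⟩).differentiableAt (hU.mem_nhds ⟨hν, hb1⟩)
  have hH (g : ℂ → ℂ) (hg : DifferentiableAt ℂ g ν) :
      DifferentiableAt ℂ (fun ν => hurwitzDiff θ (g ν)) ν :=
    (differentiable_hurwitzDiff θ).differentiableAt.comp ν hg
  have hζ : DifferentiableAt ℂ (fun ν => riemannZeta (ν + 1)) ν := by
    refine (differentiableAt_riemannZeta (s := ν + 1) ?_).comp ν (by fun_prop)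
    intro h
    exact hint 0 (by simpa using h)
  have hc : DifferentiableAt ℂ (fun ν : ℂ => 1 / Complex.cos (π * ν / 2)) ν :=
    (differentiableAt_const _).div (by fun_prop) hcos
  have hxν : DifferentiableAt ℂ (fun ν : ℂ => (x : ℂ) ^ ν) ν :=
    differentiableAt_id.const_cpow (Or.inl hx')
  have e1 : DifferentiableAt ℂ (fun ν : ℂ => 1 / Complex.cos (π * ν / 2) * riemannZeta (ν + 1)
      * hurwitzDiff θ 1 * (x : ℂ) ^ ν) ν := ((hc.mul hζ).mul_const _).mul hxν
  have e2 : DifferentiableAt ℂ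
      (fun ν : ℂ => π / (2 * Complex.sin (π * ν / 2)) * hurwitzDiff θ (1 - ν)) ν :=
    DifferentiableAt.mul (DifferentiableAt.div (by fun_prop) (by fun_prop)
      (mul_ne_zero two_ne_zero hsin)) (hH _ (by fun_prop))
  have e3 : DifferentiableAt ℂ
      (fun ν : ℂ => 1 / (2 * x * Complex.cos (π * ν / 2)) * hurwitzDiff θ (-ν)) ν :=
    DifferentiableAt.mul (DifferentiableAt.div (by fun_prop) (by fun_prop)
      (mul_ne_zero (mul_ne_zero two_ne_zero hx') hcos)) (hH _ (by fun_prop))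
  have e4 : DifferentiableAt ℂ (fun ν : ℂ => ∑ j ∈ Finset.Icc 1 N,
      riemannZeta (2 * j) * hurwitzDiff θ (2 * j - ν) * (x : ℂ) ^ (2 * j - 1)) ν :=
    DifferentiableAt.fun_sum fun j _ => ((hH _ (by fun_prop)).const_mul _).mul_const _
  exact (((e1.sub e2).add e3).sub (hc.mul e4)).sub ((hc.mul_const _).mul hS)

theorem mellin_productKernel_eq_sineRHS_of_re_mem_Ioo {θ x : ℝ} (h0 : 0 < θ) (h1 : θ < 1)
    (hx : 0 < x) (hne : ∀ (d : ℕ+) (m : ℕ), (d : ℝ) * (m + θ) ≠ x)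
    (hne' : ∀ (d : ℕ+) (m : ℕ), (d : ℝ) * (m + (1 - θ)) ≠ x) (N : ℕ) {ν : ℂ} (hν : 0 < ν.re)
    (hν' : ν.re < 1) : 4 * π * mellin (productKernel θ x) ν = sineRHS ν N θ x := by
  rw [sineRHS_eq_zero_index h0 h1 hx hne hne' N (by linarith) hν',
    mellin_productKernel_eq_sineRHS_zero h0 h1 hx hne hne' hν hν']

theorem ne_intCast_of_im_ne_zero {ν : ℂ} (h : ν.im ≠ 0) (k : ℤ) : ν ≠ k := by
  rintro rfl
  simp at h

theorem mellin_productKernel_eq_sineRHS_of_im_ne_zero {θ x : ℝ} (h0 : 0 < θ) (h1 : θ < 1)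
    (hx : 0 < x) (hne : ∀ (d : ℕ+) (m : ℕ), (d : ℝ) * (m + θ) ≠ x)
    (hne' : ∀ (d : ℕ+) (m : ℕ), (d : ℝ) * (m + (1 - θ)) ≠ x) (N : ℕ) {ν : ℂ} (hν : -1 < ν.re)
    (hN : ν.re < 2 * N + 1) (him : ν.im ≠ 0) :
    4 * π * mellin (productKernel θ x) ν = sineRHS ν N θ x := by
  have hlin : IsLinearMap ℝ fun z : ℂ => ν.im * z.im :=
    ⟨fun a b => by rw [Complex.add_im]; ring, fun c a => by simp; ring⟩
  -- The half-strip on the side of the real axis containing `ν`: convex, free of integers, and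
  -- meeting `0 < Re z < 1`, where the identity is known.
  set U : Set ℂ := Complex.re ⁻¹' Ioo (-1) (2 * N + 1) ∩ {z | 0 < ν.im * z.im} with hUdef
  have hUo : IsOpen U := (isOpen_Ioo.preimage Complex.continuous_re).inter
    (isOpen_lt continuous_const (continuous_const.mul Complex.continuous_im))
  have hUc : Convex ℝ U := ((convex_Ioo _ _).linear_preimage Complex.reLm).inter
    (convex_halfSpace_gt hlin 0)
  have himU (z : ℂ) (hz : z ∈ U) : z.im ≠ 0 := by
    intro h
    have := hz.2
    simp [h] at this
  have hsq : 0 < ν.im * ν.im := mul_self_pos.mpr him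
  have hbase : (⟨1 / 2, ν.im⟩ : ℂ) ∈ U :=
    ⟨⟨by norm_num, by simp only; linarith [N.cast_nonneg (α := ℝ)]⟩, hsq⟩
  refine AnalyticOnNhd.eqOn_of_preconnected_of_eventuallyEq
    (f := fun ν => 4 * π * mellin (productKernel θ x) ν) (g := fun ν => sineRHS ν N θ x)
    (DifferentiableOn.analyticOnNhd ?_ hUo) (DifferentiableOn.analyticOnNhd ?_ hUo)
    hUc.isPreconnected hbase ?_ (show ν ∈ U from ⟨⟨hν, hN⟩, hsq⟩)
  · exact ((differentiable_mellin_productKernel h0 h1 hx).const_mul _).differentiableOn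
  · exact fun z hz => (differentiableAt_sineRHS h0 h1 hx hne hne' N hz.1.1 hz.1.2
      (ne_intCast_of_im_ne_zero (himU z hz))).differentiableWithinAt
  · filter_upwards [(isOpen_Ioo.preimage Complex.continuous_re).mem_nhds
      (show (⟨1 / 2, ν.im⟩ : ℂ) ∈ Complex.re ⁻¹' Ioo 0 1 from ⟨by norm_num, by norm_num⟩)]
      with z hz
    exact mellin_productKernel_eq_sineRHS_of_re_mem_Ioo h0 h1 hx hne hne' N hz.1 hz.2

/-- A real non-integer order is the limit of `ν + iτ` as `τ → 0⁺`, and both sides are continuous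
there. -/
theorem mellin_productKernel_eq_sineRHS {θ x : ℝ} (h0 : 0 < θ) (h1 : θ < 1)
    (hx : 0 < x) (hne : ∀ (d : ℕ+) (m : ℕ), (d : ℝ) * (m + θ) ≠ x)
    (hne' : ∀ (d : ℕ+) (m : ℕ), (d : ℝ) * (m + (1 - θ)) ≠ x) (N : ℕ) {ν : ℂ} (hν : -1 < ν.re)
    (hN : ν.re < 2 * N + 1) (hint : ∀ k : ℤ, ν ≠ k) :
    4 * π * mellin (productKernel θ x) ν = sineRHS ν N θ x := by
  by_cases him : ν.im ≠ 0
  · exact mellin_productKernel_eq_sineRHS_of_im_ne_zero h0 h1 hx hne hne' N hν hN him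
  rw [not_not] at him
  have hpath : Tendsto (fun τ : ℝ => ν + τ * Complex.I) (𝓝[>] 0) (𝓝 ν) := by
    have h : Continuous fun τ : ℝ => ν + τ * Complex.I := by fun_prop
    have h2 := h.tendsto 0
    simp only [Complex.ofReal_zero, zero_mul, add_zero] at h2
    exact h2.mono_left nhdsWithin_le_nhds
  refine tendsto_nhds_unique_of_eventuallyEq
    ((((differentiable_mellin_productKernel h0 h1 hx).const_mul
      (4 * π : ℂ)).continuous.tendsto ν).comp hpath)
    ((differentiableAt_sineRHS h0 h1 hx hne hne' N hν hN hint).continuousAt.tendsto.comp hpath) ?_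
  filter_upwards [self_mem_nhdsWithin] with τ hτ
  refine mellin_productKernel_eq_sineRHS_of_im_ne_zero h0 h1 hx hne hne' N ?_ ?_ ?_
  · simpa using hν
  · simpa using hN
  · simpa [him] using (ne_of_gt hτ : τ ≠ 0)

/-- The identity with `sin (2πdθ)`, for every order of nonnegative real part. -/
theorem sineIdentity {ν : ℂ} (hν : ∀ k : ℤ, ν ≠ k) (hre : 0 ≤ ν.re) {N : ℕ}
    (hN : ν.re < 2 * N + 1) {θ x : ℝ} (h0 : 0 < θ) (h1 : θ < 1) (hx : 0 < x)
    (hne : ∀ (d : ℕ+) (m : ℕ), (d : ℝ) * (m + θ) ≠ x)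
    (hne' : ∀ (d : ℕ+) (m : ℕ), (d : ℝ) * (m + (1 - θ)) ≠ x) : SineIdentity ν N θ x := by
  refine ⟨summable_sineSeriesTerm hre hν θ hx,
    summable_remainderTerm h0 h1 hx hne hne' N (by linarith) hN, ?_⟩
  rw [tsum_sineSeriesTerm hre hν θ hx,
    mellin_productKernel_eq_sineRHS h0 h1 hx hne hne' N (by linarith) hN hν, sineRHS]

theorem mul_add_one_sub_ne_of_notMem_excludedSet {θ x : ℝ} (h : x ∉ excludedSet θ 0) (d : ℕ+)
    (m : ℕ) : (d : ℝ) * (m + (1 - θ)) ≠ x := by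
  rintro rfl
  refine h ⟨m + 1, d, m.succ_pos, d.pos, ?_⟩
  push_cast
  ring

/-- The hypothesis on `N` enters only as this convergence condition for the double series. -/
theorem re_lt_of_floor_le {ν : ℂ} {N : ℕ} (hN : ⌊(ν.re + 1) / 2⌋ ≤ (N : ℤ)) :
    ν.re < 2 * N + 1 := by
  have h : (ν.re + 1) / 2 < N + 1 := by
    have h1 := Int.lt_floor_add_one ((ν.re + 1) / 2)
    have h2 : ((⌊(ν.re + 1) / 2⌋ : ℤ) : ℝ) ≤ N := by exact_mod_cast hN
    linarith
  linarith

/-! ### Odd primitive Dirichlet characters -/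

theorem odd_inv {q : ℕ} {χ : DirichletCharacter ℂ q} (hχ : χ.Odd) : χ⁻¹.Odd := by
  rw [DirichletCharacter.Odd, MulChar.inv_apply_eq_inv', hχ, inv_neg, inv_one]

theorem isPrimitive_inv {q : ℕ} {χ : DirichletCharacter ℂ q} (hχ : χ.IsPrimitive) :
    χ⁻¹.IsPrimitive := by
  rw [DirichletCharacter.isPrimitive_def, DirichletCharacter.conductor_inv]
  exact hχ

theorem apply_zero_of_odd {q : ℕ} {ψ : DirichletCharacter ℂ q} (hψ : ψ.Odd) : ψ 0 = 0 := by
  have h := DirichletCharacter.Odd.eval_neg ψ 0 hψ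
  rw [neg_zero] at h
  exact self_eq_neg.mp h

/-- The discrete Fourier transform of a primitive `ψ` is a multiple of its Gauss sum. If that were
zero, injectivity of the transform would force `ψ = 0`, against `ψ(1) = 1`. -/
theorem gaussSum_ne_zero_of_isPrimitive {q : ℕ} [NeZero q] {ψ : DirichletCharacter ℂ q}
    (hψ : ψ.IsPrimitive) : gaussSum ψ ZMod.stdAddChar ≠ 0 := by
  intro h
  have h0 : ZMod.dft (ψ : ZMod q → ℂ) = 0 := by
    funext k
    rw [hψ.fourierTransform_eq_inv_mul_gaussSum, h, mul_zero, Pi.zero_apply]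
  have h1 := congrFun ((LinearEquiv.map_eq_zero_iff _).mp h0) 1
  simp at h1

theorem sum_char_mul_hurwitzDiff {q : ℕ} [NeZero q] {ψ : DirichletCharacter ℂ q} (hψ : ψ.Odd)
    (s : ℂ) : ∑ j : ZMod q, ψ j * hurwitzDiff (j.val / q) s
      = 2 * (q : ℂ) ^ s * DirichletCharacter.LFunction ψ s := by
  have hq : (q : ℂ) ≠ 0 := by exact_mod_cast NeZero.ne q
  have hqs : (q : ℂ) ^ s ≠ 0 := by
    rw [Ne, Complex.cpow_eq_zero_iff]
    exact fun h => hq h.1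
  rw [DirichletCharacter.LFunction, ZMod.LFunction_def_odd hψ.to_fun, Complex.cpow_neg,
    ← mul_assoc, mul_assoc 2, mul_inv_cancel₀ hqs, mul_one, Finset.mul_sum]
  refine Finset.sum_congr rfl fun j _ => ?_
  rw [hurwitzDiff_eq_two_mul, ZMod.toAddCircle_apply]
  ring

/-- Split the sine into exponentials at `n` and `-n`. Each gives a shifted Gauss sum, and by oddness
the two contributions add. -/
theorem sum_char_mul_sin {q : ℕ} [NeZero q] {ψ : DirichletCharacter ℂ q} (hψ : ψ.IsPrimitive)
    (hodd : ψ.Odd) (n : ℕ) :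
    ∑ j : ZMod q, ψ j * ((Real.sin (2 * π * n * (j.val / q)) : ℝ) : ℂ)
      = -Complex.I * gaussSum ψ ZMod.stdAddChar * ψ⁻¹ (n : ZMod q) := by
  have h (a : ℤ) : ∑ j : ZMod q, ψ j * Complex.exp (2 * π * Complex.I * (a * j.val) / q)
      = ψ⁻¹ (a : ZMod q) * gaussSum ψ ZMod.stdAddChar := by
    rw [← gaussSum_mulShift_of_isPrimitive _ hψ, gaussSum]
    refine Finset.sum_congr rfl fun j _ => ?_
    rw [AddChar.mulShift_apply]
    have := ZMod.stdAddChar_coe (N := q) (a * j.val)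
    push_cast [ZMod.natCast_zmod_val] at this
    rw [this]
  have h1 := h n
  have h2 := h (-n)
  have h3 : ψ⁻¹ ((-n : ℤ) : ZMod q) = -ψ⁻¹ (n : ZMod q) := by
    rw [← DirichletCharacter.Odd.eval_neg _ _ (odd_inv hodd)]
    push_cast
    rfl
  rw [h3] at h2
  rw [Int.cast_natCast, Int.cast_natCast] at h1
  have h4 (j : ZMod q) : ψ j * ((Real.sin (2 * π * n * (j.val / q)) : ℝ) : ℂ)
      = Complex.I / 2 * (ψ j * Complex.exp (2 * π * Complex.I * (((-n : ℤ) : ℂ) * j.val) / q))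
        - Complex.I / 2 * (ψ j * Complex.exp (2 * π * Complex.I * ((n : ℂ) * j.val) / q)) := by
    rw [Complex.ofReal_sin, Complex.sin]
    push_cast
    rw [show -(2 * (π : ℂ) * n * (j.val / q)) * Complex.I
        = 2 * π * Complex.I * (-n * j.val) / q by ring,
      show 2 * (π : ℂ) * n * (j.val / q) * Complex.I = 2 * π * Complex.I * (n * j.val) / q by ring]
    ring
  simp only [h4]
  rw [Finset.sum_sub_distrib, ← Finset.mul_sum, ← Finset.mul_sum, h1, h2]
  ring

theorem charTerm_eq_sum {q : ℕ} [NeZero q] {χ : DirichletCharacter ℂ q} (hχ : χ.IsPrimitive)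
    (hodd : χ.Odd) (ν : ℂ) (x : ℝ) (n : ℕ+) :
    charTerm ν χ x n = Complex.I / gaussSum χ⁻¹ ZMod.stdAddChar *
      ∑ j : ZMod q, χ⁻¹ j * sineSeriesTerm ν (j.val / q) x n := by
  have hτ := gaussSum_ne_zero_of_isPrimitive (isPrimitive_inv hχ)
  have h (d : ℕ) : χ (d : ZMod q) = Complex.I / gaussSum χ⁻¹ ZMod.stdAddChar *
      ∑ j : ZMod q, χ⁻¹ j * ((Real.sin (2 * π * d * (j.val / q)) : ℝ) : ℂ) := by
    rw [sum_char_mul_sin (isPrimitive_inv hχ) (odd_inv hodd), inv_inv]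
    field_simp
    rw [Complex.I_sq]
    ring
  simp only [charTerm, sineSeriesTerm, h, Finset.mul_sum, Finset.sum_mul]
  rw [Finset.sum_comm]
  refine Finset.sum_congr rfl fun j _ => Finset.sum_congr rfl fun d _ => ?_
  ring

/-- The general functional equation involves the transforms of `ψ` and of `j ↦ ψ(-j)`. For odd
primitive `ψ` these are opposite multiples of `ψ⁻¹`, so the exponentials combine into a sine. -/
theorem LFunction_one_sub_of_odd {q : ℕ} [NeZero q] {ψ : DirichletCharacter ℂ q}
    (hψ : ψ.IsPrimitive) (hodd : ψ.Odd) {s : ℂ} (hs : ∀ n : ℕ, s ≠ -n) :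
    DirichletCharacter.LFunction ψ (1 - s) = (q : ℂ) ^ (s - 1) * (2 * π) ^ (-s) *
      Complex.Gamma s * (-2 * Complex.I * Complex.sin (π * s / 2)) *
      gaussSum ψ ZMod.stdAddChar * DirichletCharacter.LFunction ψ⁻¹ s := by
  set τ := gaussSum ψ ZMod.stdAddChar with hτ
  have hmul (c : ℂ) :
      ZMod.LFunction (fun k => c * ψ⁻¹ k) s = c * DirichletCharacter.LFunction ψ⁻¹ s := by
    simp only [DirichletCharacter.LFunction, ZMod.LFunction, Finset.mul_sum]
    refine Finset.sum_congr rfl fun j _ => ?_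
    ring
  have h1 (k : ZMod q) : ZMod.dft ψ k = -τ * ψ⁻¹ k := by
    rw [hψ.fourierTransform_eq_inv_mul_gaussSum,
      DirichletCharacter.Odd.eval_neg _ _ (odd_inv hodd)]
    ring
  have h2 (k : ZMod q) : ZMod.dft (fun j : ZMod q => ψ (-j)) k = τ * ψ⁻¹ k := by
    rw [ZMod.dft_comp_neg]
    simp only
    rw [h1, DirichletCharacter.Odd.eval_neg _ _ (odd_inv hodd)]
    ring
  have h := ZMod.LFunction_one_sub ψ hs (Or.inl (apply_zero_of_odd hodd))
  rw [funext h1, funext h2, hmul, hmul] at h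
  rw [DirichletCharacter.LFunction, h, Complex.sin,
    show -(π * s / 2) * Complex.I = -π * Complex.I * s / 2 by ring,
    show π * s / 2 * Complex.I = π * Complex.I * s / 2 by ring]
  linear_combination ((q : ℂ) ^ (s - 1) * (2 * π) ^ (-s) * Complex.Gamma s * τ *
    DirichletCharacter.LFunction ψ⁻¹ s * (Complex.exp (-π * Complex.I * s / 2)
    - Complex.exp (π * Complex.I * s / 2))) * Complex.I_mul_I

/-! ### The identity for odd primitive characters -/

/-- The summand `d^{-ν} ψ(r) ((dr)^{ν+1-2N} - X^{ν+1-2N}) / (dr ((dr)² - X²))`. -/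
def charPairTerm {q : ℕ} (ν : ℂ) (N : ℕ) (ψ : DirichletCharacter ℂ q) (X : ℝ) (d r : ℕ) : ℂ :=
  (d : ℂ) ^ (-ν) * ψ (r : ZMod q) *
    ((((d * r : ℕ) : ℂ) ^ (ν + 1 - 2 * N) - (X : ℂ) ^ (ν + 1 - 2 * N))
      / ((d * r : ℕ) * (((d * r : ℕ) : ℂ) ^ 2 - (X : ℂ) ^ 2)))

theorem charRemainderTerm_eq_sum {q : ℕ} (ν : ℂ) (N : ℕ) (ψ : DirichletCharacter ℂ q) (X : ℝ)
    (n : ℕ+) : charRemainderTerm ν N ψ X n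
      = ∑ p ∈ (n : ℕ).divisorsAntidiagonal, charPairTerm ν N ψ X p.1 p.2 := by
  rw [charRemainderTerm, ← Nat.sum_divisorsAntidiagonal (n := n)
    fun d r => (d : ℂ) ^ (-ν) * ψ (r : ZMod q), Finset.sum_mul]
  refine Finset.sum_congr rfl fun p hp => ?_
  rw [charPairTerm, (Nat.mem_divisorsAntidiagonal.mp hp).1]

/-- Put `r = j + qm`, so `m + j/q = r/q`. Clearing `q` gives `q^{-(ν+1-2N)}` from the numerator and
`q³` from the denominator. -/
theorem mul_remainderPart_eq_charPairTerm {q : ℕ} [NeZero q] (ν : ℂ) (N : ℕ)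
    {ψ : DirichletCharacter ℂ q} (hodd : ψ.Odd) {x : ℝ} (hx : 0 < x) (d : ℕ+) (m : ℕ)
    (j : ZMod q) :
    ψ j * ((d : ℂ) ^ (-ν - 1) * remainderPart ν N x d (m + j.val / q))
      = (q : ℂ) ^ (2 * N + 2 - ν) * charPairTerm ν N ψ (q * x) d (j.val + q * m) := by
  have hψ : ψ ((j.val + q * m : ℕ) : ZMod q) = ψ j := by
    push_cast
    rw [ZMod.natCast_self, zero_mul, add_zero, ZMod.natCast_zmod_val]
  rw [charPairTerm, hψ]
  rcases eq_or_ne j 0 with rfl | hj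
  · rw [apply_zero_of_odd hodd]
    ring
  have hq0 : (0 : ℝ) < q := by exact_mod_cast NeZero.pos q
  have hq : (q : ℂ) ≠ 0 := by exact_mod_cast NeZero.ne q
  have hd0 : (0 : ℝ) < d := by positivity
  have hd : (d : ℂ) ≠ 0 := by exact_mod_cast d.ne_zero
  have hj0 : 0 < j.val := (ZMod.val_pos).mpr hj
  set r : ℕ := j.val + q * m with hr
  have hr0 : 0 < r := by omega
  have hrR : (0 : ℝ) < r := by exact_mod_cast hr0
  have hrC : (r : ℂ) ≠ 0 := by exact_mod_cast hr0.ne'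
  have hy : (m : ℝ) + j.val / q = (q : ℝ)⁻¹ * r := by
    rw [hr]
    push_cast
    field_simp
    ring
  set a : ℂ := ν + 1 - 2 * N with ha
  have e1 : ((d * ((q : ℝ)⁻¹ * r) : ℝ) : ℂ) ^ a
      = (((q : ℝ)⁻¹ : ℝ) : ℂ) ^ a * ((d * r : ℕ) : ℂ) ^ a := by
    rw [show (d : ℝ) * ((q : ℝ)⁻¹ * r) = (q : ℝ)⁻¹ * (d * r : ℝ) by ring, Complex.ofReal_mul,
      Complex.mul_cpow_ofReal_nonneg (by positivity) (by positivity)]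
    push_cast
    rfl
  have e2 : (x : ℂ) ^ a = (((q : ℝ)⁻¹ : ℝ) : ℂ) ^ a * ((q * x : ℝ) : ℂ) ^ a := by
    rw [← Complex.mul_cpow_ofReal_nonneg (by positivity) (by positivity), ← Complex.ofReal_mul,
      inv_mul_cancel_left₀ hq0.ne']
  have e3 : (((q : ℝ)⁻¹ : ℝ) : ℂ) ^ a = (q : ℂ) ^ (-a) := by
    rw [Complex.ofReal_inv, Complex.ofReal_natCast, Complex.cpow_neg, Complex.inv_cpow]
    rw [Complex.natCast_arg]
    exact Real.pi_pos.ne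
  have e4 : (q : ℂ) ^ (2 * N + 2 - ν) = (q : ℂ) ^ 3 * (q : ℂ) ^ (-a) := by
    rw [← Complex.cpow_natCast, ← Complex.cpow_add _ _ hq]
    congr 1
    rw [ha]
    push_cast
    ring
  have e5 : (((q : ℝ)⁻¹ * r * ((d : ℝ) ^ 2 * ((q : ℝ)⁻¹ * r) ^ 2 - x ^ 2) : ℝ) : ℂ)
      = ((q : ℂ) ^ 3)⁻¹ * (r * (((d * r : ℕ) : ℂ) ^ 2 - ((q * x : ℝ) : ℂ) ^ 2)) := by
    push_cast
    field_simp
  rw [remainderPart, hy, e1, e2, e3, e4, e5, Complex.cpow_sub _ _ hd, Complex.cpow_one,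
    ← mul_sub]
  generalize ((d * r : ℕ) : ℂ) ^ a - ((q * x : ℝ) : ℂ) ^ a = A
  generalize hB : ((d * r : ℕ) : ℂ) ^ 2 - ((q * x : ℝ) : ℂ) ^ 2 = B
  rcases eq_or_ne B 0 with h0 | h0
  · simp [h0]
  · push_cast
    field_simp

/-- The equivalence of `ℤ/q × (ℕ+ × ℕ)` with `ℕ+ × ℕ` given by `(j, (d, m)) ↦ (d, j + qm)`. -/
def residuePairEquiv (q : ℕ) [NeZero q] : ZMod q × (ℕ+ × ℕ) ≃ ℕ+ × ℕ where
  toFun p := (p.2.1, (Nat.residueClassesEquiv q).symm (p.1, p.2.2))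
  invFun p := ((Nat.residueClassesEquiv q p.2).1, (p.1, (Nat.residueClassesEquiv q p.2).2))
  left_inv p := by simp
  right_inv p := by simp

theorem mul_add_val_div_ne {q : ℕ} [NeZero q] {x : ℝ} (hne : ∀ n : ℕ, 0 < n → (q : ℝ) * x ≠ n)
    {j : ZMod q} (hj : j ≠ 0) (d : ℕ+) (m : ℕ) : (d : ℝ) * (m + j.val / q) ≠ x := by
  have hq0 : (0 : ℝ) < q := by exact_mod_cast NeZero.pos q
  have hj0 : 0 < j.val := (ZMod.val_pos).mpr hj
  rintro rfl
  refine hne (d * (j.val + q * m)) (by positivity) ?_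
  push_cast
  field_simp
  ring

/-- The numbers `j + qm` run once through all naturals, so the sum over residues merges with the sum
over `m`; `r = 0` drops out because `ψ(0) = 0`. -/
theorem hasSum_charPairTerm {q : ℕ} [NeZero q] {ν : ℂ} {N : ℕ} (hν : -1 ≤ ν.re)
    (hN : ν.re < 2 * N + 1) {ψ : DirichletCharacter ℂ q} (hodd : ψ.Odd) {x : ℝ} (hx : 0 < x)
    (hne : ∀ n : ℕ, 0 < n → (q : ℝ) * x ≠ n) :
    HasSum (fun p : ℕ+ × ℕ+ => (q : ℂ) ^ (2 * N + 2 - ν) * charPairTerm ν N ψ (q * x) p.1 p.2)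
      (∑ j : ZMod q, ψ j * ∑' p : ℕ+ × ℕ,
        (p.1 : ℂ) ^ (-ν - 1) * remainderPart ν N x p.1 (p.2 + j.val / q)) := by
  have hq0 : (0 : ℝ) < q := by exact_mod_cast NeZero.pos q
  have hsum (j : ZMod q) : Summable fun p : ℕ+ × ℕ =>
      ψ j * ((p.1 : ℂ) ^ (-ν - 1) * remainderPart ν N x p.1 (p.2 + j.val / q)) := by
    rcases eq_or_ne j 0 with rfl | hj
    · simpa only [apply_zero_of_odd hodd, zero_mul] using summable_zero
    · have hj0 : (0 : ℝ) < j.val := by exact_mod_cast (ZMod.val_pos).mpr hj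
      exact (summable_remainderPart (div_pos hj0 hq0) hx (mul_add_val_div_ne hne hj) N hν
        hN).mul_left _
  have htot : Summable fun p : ZMod q × (ℕ+ × ℕ) =>
      ψ p.1 * ((p.2.1 : ℂ) ^ (-ν - 1) * remainderPart ν N x p.2.1 (p.2.2 + p.1.val / q)) := by
    refine Summable.of_norm ((summable_prod_of_nonneg fun p => norm_nonneg _).mpr
      ⟨fun j => (hsum j).norm, Summable.of_finite⟩)
  have hval : ∑' p : ZMod q × (ℕ+ × ℕ),
      ψ p.1 * ((p.2.1 : ℂ) ^ (-ν - 1) * remainderPart ν N x p.2.1 (p.2.2 + p.1.val / q))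
      = ∑ j : ZMod q, ψ j * ∑' p : ℕ+ × ℕ,
        (p.1 : ℂ) ^ (-ν - 1) * remainderPart ν N x p.1 (p.2 + j.val / q) := by
    rw [htot.tsum_prod, tsum_fintype]
    exact Finset.sum_congr rfl fun j _ => by simp only [tsum_mul_left]
  have h1 := htot.hasSum
  rw [hval] at h1
  have h2 : HasSum (fun p : ℕ+ × ℕ =>
      (q : ℂ) ^ (2 * N + 2 - ν) * charPairTerm ν N ψ (q * x) p.1 p.2) _ :=
    (residuePairEquiv q).hasSum_iff.mp (h1.congr_fun fun p =>
      (mul_remainderPart_eq_charPairTerm ν N hodd hx p.2.1 p.2.2 p.1).symm)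
  refine (Function.Injective.hasSum_iff (g := fun p : ℕ+ × ℕ+ => ((p.1, (p.2 : ℕ)) : ℕ+ × ℕ))
    ?_ ?_).mpr h2
  · rintro ⟨a, b⟩ ⟨c, d⟩ h
    simpa using h
  · rintro ⟨d, r⟩ h
    rcases Nat.eq_zero_or_pos r with rfl | hr
    · rw [charPairTerm, Nat.cast_zero, apply_zero_of_odd hodd]
      ring
    · exact absurd ⟨(d, ⟨r, hr⟩), rfl⟩ h

theorem hasSum_charRemainderTerm {q : ℕ} [NeZero q] {ν : ℂ} {N : ℕ} (hν : -1 ≤ ν.re)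
    (hN : ν.re < 2 * N + 1) {ψ : DirichletCharacter ℂ q} (hodd : ψ.Odd) {x : ℝ} (hx : 0 < x)
    (hne : ∀ n : ℕ, 0 < n → (q : ℝ) * x ≠ n) :
    HasSum (fun n : ℕ+ => (q : ℂ) ^ (2 * N + 2 - ν) * charRemainderTerm ν N ψ (q * x) n)
      (∑ j : ZMod q, ψ j * ∑' p : ℕ+ × ℕ,
        (p.1 : ℂ) ^ (-ν - 1) * remainderPart ν N x p.1 (p.2 + j.val / q)) := by
  refine (hasSum_divisorsAntidiagonal
    (f := fun d r => (q : ℂ) ^ (2 * N + 2 - ν) * charPairTerm ν N ψ (q * x) d r)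
    (hasSum_charPairTerm hν hN hodd hx hne)).congr_fun fun n => ?_
  rw [charRemainderTerm_eq_sum, Finset.mul_sum]

theorem val_neg_div {q : ℕ} [NeZero q] {j : ZMod q} (hj : j ≠ 0) :
    ((-j).val : ℝ) / q = 1 - j.val / q := by
  have hq0 : (q : ℝ) ≠ 0 := by exact_mod_cast NeZero.ne q
  have : NeZero j := ⟨hj⟩
  rw [ZMod.val_neg_of_ne_zero, Nat.cast_sub (ZMod.val_lt j).le]
  field_simp

/-- At `θ = j/q` the subtracted half of each term belongs to the residue `-j`. Oddness of `ψ` turns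
the difference into a sum, so each residue is counted twice. -/
theorem sum_char_mul_tsum_remainderTerm {q : ℕ} [NeZero q] {ν : ℂ} {N : ℕ} (hν : -1 ≤ ν.re)
    (hN : ν.re < 2 * N + 1) {ψ : DirichletCharacter ℂ q} (hodd : ψ.Odd) {x : ℝ} (hx : 0 < x)
    (hne : ∀ n : ℕ, 0 < n → (q : ℝ) * x ≠ n) :
    ∑ j : ZMod q, ψ j * ∑' d : ℕ+, ∑' m : ℕ, remainderTerm ν N (j.val / q) x d m
      = 2 * (q : ℂ) ^ (2 * N + 2 - ν) * ∑' n : ℕ+, charRemainderTerm ν N ψ (q * x) n := by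
  have hq0 : (0 : ℝ) < q := by exact_mod_cast NeZero.pos q
  set S : ZMod q → ℂ := fun j => ∑' p : ℕ+ × ℕ,
    (p.1 : ℂ) ^ (-ν - 1) * remainderPart ν N x p.1 (p.2 + j.val / q) with hS
  have hterm (j : ZMod q) : ψ j * ∑' d : ℕ+, ∑' m : ℕ, remainderTerm ν N (j.val / q) x d m
      = ψ j * S j + ψ (-j) * S (-j) := by
    rcases eq_or_ne j 0 with rfl | hj
    · simp [apply_zero_of_odd hodd]
    have hj' : -j ≠ 0 := neg_ne_zero.mpr hj
    have hpos {i : ZMod q} (hi : i ≠ 0) : (0 : ℝ) < i.val / q :=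
      div_pos (by exact_mod_cast (ZMod.val_pos).mpr hi) hq0
    have s1 := summable_remainderPart (hpos hj) hx (mul_add_val_div_ne hne hj) N hν hN
    have s2 := summable_remainderPart (hpos hj') hx (mul_add_val_div_ne hne hj') N hν hN
    have h := s1.hasSum.sub s2.hasSum
    have h' : HasSum (fun p : ℕ+ × ℕ => remainderTerm ν N (j.val / q) x p.1 p.2) _ :=
      h.congr_fun fun p => by rw [remainderTerm_eq, val_neg_div hj]
    rw [← h'.summable.tsum_prod, h'.tsum_eq, DirichletCharacter.Odd.eval_neg _ _ hodd]
    ring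
  have hneg : ∑ j : ZMod q, ψ (-j) * S (-j) = ∑ j : ZMod q, ψ j * S j :=
    Equiv.sum_comp (Equiv.neg (ZMod q)) fun j => ψ j * S j
  rw [Finset.sum_congr rfl fun j _ => hterm j, Finset.sum_add_distrib, hneg,
    ← (hasSum_charRemainderTerm hν hN hodd hx hne).tsum_eq, tsum_mul_left]
  ring

/-- The character identity is the combination of the identities with `sin (2πdj/q)` with the
weights `χ⁻¹ j`. -/
theorem characterIdentity_of_sineIdentity {ν : ℂ} (hν : ∀ k : ℤ, ν ≠ k) (hre : 0 ≤ ν.re) {N : ℕ}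
    (hN : ν.re < 2 * N + 1)
    (hsine : ∀ θ x : ℝ, 0 < θ → θ < 1 → 0 < x → x ∉ excludedSet θ 0 → x ∉ excludedSet (1 - θ) 0 →
      SineIdentity ν N θ x)
    {q : ℕ} [NeZero q] {χ : DirichletCharacter ℂ q} (hχ : χ.IsPrimitive) (hodd : χ.Odd) {x : ℝ}
    (hx : 0 < x) (hne : ∀ n : ℕ, 0 < n → (q : ℝ) * x ≠ n) : CharacterIdentity ν N χ x := by
  have hq0 : (0 : ℝ) < q := by exact_mod_cast NeZero.pos q
  have hq : (q : ℂ) ≠ 0 := by exact_mod_cast NeZero.ne q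
  have hxC : (x : ℂ) ≠ 0 := by exact_mod_cast hx.ne'
  have hπ : (2 * π : ℂ) ≠ 0 := by exact_mod_cast (by positivity : (2 * π : ℝ) ≠ 0)
  have hqpow (s : ℂ) : (q : ℂ) ^ s ≠ 0 := by
    rw [Ne, Complex.cpow_eq_zero_iff]
    exact fun h => hq h.1
  have hodd' := odd_inv hodd
  have hτ := gaussSum_ne_zero_of_isPrimitive (isPrimitive_inv hχ)
  have hcos := cos_pi_mul_div_two_ne_zero hν
  have hsin := sin_pi_mul_div_two_ne_zero hν
  -- If `x` lay in an excluded set for `θ = j/q`, then `qx` would be a positive integer. The residue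
  -- `0`, where `θ` would be `0`, always carries weight `χ⁻¹(0) = 0`.
  have hI (j : ZMod q) (hj : j ≠ 0) : SineIdentity ν N (j.val / q) x := by
    have hj0 : 0 < j.val := (ZMod.val_pos).mpr hj
    have hjq : j.val < q := ZMod.val_lt j
    refine hsine _ _ (div_pos (by exact_mod_cast hj0) hq0)
      ((div_lt_one hq0).mpr (by exact_mod_cast hjq)) hx ?_ ?_
    · rintro ⟨n, r, hn, hr, h⟩
      obtain ⟨n, rfl⟩ := Nat.exists_eq_add_of_lt hn
      refine hne ((n * q + (q - j.val)) * r)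
        (Nat.mul_pos (by omega) hr) ?_
      rw [h]
      push_cast [Nat.cast_sub hjq.le]
      field_simp
      ring
    · rintro ⟨n, r, hn, hr, h⟩
      obtain ⟨n, rfl⟩ := Nat.exists_eq_add_of_lt hn
      refine hne ((n * q + j.val) * r) (Nat.mul_pos (by omega) hr) ?_
      rw [h]
      push_cast
      field_simp
      ring
  have hterm (j : ZMod q) : Summable fun n => χ⁻¹ j * sineSeriesTerm ν (j.val / q) x n := by
    rcases eq_or_ne j 0 with rfl | hj
    · simpa only [apply_zero_of_odd hodd', zero_mul] using summable_zero
    · exact (hI j hj).1.mul_left _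
  have hchar := (hasSum_sum fun j (_ : j ∈ Finset.univ) => (hterm j).hasSum).mul_left
    (Complex.I / gaussSum χ⁻¹ ZMod.stdAddChar)
  simp only [← charTerm_eq_sum hχ hodd] at hchar
  refine ⟨hchar.summable, (summable_mul_left_iff (hqpow _)).mp
    (hasSum_charRemainderTerm (by linarith) hN hodd' hx hne).summable, ?_⟩
  have hident (j : ZMod q) : χ⁻¹ j * (8 * (π : ℂ) * (x : ℂ) ^ (ν / 2) *
      ∑' n : ℕ+, sineSeriesTerm ν (j.val / q) x n) = χ⁻¹ j * sineRHS ν N (j.val / q) x := by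
    rcases eq_or_ne j 0 with rfl | hj
    · rw [apply_zero_of_odd hodd', zero_mul, zero_mul]
    · rw [(hI j hj).2.2, sineRHS]
  have hL : 8 * (π : ℂ) * (x : ℂ) ^ (ν / 2) * ∑' n : ℕ+, charTerm ν χ x n
      = Complex.I / gaussSum χ⁻¹ ZMod.stdAddChar *
        ∑ j : ZMod q, χ⁻¹ j * sineRHS ν N (j.val / q) x := by
    rw [hchar.tsum_eq, ← Finset.sum_congr rfl fun j _ => hident j, ← mul_assoc,
      mul_comm _ (Complex.I / _), mul_assoc, Finset.mul_sum]
    congr 1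
    refine Finset.sum_congr rfl fun j _ => ?_
    rw [tsum_mul_left]
    ring
  have hsumRHS : ∑ j : ZMod q, χ⁻¹ j * sineRHS ν N (j.val / q) x
      = 1 / Complex.cos (π * ν / 2) * riemannZeta (ν + 1)
          * (2 * (q : ℂ) ^ (1 : ℂ) * DirichletCharacter.LFunction χ⁻¹ 1) * (x : ℂ) ^ ν
        - π / (2 * Complex.sin (π * ν / 2))
          * (2 * (q : ℂ) ^ (1 - ν) * DirichletCharacter.LFunction χ⁻¹ (1 - ν))
        + 1 / (2 * x * Complex.cos (π * ν / 2))
          * (2 * (q : ℂ) ^ (-ν) * DirichletCharacter.LFunction χ⁻¹ (-ν))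
        - 1 / Complex.cos (π * ν / 2) * ∑ j ∈ Finset.Icc 1 N, riemannZeta (2 * j)
          * (2 * (q : ℂ) ^ (2 * j - ν) * DirichletCharacter.LFunction χ⁻¹ (2 * j - ν))
          * (x : ℂ) ^ (2 * j - 1)
        - 1 / Complex.cos (π * ν / 2) * (x : ℂ) ^ (2 * N + 1) * (2 * (q : ℂ) ^ (2 * N + 2 - ν) *
          ∑' n : ℕ+, charRemainderTerm ν N χ⁻¹ (q * x) n) := by
    simp only [← sum_char_mul_hurwitzDiff hodd',
      ← sum_char_mul_tsum_remainderTerm (by linarith) hN hodd' hx hne, sineRHS]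
    simp only [mul_sub, mul_add, Finset.sum_sub_distrib, Finset.sum_add_distrib, Finset.mul_sum,
      Finset.sum_mul]
    congr 1
    · congr 1
      · congr 1
        · congr 1
          · exact Finset.sum_congr rfl fun j _ => by ring
          · exact Finset.sum_congr rfl fun j _ => by ring
        · exact Finset.sum_congr rfl fun j _ => by ring
      · rw [Finset.sum_comm]
        exact Finset.sum_congr rfl fun j _ => Finset.sum_congr rfl fun i _ => by ring
    · exact Finset.sum_congr rfl fun j _ => by ring
  -- The functional equation at `ν` and `ν + 1` replaces `L(1-ν, χ⁻¹)` and `L(-ν, χ⁻¹)` by `L(ν, χ)`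
  -- and `L(1+ν, χ)`. Its sine and cosine cancel those in the denominators.
  have f1 := LFunction_one_sub_of_odd (isPrimitive_inv hχ) hodd' (s := ν)
    fun n h => hν (-n) (by rw [h]; push_cast; rfl)
  have f2 := LFunction_one_sub_of_odd (isPrimitive_inv hχ) hodd' (s := ν + 1)
    fun n h => hν (-n - 1) (by rw [eq_sub_of_add_eq h]; push_cast; rfl)
  rw [inv_inv] at f1 f2
  rw [show 1 - (ν + 1) = -ν by ring, show (π : ℂ) * (ν + 1) / 2 = π * ν / 2 + π / 2 by ring,
    Complex.sin_add_pi_div_two, add_sub_cancel_right] at f2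
  have g1 : (q : ℂ) ^ (1 - ν) = (q : ℂ) * ((q : ℂ) ^ ν)⁻¹ := by
    rw [sub_eq_add_neg, Complex.cpow_add _ _ hq, Complex.cpow_one, Complex.cpow_neg]
  have g2 : (q : ℂ) ^ (ν - 1) = (q : ℂ) ^ ν / q := by
    rw [Complex.cpow_sub _ _ hq, Complex.cpow_one]
  have g3 (n : ℕ) : (q : ℂ) ^ (2 * (n : ℂ) - ν) = (q : ℂ) ^ (2 * n) * ((q : ℂ) ^ ν)⁻¹ := by
    rw [sub_eq_add_neg, Complex.cpow_add _ _ hq, Complex.cpow_neg, ← Complex.cpow_natCast]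
    push_cast
    rfl
  have g4 : (q : ℂ) ^ (2 * N + 2 - ν) = (q : ℂ) ^ (2 * N + 2) * ((q : ℂ) ^ ν)⁻¹ := by
    rw [show 2 * (N : ℂ) + 2 = 2 * ((N + 1 : ℕ) : ℂ) by push_cast; ring, g3]
    ring_nf
  have g5 : ((q * x : ℝ) : ℂ) ^ ν = (q : ℂ) ^ ν * (x : ℂ) ^ ν := by
    rw [Complex.ofReal_mul, Complex.mul_cpow_ofReal_nonneg hq0.le hx.le, Complex.ofReal_natCast]
  have g6 : (2 * π : ℂ) ^ (ν - 1) = (2 * π : ℂ) ^ ν / (2 * π) := by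
    rw [Complex.cpow_sub _ _ hπ, Complex.cpow_one]
  have g7 : (2 * π : ℂ) ^ (ν + 1) = (2 * π : ℂ) ^ ν * (2 * π) := by
    rw [Complex.cpow_add _ _ hπ, Complex.cpow_one]
  have hπν : (2 * π : ℂ) ^ ν ≠ 0 := by
    rw [Ne, Complex.cpow_eq_zero_iff]
    exact fun h => hπ h.1
  have hqν := hqpow ν
  have g8 : ∑ j ∈ Finset.Icc 1 N, riemannZeta (2 * j)
        * (2 * (q : ℂ) ^ (2 * (j : ℂ) - ν) * DirichletCharacter.LFunction χ⁻¹ (2 * j - ν))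
        * (x : ℂ) ^ (2 * j - 1)
      = 2 * (q : ℂ) * ((q : ℂ) ^ ν)⁻¹ * ∑ j ∈ Finset.Icc 1 N, riemannZeta (2 * j)
        * DirichletCharacter.LFunction χ⁻¹ (2 * j - ν) * ((q * x : ℝ) : ℂ) ^ (2 * j - 1) := by
    rw [Finset.mul_sum]
    refine Finset.sum_congr rfl fun j hj => ?_
    obtain ⟨i, rfl⟩ := Nat.exists_eq_add_of_le (Finset.mem_Icc.mp hj).1
    rw [g3, show 2 * (1 + i) - 1 = 2 * i + 1 by omega, Complex.ofReal_mul, Complex.ofReal_natCast]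
    ring
  rw [hL, hsumRHS, g8, f1, f2, g4, Complex.cpow_neg, Complex.cpow_neg, Complex.cpow_neg,
    g1, g2, g5, g6, g7, Complex.cpow_one, Complex.ofReal_mul, Complex.ofReal_natCast,
    add_comm 1 ν]
  generalize ∑ j ∈ Finset.Icc 1 N, riemannZeta (2 * j) * DirichletCharacter.LFunction χ⁻¹
    (2 * j - ν) * ((q : ℂ) * (x : ℂ)) ^ (2 * j - 1) = A
  generalize ∑' n : ℕ+, charRemainderTerm ν N χ⁻¹ (q * x) n = B
  generalize gaussSum χ⁻¹ ZMod.stdAddChar = τ at *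
  field_simp
  linear_combination (τ * Complex.cos (π * ν / 2) * (q : ℂ) ^ ν *
    (2 * π ^ 2 * Complex.Gamma ν * DirichletCharacter.LFunction χ ν * x
      - Complex.Gamma (ν + 1) * DirichletCharacter.LFunction χ (ν + 1))) * Complex.I_mul_I

end CohenSine

end

/-! ### The theorem -/

theorem theorem3p1 (ν : ℂ) (hν : ∀ k : ℤ, ν ≠ (k : ℂ)) (hre : 0 ≤ ν.re)
    (N : ℕ) (hN : ⌊(ν.re + 1) / 2⌋ ≤ (N : ℤ)) :
    (∀ θ x : ℝ, 0 < θ → θ < 1 → 0 < x →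
        x ∉ CohenSine.excludedSet θ 0 → x ∉ CohenSine.excludedSet (1 - θ) 0 →
        CohenSine.SineIdentity ν N θ x) ∧
    ((∀ θ x : ℝ, 0 < θ → θ < 1 → 0 < x →
        x ∉ CohenSine.excludedSet θ 0 → x ∉ CohenSine.excludedSet (1 - θ) 0 →
        CohenSine.SineIdentity ν N θ x) ↔
      (∀ (q : ℕ) [NeZero q] (χ : DirichletCharacter ℂ q) (x : ℝ),
        χ.IsPrimitive → χ.Odd → 0 < x → (∀ n : ℕ, 0 < n → (q : ℝ) * x ≠ (n : ℝ)) →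
        CohenSine.CharacterIdentity ν N χ x)) := by
  have hN' := CohenSine.re_lt_of_floor_le hN
  have hsine : ∀ θ x : ℝ, 0 < θ → θ < 1 → 0 < x →
      x ∉ CohenSine.excludedSet θ 0 → x ∉ CohenSine.excludedSet (1 - θ) 0 →
      CohenSine.SineIdentity ν N θ x := by
    intro θ x h0 h1 hx he he'
    -- Since `(m + 1) - θ = m + (1 - θ)`, the set for `θ` excludes the poles at `d(m + 1 - θ)`, and
    -- the set for `1 - θ` those at `d(m + θ)`.
    refine CohenSine.sineIdentity hν hre hN' h0 h1 hx (fun d m => ?_)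
      (CohenSine.mul_add_one_sub_ne_of_notMem_excludedSet he)
    simpa only [sub_sub_cancel] using
      CohenSine.mul_add_one_sub_ne_of_notMem_excludedSet he' d m
  -- The forward implication is a genuine derivation from the sine identities; the converse holds
  -- because its conclusion is already proved.
  exact ⟨hsine, fun h _ _ _ _ hχ hodd hx hne =>
    CohenSine.characterIdentity_of_sineIdentity hν hre hN' h hχ hodd hx hne, fun _ => hsine⟩
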